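/- **Theorem 1.5.** Let $f$ be an inner function, i.e. an analytic map of the unit disc $\mathbb{D}$ into itself whose radial limits exist and have modulus one at almost every point of $\partial\mathbb{D}$. Assume that $f(0)=0$ and that $f$ is not a rotation, and let $f^{n}$ denote the $n$-th iterate of $f$. Let $\{a_n\}_{n\ge 1}$ be a sequence of complex numbers with $\sum_{n=1}^{\infty}|a_n|^2<\infty$ and let $F=\sum_{n=1}^{\infty}a_n f^{n}$ on $\mathbb{D}$ (the series converges absolutely at each point of $\mathbb{D}$). For $\xi\in\partial\mathbb{D}$ write $F(\xi)=\lim_{r\to 1^-}F(r\xi)$, which exists for almost every $\xi$. Assume that there exists a nondegenerate arc $I\subset\partial\mathbb{D}$ on which $F$ is essentially bounded, i.e. there is a constant $M$ with $|F(\xi)|\le M$ for almost every $\xi\in I$. Then $\sum_{n=1}^{\infty}|a_n|<\infty$. -/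

import Mathlib

open Set Filter Topology MeasureTheory

/-- The point `e^{iθ}` of the unit circle. -/
noncomputable def circlePoint (θ : ℝ) : ℂ := Complex.exp (θ * Complex.I)

/-- The function `g`, defined on the open unit disc, has the radial limit `w` at the point `ξ`
of the unit circle: `g (r ξ) → w` as `r → 1`, `r < 1`. -/
def HasRadialLimit (g : ℂ → ℂ) (ξ w : ℂ) : Prop :=
  Tendsto (fun r : ℝ => g (r * ξ)) (𝓝[<] 1) (𝓝 w)

/-- Inner functions: analytic maps of the open unit disc into itself whose radial limits exist and
have modulus one at almost every point of the unit circle. Only the values of `f` on the open disc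
matter. A null set of the circle is one whose set of angles `θ` is Lebesgue null in `ℝ`. -/
structure IsInner (f : ℂ → ℂ) : Prop where
  differentiableOn : DifferentiableOn ℂ f (Metric.ball 0 1)
  mapsTo : MapsTo f (Metric.ball 0 1) (Metric.ball 0 1)
  radial : ∀ᵐ θ : ℝ, ∃ w : ℂ, HasRadialLimit f (circlePoint θ) w ∧ ‖w‖ = 1

/-- On the unit disc, `f` is the rotation `z ↦ c z` for some `c` of modulus one. -/
def IsDiscRotation (f : ℂ → ℂ) : Prop :=
  ∃ c : ℂ, ‖c‖ = 1 ∧ ∀ z ∈ Metric.ball (0 : ℂ) 1, f z = c * z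

/-- The function `F = ∑_{n ≥ 1} a_n f^n` on the open unit disc, where `f^n` is the `n`-th iterate
of `f` (the value `a 0` plays no role). If `f` is inner, is not a rotation, `f 0 = 0` and
`∑ |a_n|² < ∞`, the series converges absolutely at each point of the disc. -/
noncomputable def iterateSeries (f : ℂ → ℂ) (a : ℕ → ℂ) (z : ℂ) : ℂ :=
  ∑' n : ℕ, a (n + 1) * f^[n + 1] z

/-- The boundary function `ξ ↦ F(ξ) = lim_{r → 1} F(r ξ)` of `F` is essentially bounded on the arc
`{e^{iθ} : α < θ < β}`: for some constant `M` and almost every `ξ` of the arc, the value `F(ξ)` has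
modulus at most `M`. Nothing is assumed about the existence of the radial limits. -/
def EssBoundedOnArc (F : ℂ → ℂ) (α β : ℝ) : Prop :=
  ∃ M : ℝ, ∀ᵐ θ : ℝ, θ ∈ Ioo α β → ∀ w : ℂ, HasRadialLimit F (circlePoint θ) w → ‖w‖ ≤ M

/-! Let `T` be the boundary map of `f`, `m` normalized arc length, `a = f'(0)` and `κ = 1 - |a|²`,
which is positive because `f` is not a rotation. Since `f(0) = 0`, `T` preserves `m`. Poisson's
formula applied to products of `f`, `z` and difference quotients of `f` computes conditional
expectations given `T`: `E[ξ | T] = ā T` and `E[ξ² | T] = ā₂ T + ā² T²`, where `a₂` is the second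
Taylor coefficient of `f`. So `d = ξ - ā T` satisfies `E[d | T] = 0`, `E[|d|² | T] = κ`, `E[d² | T]
= ā₂ T`, with `|a₂| ≤ κ`. The functions `d ∘ T^n` are bounded reverse martingale differences.

Summation by parts turns `∑ aₙ T^n` into `∑ bₙ d ∘ T^(n+1)`, where `b` is the convolution of the
coefficients with the powers of `ā`. Square summability passes from the coefficients to `b`, and
absolute summability passes back, so it suffices to bound `∑ |bₙ|`.

If `F` were bounded on the whole circle, one would integrate it against Riesz products `Q = ∏ (1 +
Re(cₙ \bar d(T^n)) / 4)` with `cₙ bₙ = |bₙ|`. These are nonnegative with mean one, and `Re ∫ bₙ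
d(T^n) Q ≥ κ |bₙ| / 16` (`le_re_mul_integral_boundaryDiff_mul_rieszProduct`). The term in `d²` is
harmless because `|a₂| ≤ κ` and the mean of `ξ` against `Q` is at most `1/2`.

To localize to an arc, `Q ∘ T^(K+1)` is multiplied by a tent function `φ` supported in the arc. By
the Schwarz lemma `f^n → 0` uniformly on compact sets, whence `∫ φ · H ∘ T^n` is close to `∫ φ ∫ H`,
with an error small relative to the `L¹` norm of `H`
(`exists_forall_norm_integral_mul_iterate_sub_le`). The uniformity in `H` allows `K` to be fixed
before the length of the Riesz product. In `sum_norm_le_of_bounded` the terms before the block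
contribute a fixed constant, the block gives the lower bound, and the tail is controlled in `L¹` by
the `ℓ²` norm of `b`. Fatou's theorem identifies the `L¹` sum of the series with the radial limits
of `F`. -/

open scoped ComplexConjugate

/-! ### Normalized arc length on the unit circle -/

noncomputable instance Circle.instMeasurableSpaceBorel : MeasurableSpace Circle := borel Circle

instance Circle.instBorelSpaceBorel : BorelSpace Circle := ⟨rfl⟩

/-- Normalized arc length on the unit circle. -/
noncomputable def circleMeasure : Measure Circle :=
  (ENNReal.ofReal (2 * Real.pi)⁻¹) •
    (volume.restrict (Ioc (-Real.pi) Real.pi)).map (fun t : ℝ => Circle.exp t)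

theorem measurable_circleExp : Measurable (fun t : ℝ => Circle.exp t) :=
  Circle.exp.continuous.measurable

theorem measurable_circleCoe : Measurable (fun ξ : Circle => (ξ : ℂ)) :=
  (by fun_prop : Continuous fun ξ : Circle => (ξ : ℂ)).measurable

theorem coe_circleExp_eq_circlePoint (t : ℝ) : (Circle.exp t : ℂ) = circlePoint t := by
  simp [circlePoint, Circle.coe_exp]

instance : IsProbabilityMeasure circleMeasure := by
  constructor
  rw [circleMeasure, Measure.smul_apply, Measure.map_apply measurable_circleExp MeasurableSet.univ]
  have h : (0 : ℝ) < 2 * Real.pi := by positivity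
  simp only [preimage_univ, Measure.restrict_apply MeasurableSet.univ, univ_inter, Real.volume_Ioc,
    smul_eq_mul]
  rw [← ENNReal.ofReal_mul (by positivity), show Real.pi - -Real.pi = 2 * Real.pi by ring,
    inv_mul_cancel₀ h.ne', ENNReal.ofReal_one]

theorem ofReal_two_pi_inv_ne_zero : ENNReal.ofReal (2 * Real.pi)⁻¹ ≠ 0 := by
  have : (0 : ℝ) < (2 * Real.pi)⁻¹ := by positivity
  simpa using this

/-- A property that holds at almost every angle holds at almost every point of the circle. -/
theorem ae_circleMeasure_of_ae {p : Circle → Prop} (h : ∀ᵐ t : ℝ, p (Circle.exp t)) :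
    ∀ᵐ ξ ∂circleMeasure, p ξ := by
  rw [ae_iff] at h ⊢
  set S : Set Circle := {ξ | ¬ p ξ}
  set N := toMeasurable volume {t : ℝ | ¬ p (Circle.exp t)}
  have hN : volume N = 0 := by rw [measure_toMeasurable]; exact h
  have harg : Measurable (fun ξ : Circle => Complex.arg ξ) :=
    Complex.measurable_arg.comp measurable_circleCoe
  have hsub : S ⊆ (fun ξ : Circle => Complex.arg ξ) ⁻¹' N := by
    intro ξ hξ
    apply subset_toMeasurable
    change ¬ p (Circle.exp (Complex.arg ξ))
    rw [Circle.exp_arg]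
    exact hξ
  refine measure_mono_null hsub ?_
  have hm : MeasurableSet ((fun ξ : Circle => Complex.arg ξ) ⁻¹' N) :=
    harg (measurableSet_toMeasurable _ _)
  rw [circleMeasure, Measure.smul_apply, Measure.map_apply measurable_circleExp hm,
    Measure.restrict_apply (measurable_circleExp hm)]
  have : (fun t : ℝ => Circle.exp t) ⁻¹' ((fun ξ : Circle => Complex.arg ξ) ⁻¹' N) ∩
      Ioc (-Real.pi) Real.pi ⊆ N := by
    rintro t ⟨ht, h1, h2⟩
    have ht' : Complex.arg (Circle.exp t) ∈ N := ht
    rwa [Circle.arg_exp h1 h2] at ht'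
  rw [measure_mono_null this hN, smul_zero]

/-- A property that holds at almost every point of the circle holds at almost every angle of
`(-π, π]`. -/
theorem ae_restrict_of_ae_circleMeasure {p : Circle → Prop} (h : ∀ᵐ ξ ∂circleMeasure, p ξ) :
    ∀ᵐ t ∂volume.restrict (Ioc (-Real.pi) Real.pi), p (Circle.exp t) := by
  refine ae_of_ae_map measurable_circleExp.aemeasurable ?_
  rw [circleMeasure] at h
  rw [ae_iff, Measure.smul_apply, smul_eq_mul, mul_eq_zero] at h
  exact ae_iff.2 (h.resolve_left ofReal_two_pi_inv_ne_zero)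

theorem integral_circleMeasure {E : Type*} [NormedAddCommGroup E] [NormedSpace ℝ E]
    {g : Circle → E} (hg : AEStronglyMeasurable g circleMeasure) :
    ∫ ξ, g ξ ∂circleMeasure =
      (2 * Real.pi)⁻¹ • ∫ t in (-Real.pi)..Real.pi, g (Circle.exp t) := by
  have h1 : AEStronglyMeasurable g
      ((volume.restrict (Ioc (-Real.pi) Real.pi)).map (fun t : ℝ => Circle.exp t)) := by
    rw [circleMeasure] at hg
    exact hg.mono_ac (Measure.absolutelyContinuous_smul ofReal_two_pi_inv_ne_zero)
  rw [intervalIntegral.integral_of_le (by linarith [Real.pi_pos]), circleMeasure,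
    integral_smul_measure, integral_map measurable_circleExp.aemeasurable h1,
    ENNReal.toReal_ofReal (by positivity)]

theorem integrable_circleMeasure {E : Type*} [NormedAddCommGroup E]
    {g : Circle → E} (hg : Integrable g circleMeasure) :
    IntegrableOn (fun t : ℝ => g (Circle.exp t)) (Ioc (-Real.pi) Real.pi) := by
  rw [circleMeasure, integrable_smul_measure ofReal_two_pi_inv_ne_zero ENNReal.ofReal_ne_top] at hg
  exact hg.comp_measurable measurable_circleExp

theorem integral_circleMeasure_eq_circleAverage {g : ℂ → ℂ}
    (hg : AEStronglyMeasurable (fun ξ : Circle => g ξ) circleMeasure) :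
    ∫ ξ : Circle, g ξ ∂circleMeasure = Real.circleAverage g 0 1 := by
  rw [integral_circleMeasure hg, Real.circleAverage]
  congr 1
  have hp : (fun t : ℝ => g (circleMap 0 1 t)).Periodic (2 * Real.pi) := fun x => by
    simp only [periodic_circleMap 0 1 x]
  have := hp.intervalIntegral_add_eq (-Real.pi) 0
  rw [show -Real.pi + 2 * Real.pi = Real.pi by ring, zero_add] at this
  rw [← this]
  simp [circleMap, Circle.coe_exp]

theorem integrable_circleMeasure_of_continuous {E : Type*} [NormedAddCommGroup E]
    {g : Circle → E} (hg : Continuous g) : Integrable g circleMeasure :=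
  hg.integrable_of_hasCompactSupport (HasCompactSupport.of_compactSpace g)

/-! ### Density of trigonometric polynomials -/

/-- The monomial `ξ ↦ ξ ^ k` on the circle. -/
noncomputable def circleMonomial (k : ℤ) : C(Circle, ℂ) :=
  ⟨fun ξ => ((ξ ^ k : Circle) : ℂ),
    (by fun_prop : Continuous fun ξ : Circle => (ξ : ℂ)).comp (continuous_zpow k)⟩

/-- Stone–Weierstrass: the monomials are closed under products and conjugation, so the star algebra
they generate is their linear span, and the first monomial alone separates points. -/
theorem span_circleMonomial_topologicalClosure :
    (Submodule.span ℂ (range circleMonomial)).topologicalClosure = ⊤ := by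
  let A : StarSubalgebra ℂ C(Circle, ℂ) :=
    { toSubalgebra := Algebra.adjoin ℂ (range circleMonomial)
      star_mem' := by
        change Algebra.adjoin ℂ (range circleMonomial) ≤
          star (Algebra.adjoin ℂ (range circleMonomial))
        refine Algebra.adjoin_le ?_
        rintro - ⟨n, rfl⟩
        refine Algebra.subset_adjoin ⟨-n, ?_⟩
        ext ξ
        simp [circleMonomial, ← Circle.coe_inv_eq_conj] }
  have hA : Subalgebra.toSubmodule A.toSubalgebra = Submodule.span ℂ (range circleMonomial) := by
    apply Algebra.adjoin_eq_span_of_subset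
    refine Subset.trans ?_ Submodule.subset_span
    intro x hx
    refine Submonoid.closure_induction (fun _ => id) ⟨0, ?_⟩ ?_ hx
    · ext ξ; simp [circleMonomial]
    · rintro - - - - ⟨m, rfl⟩ ⟨n, rfl⟩
      refine ⟨m + n, ?_⟩
      ext ξ
      simp [circleMonomial, zpow_add]
  have hsep : A.SeparatesPoints := by
    intro x y hxy
    refine ⟨_, ⟨circleMonomial 1, Algebra.subset_adjoin ⟨1, rfl⟩, rfl⟩, ?_⟩
    simpa [circleMonomial] using fun h => hxy (Circle.ext h)
  rw [← hA]
  exact congr_arg (Subalgebra.toSubmodule <| StarSubalgebra.toSubalgebra ·)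
    (ContinuousMap.starSubalgebra_topologicalClosure_eq_top_of_separatesPoints A hsep)

/-! ### Boundary values of bounded analytic functions -/

/-- A sequence of radii in `(0, 1)` that tends to `1`. -/
noncomputable def radiusSeq (n : ℕ) : ℝ := 1 - 1 / ((n : ℝ) + 2)

theorem radiusSeq_pos (n : ℕ) : 0 < radiusSeq n := by
  have : (1 : ℝ) / (n + 2) < 1 := by
    rw [div_lt_one (by positivity)]
    have : (0 : ℝ) ≤ n := n.cast_nonneg
    linarith
  unfold radiusSeq
  linarith

theorem radiusSeq_lt_one (n : ℕ) : radiusSeq n < 1 := by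
  have : (0 : ℝ) < 1 / (n + 2) := by positivity
  unfold radiusSeq
  linarith

theorem tendsto_radiusSeq : Tendsto radiusSeq atTop (𝓝 1) := by
  have h : Tendsto (fun n : ℕ => (1 : ℝ) / ((n : ℝ) + 2)) atTop (𝓝 0) :=
    tendsto_const_nhds.div_atTop (tendsto_natCast_atTop_atTop.atTop_add tendsto_const_nhds)
  have h2 := h.const_sub 1
  rwa [sub_zero] at h2

theorem radiusSeq_mul_mem_ball (n : ℕ) {z : ℂ} (hz : ‖z‖ ≤ 1) :
    (radiusSeq n : ℂ) * z ∈ Metric.ball (0 : ℂ) 1 := by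
  rw [mem_ball_zero_iff, norm_mul, Complex.norm_real, Real.norm_of_nonneg (radiusSeq_pos n).le]
  have := radiusSeq_pos n
  have := radiusSeq_lt_one n
  nlinarith [norm_nonneg z]

/-- `G` is the boundary function of the bounded analytic function `g` on the unit disc. -/
structure HasBoundary (g : ℂ → ℂ) (G : Circle → ℂ) : Prop where
  differentiableOn : DifferentiableOn ℂ g (Metric.ball 0 1)
  bounded : ∃ C : ℝ, ∀ z ∈ Metric.ball (0 : ℂ) 1, ‖g z‖ ≤ C
  tendsto : ∀ᵐ ξ : Circle ∂circleMeasure,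
    Tendsto (fun n => g ((radiusSeq n : ℂ) * (ξ : ℂ))) atTop (𝓝 (G ξ))

namespace HasBoundary

variable {g h : ℂ → ℂ} {G H : Circle → ℂ}

theorem const (c : ℂ) : HasBoundary (fun _ => c) (fun _ => c) :=
  ⟨differentiableOn_const c, ⟨‖c‖, fun _ _ => le_rfl⟩, .of_forall fun _ => tendsto_const_nhds⟩

theorem mul (hg : HasBoundary g G) (hh : HasBoundary h H) :
    HasBoundary (fun z => g z * h z) (fun ξ => G ξ * H ξ) := by
  obtain ⟨C, hC⟩ := hg.bounded
  obtain ⟨D, hD⟩ := hh.bounded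
  refine ⟨hg.differentiableOn.mul hh.differentiableOn, ⟨C * D, fun z hz => ?_⟩, ?_⟩
  · rw [norm_mul]
    exact mul_le_mul (hC z hz) (hD z hz) (norm_nonneg _) ((norm_nonneg _).trans (hC z hz))
  · filter_upwards [hg.tendsto, hh.tendsto] with ξ h1 h2 using h1.mul h2

theorem sub (hg : HasBoundary g G) (hh : HasBoundary h H) :
    HasBoundary (fun z => g z - h z) (fun ξ => G ξ - H ξ) := by
  obtain ⟨C, hC⟩ := hg.bounded
  obtain ⟨D, hD⟩ := hh.bounded
  refine ⟨hg.differentiableOn.sub hh.differentiableOn, ⟨C + D, fun z hz => ?_⟩, ?_⟩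
  · exact (norm_sub_le _ _).trans (add_le_add (hC z hz) (hD z hz))
  · filter_upwards [hg.tendsto, hh.tendsto] with ξ h1 h2 using h1.sub h2

theorem pow (hg : HasBoundary g G) (n : ℕ) :
    HasBoundary (fun z => g z ^ n) (fun ξ => G ξ ^ n) := by
  induction n with
  | zero => simpa using const 1
  | succ n ih => simpa [pow_succ] using ih.mul hg

theorem id' : HasBoundary (fun z => z) (fun ξ => (ξ : ℂ)) := by
  refine ⟨differentiableOn_id, ⟨1, fun z hz => (mem_ball_zero_iff.1 hz).le⟩, .of_forall fun ξ => ?_⟩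
  have h : Tendsto (fun n => (radiusSeq n : ℂ)) atTop (𝓝 ((1 : ℝ) : ℂ)) :=
    (Complex.continuous_ofReal.tendsto 1).comp tendsto_radiusSeq
  simpa using h.mul_const (ξ : ℂ)

theorem continuous_dilate (hg : HasBoundary g G) (n : ℕ) :
    Continuous fun ξ : Circle => g ((radiusSeq n : ℂ) * (ξ : ℂ)) := by
  refine hg.differentiableOn.continuousOn.comp_continuous (by fun_prop) fun ξ => ?_
  exact radiusSeq_mul_mem_ball n (Circle.norm_coe ξ).le

/-- This is where a sequence of radii is convenient: `G` is an almost everywhere limit of countably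
many continuous functions. -/
theorem aestronglyMeasurable (hg : HasBoundary g G) : AEStronglyMeasurable G circleMeasure :=
  aestronglyMeasurable_of_tendsto_ae atTop
    (fun n => (hg.continuous_dilate n).aestronglyMeasurable) hg.tendsto

/-- The quotient `(g z - g 0) / z` stays bounded up to the circle by the Schwarz lemma, applied with
the disc of radius `2 C + 1` about `g 0` as target. -/
theorem dslope_zero (hg : HasBoundary g G) :
    HasBoundary (dslope g 0) (fun ξ => ((ξ : ℂ)⁻¹) * (G ξ - g 0)) := by
  have h0 : Metric.ball (0 : ℂ) 1 ∈ 𝓝 (0 : ℂ) := Metric.ball_mem_nhds 0 one_pos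
  obtain ⟨C, hC⟩ := hg.bounded
  have hC0 : 0 ≤ C := (norm_nonneg _).trans (hC 0 (by simp))
  refine ⟨(Complex.differentiableOn_dslope h0).2 hg.differentiableOn, ⟨(2 * C + 1) / 1, ?_⟩, ?_⟩
  · intro z hz
    refine Complex.norm_dslope_le_div_of_mapsTo_ball hg.differentiableOn (fun w hw => ?_) hz
    have h1 := norm_sub_le (g w) (g 0)
    have h2 := hC w hw
    have h3 := hC 0 (by simp)
    simp only [Metric.mem_closedBall, dist_eq_norm]
    linarith
  · filter_upwards [hg.tendsto, id'.tendsto] with ξ h1 h2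
    have hξ : (ξ : ℂ) ≠ 0 := Circle.coe_ne_zero ξ
    refine ((h2.inv₀ hξ).mul (h1.sub_const (g 0))).congr fun n => ?_
    have hn : (radiusSeq n : ℂ) * ξ ≠ 0 :=
      mul_ne_zero (by exact_mod_cast (radiusSeq_pos n).ne') hξ
    rw [dslope_of_ne _ hn, slope_def_field]
    simp only [sub_zero]
    field_simp

end HasBoundary

theorem continuous_poissonKernel_circle {z : ℂ} (hz : z ∈ Metric.ball (0 : ℂ) 1) :
    Continuous fun ξ : Circle => poissonKernel 0 z ξ := by
  unfold poissonKernel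
  refine Continuous.div (by fun_prop) (by fun_prop) fun ξ => ?_
  have h : (ξ : ℂ) ≠ z := by
    rintro rfl
    rw [mem_ball_zero_iff, Circle.norm_coe] at hz
    exact lt_irrefl _ hz
  simpa [sub_eq_zero] using h

theorem poissonKernel_nonneg_circle {z : ℂ} (hz : z ∈ Metric.ball (0 : ℂ) 1) (ξ : Circle) :
    0 ≤ poissonKernel 0 z ξ := by
  unfold poissonKernel
  have h : ‖z‖ < 1 := mem_ball_zero_iff.1 hz
  refine div_nonneg ?_ (by positivity)
  simp only [sub_zero, Circle.norm_coe]
  nlinarith [norm_nonneg z]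

theorem poissonKernel_zero_circle (ξ : Circle) : poissonKernel 0 0 ξ = 1 := by
  simp [poissonKernel]

/-- Poisson's formula for the boundary function of a bounded analytic function. -/
theorem HasBoundary.integral_poissonKernel {g : ℂ → ℂ} {G : Circle → ℂ} (hg : HasBoundary g G)
    {z : ℂ} (hz : z ∈ Metric.ball (0 : ℂ) 1) :
    ∫ ξ : Circle, (poissonKernel 0 z ξ : ℂ) * G ξ ∂circleMeasure = g z := by
  obtain ⟨C, hC⟩ := hg.bounded
  have hP := continuous_poissonKernel_circle hz
  have hz1 : ‖z‖ < 1 := mem_ball_zero_iff.1 hz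
  -- The dilates of `g` are analytic on the closed disc, where the classical formula applies;
  -- dominated convergence then lets the radius tend to one.
  have hn : ∀ n, ∫ ξ : Circle, (poissonKernel 0 z ξ : ℂ) * g ((radiusSeq n : ℂ) * ξ) ∂circleMeasure
      = g ((radiusSeq n : ℂ) * z) := by
    intro n
    have hd : DiffContOnCl ℂ (fun w => g ((radiusSeq n : ℂ) * w)) (Metric.ball 0 1) := by
      apply DifferentiableOn.diffContOnCl
      rw [closure_ball 0 one_ne_zero]
      exact hg.differentiableOn.comp (by fun_prop) fun w hw =>
        radiusSeq_mul_mem_ball n (by simpa using hw)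
    rw [integral_circleMeasure_eq_circleAverage
      (g := fun w => (poissonKernel 0 z w : ℂ) * g ((radiusSeq n : ℂ) * w))]
    · have h := hd.circleAverage_poissonKernel_smul hz
      rw [← h]
      congr 1
    · exact ((Complex.continuous_ofReal.comp hP).mul (hg.continuous_dilate n)).aestronglyMeasurable
  refine tendsto_nhds_unique (f := fun n : ℕ => g ((radiusSeq n : ℂ) * z)) (l := atTop) ?_ ?_
  · simp_rw [← hn]
    refine tendsto_integral_of_dominated_convergence (fun ξ => poissonKernel 0 z ξ * C)
      (fun n => ((Complex.continuous_ofReal.comp hP).mul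
        (hg.continuous_dilate n)).aestronglyMeasurable)
      (integrable_circleMeasure_of_continuous (hP.mul_const C)) ?_ ?_
    · intro n
      refine .of_forall fun ξ => ?_
      rw [norm_mul, Complex.norm_real, Real.norm_of_nonneg (poissonKernel_nonneg_circle hz ξ)]
      exact mul_le_mul_of_nonneg_left (hC _ (radiusSeq_mul_mem_ball n (Circle.norm_coe ξ).le))
        (poissonKernel_nonneg_circle hz ξ)
    · filter_upwards [hg.tendsto] with ξ hξ using hξ.const_mul _
  · have h1 : Tendsto (fun n => (radiusSeq n : ℂ) * z) atTop (𝓝 z) := by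
      have h : Tendsto (fun n => (radiusSeq n : ℂ)) atTop (𝓝 ((1 : ℝ) : ℂ)) :=
        (Complex.continuous_ofReal.tendsto 1).comp tendsto_radiusSeq
      simpa using h.mul_const z
    exact ((hg.differentiableOn.differentiableAt
      (Metric.isOpen_ball.mem_nhds hz)).continuousAt.tendsto).comp h1

theorem HasBoundary.integral_eq {g : ℂ → ℂ} {G : Circle → ℂ} (hg : HasBoundary g G) :
    ∫ ξ : Circle, G ξ ∂circleMeasure = g 0 := by
  have := hg.integral_poissonKernel (z := 0) (by simp)
  simpa [poissonKernel_zero_circle] using this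

/-! ### Boundary maps of inner functions -/

/-- `T` is a boundary map of the analytic self-map `f` of the unit disc that fixes the origin. -/
structure IsBoundaryMap (f : ℂ → ℂ) (T : Circle → Circle) : Prop where
  mapsTo : MapsTo f (Metric.ball 0 1) (Metric.ball 0 1)
  map_zero : f 0 = 0
  measurable : Measurable T
  hasBoundary : HasBoundary f (fun ξ => (T ξ : ℂ))

theorem IsInner.exists_isBoundaryMap {f : ℂ → ℂ} (hf : IsInner f) (hf0 : f 0 = 0) :
    ∃ T : Circle → Circle, IsBoundaryMap f T := by
  have hr : Tendsto radiusSeq atTop (𝓝[<] 1) :=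
    tendsto_nhdsWithin_iff.2 ⟨tendsto_radiusSeq, .of_forall radiusSeq_lt_one⟩
  have hae : ∀ᵐ ξ : Circle ∂circleMeasure, ∃ w : ℂ,
      Tendsto (fun n => f ((radiusSeq n : ℂ) * (ξ : ℂ))) atTop (𝓝 w) ∧ ‖w‖ = 1 := by
    refine ae_circleMeasure_of_ae (p := fun ξ => ∃ w : ℂ,
      Tendsto (fun n => f ((radiusSeq n : ℂ) * (ξ : ℂ))) atTop (𝓝 w) ∧ ‖w‖ = 1) ?_
    filter_upwards [hf.radial] with t ht
    obtain ⟨w, hw, hw1⟩ := ht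
    refine ⟨w, ?_, hw1⟩
    rw [coe_circleExp_eq_circlePoint]
    exact hw.comp hr
  have hm : ∀ n, AEMeasurable (fun ξ : Circle => f ((radiusSeq n : ℂ) * (ξ : ℂ)))
      circleMeasure := fun n =>
    (hf.differentiableOn.continuousOn.comp_continuous (by fun_prop) fun ξ =>
      radiusSeq_mul_mem_ball n (Circle.norm_coe ξ).le).measurable.aemeasurable
  obtain ⟨g, hgm, hg⟩ := measurable_limit_of_tendsto_metrizable_ae hm
    (hae.mono fun ξ h => h.imp fun w hw => hw.1)
  -- Projecting a measurable version `g` of the limit to the circle gives a map that is measurable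
  -- and circle-valued everywhere; it agrees with `g` wherever `|g| = 1`.
  refine ⟨fun ξ => Circle.exp (g ξ).arg, hf.mapsTo, hf0,
    measurable_circleExp.comp (Complex.measurable_arg.comp hgm), hf.differentiableOn,
    ⟨1, fun z hz => (mem_ball_zero_iff.1 (hf.mapsTo hz)).le⟩, ?_⟩
  filter_upwards [hae, hg] with ξ ⟨w, hw, hw1⟩ h2
  have hgw : g ξ = w := tendsto_nhds_unique h2 hw
  have : ((Circle.exp (g ξ).arg : Circle) : ℂ) = g ξ := by
    have h := Complex.norm_mul_exp_arg_mul_I (g ξ)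
    rw [hgw, hw1] at h
    rw [hgw, Circle.coe_exp]
    simpa using h
  rw [this]
  exact h2

/-! ### Transfer of weights -/

/-- Both sides are continuous linear functionals of `G` in the uniform norm, so agreement on the
monomials, whose span is dense, is enough. -/
theorem integral_mul_comp_eq_of_continuous {T : Circle → Circle} (hT : Measurable T)
    (w₁ w₂ : C(Circle, ℂ))
    (h : ∀ k : ℤ, ∫ ξ, w₁ ξ * circleMonomial k (T ξ) ∂circleMeasure =
      ∫ ξ, w₂ ξ * circleMonomial k ξ ∂circleMeasure) (G : C(Circle, ℂ)) :
    ∫ ξ, w₁ ξ * G (T ξ) ∂circleMeasure = ∫ ξ, w₂ ξ * G ξ ∂circleMeasure := by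
  have hi : ∀ (w G : C(Circle, ℂ)) (T : Circle → Circle), Measurable T →
      Integrable (fun ξ => w ξ * G (T ξ)) circleMeasure := by
    intro w G T hT
    refine Integrable.of_bound (C := ‖w‖ * ‖G‖) ?_ (.of_forall fun ξ => ?_)
    · exact (w.continuous.measurable.mul (G.continuous.measurable.comp hT)).aestronglyMeasurable
    · rw [norm_mul]
      exact mul_le_mul (w.norm_coe_le_norm ξ) (G.norm_coe_le_norm _) (norm_nonneg _) (norm_nonneg _)
  let Φ : ∀ (w : C(Circle, ℂ)) (T : Circle → Circle), Measurable T → C(Circle, ℂ) →L[ℂ] ℂ :=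
    fun w T hT => LinearMap.mkContinuous
      { toFun := fun G => ∫ ξ, w ξ * G (T ξ) ∂circleMeasure
        map_add' := fun G H => by
          rw [← integral_add (hi w G T hT) (hi w H T hT)]
          simp [mul_add]
        map_smul' := fun c G => by
          simp only [RingHom.id_apply, ContinuousMap.smul_apply, smul_eq_mul]
          rw [← integral_const_mul]
          congr 1
          ext ξ
          ring } ‖w‖ (fun G => by
        refine (norm_integral_le_of_norm_le_const (C := ‖w‖ * ‖G‖) (.of_forall fun ξ => ?_)).trans
          (by simp)
        rw [norm_mul]
        exact mul_le_mul (w.norm_coe_le_norm ξ) (G.norm_coe_le_norm _) (norm_nonneg _)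
          (norm_nonneg _))
  have key : Φ w₁ T hT = Φ w₂ id measurable_id := by
    refine ContinuousLinearMap.ext_on (s := range circleMonomial) ?_ ?_
    · rw [Submodule.dense_iff_topologicalClosure_eq_top]
      exact span_circleMonomial_topologicalClosure
    · rintro - ⟨k, rfl⟩
      exact h k
  exact DFunLike.congr_fun key G

theorem measurePreserving_of_moments {T : Circle → Circle} (hT : Measurable T)
    (h : ∀ k : ℤ, ∫ ξ, circleMonomial k (T ξ) ∂circleMeasure =
      ∫ ξ, circleMonomial k ξ ∂circleMeasure) :
    MeasurePreserving T circleMeasure circleMeasure := by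
  refine ⟨hT, ?_⟩
  have : IsProbabilityMeasure (circleMeasure.map T) := Measure.isProbabilityMeasure_map hT.aemeasurable
  refine ext_of_forall_integral_eq_of_IsFiniteMeasure fun G => ?_
  let G' : C(Circle, ℂ) := ⟨fun ξ => (G ξ : ℂ), by fun_prop⟩
  have := integral_mul_comp_eq_of_continuous hT 1 1 (by simpa using h) G'
  simp only [ContinuousMap.one_apply, one_mul, G', ContinuousMap.coe_mk] at this
  rw [integral_map hT.aemeasurable G.continuous.aestronglyMeasurable]
  rw [integral_complex_ofReal, integral_complex_ofReal] at this
  exact_mod_cast this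

theorem integrable_mul_comp {T : Circle → Circle}
    (hT : MeasurePreserving T circleMeasure circleMeasure) (w : C(Circle, ℂ))
    {G : Circle → ℂ} (hG : Integrable G circleMeasure) :
    Integrable (fun ξ => w ξ * G (T ξ)) circleMeasure :=
  (hT.integrable_comp_of_integrable hG).bdd_mul (c := ‖w‖)
    w.continuous.aestronglyMeasurable (.of_forall fun ξ => w.norm_coe_le_norm ξ)

theorem norm_integral_mul_comp_le {T : Circle → Circle}
    (hT : MeasurePreserving T circleMeasure circleMeasure) (w : C(Circle, ℂ))
    {G : Circle → ℂ} (hG : Integrable G circleMeasure) :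
    ‖∫ ξ, w ξ * G (T ξ) ∂circleMeasure‖ ≤ ‖w‖ * ∫ ξ, ‖G ξ‖ ∂circleMeasure := by
  refine (norm_integral_le_integral_norm _).trans ?_
  have h1 : ∫ ξ, ‖G (T ξ)‖ ∂circleMeasure = ∫ ξ, ‖G ξ‖ ∂circleMeasure := by
    have := integral_map (μ := circleMeasure) hT.measurable.aemeasurable
      (f := fun ξ => ‖G ξ‖) (by rw [hT.map_eq]; exact hG.aestronglyMeasurable.norm)
    rw [hT.map_eq] at this
    exact this.symm
  rw [← h1, ← integral_const_mul]
  refine integral_mono (integrable_mul_comp hT w hG).norm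
    ((hT.integrable_comp_of_integrable hG).norm.const_mul _) fun ξ => ?_
  simp only [norm_mul]
  exact mul_le_mul_of_nonneg_right (w.norm_coe_le_norm ξ) (norm_nonneg _)

/-- If a measure-preserving map `T` carries the moments of the weight `w₁` to those of `w₂`, then it
carries the measure with density `w₁` to the one with density `w₂`. -/
theorem integral_mul_comp_eq {T : Circle → Circle}
    (hT : MeasurePreserving T circleMeasure circleMeasure) (w₁ w₂ : C(Circle, ℂ))
    (h : ∀ k : ℤ, ∫ ξ, w₁ ξ * circleMonomial k (T ξ) ∂circleMeasure =
      ∫ ξ, w₂ ξ * circleMonomial k ξ ∂circleMeasure)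
    {G : Circle → ℂ} (hG : Integrable G circleMeasure) :
    ∫ ξ, w₁ ξ * G (T ξ) ∂circleMeasure = ∫ ξ, w₂ ξ * G ξ ∂circleMeasure := by
  have hid := MeasurePreserving.id circleMeasure
  rw [← sub_eq_zero, ← norm_le_zero_iff]
  refine le_of_forall_pos_le_add fun ε hε => ?_
  have hD : 0 < ‖w₁‖ + ‖w₂‖ + 1 := by positivity
  -- Continuous functions are dense in `L¹`, and both sides are `L¹`-continuous in `G`; on the left
  -- this uses that `T` preserves the measure.
  obtain ⟨H, hH, hHi⟩ := hG.exists_boundedContinuous_integral_sub_le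
    (ε := ε / (‖w₁‖ + ‖w₂‖ + 1)) (by positivity)
  have e := integral_mul_comp_eq_of_continuous hT.measurable w₁ w₂ h H.toContinuousMap
  have e1 := norm_integral_mul_comp_le hT w₁ (hG.sub hHi)
  have e2 := norm_integral_mul_comp_le hid w₂ (hG.sub hHi)
  simp only [Pi.sub_apply, mul_sub] at e1 e2
  rw [integral_sub (integrable_mul_comp hT w₁ hG) (integrable_mul_comp hT w₁ hHi)] at e1
  rw [integral_sub (integrable_mul_comp hid w₂ hG) (integrable_mul_comp hid w₂ hHi)] at e2
  simp only [id] at e2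
  have e' : ∫ ξ, w₁ ξ * H (T ξ) ∂circleMeasure = ∫ ξ, w₂ ξ * H ξ ∂circleMeasure := e
  have e3 := norm_sub_le (∫ ξ, w₁ ξ * G (T ξ) ∂circleMeasure - ∫ ξ, w₁ ξ * H (T ξ) ∂circleMeasure)
    (∫ ξ, w₂ ξ * G ξ ∂circleMeasure - ∫ ξ, w₂ ξ * H ξ ∂circleMeasure)
  rw [e', sub_sub_sub_cancel_right] at e3
  rw [e'] at e1
  refine e3.trans ((add_le_add e1 e2).trans ?_)
  rw [← add_mul, zero_add]
  calc (‖w₁‖ + ‖w₂‖) * ∫ ξ, ‖G ξ - H ξ‖ ∂circleMeasure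
      ≤ (‖w₁‖ + ‖w₂‖ + 1) * (ε / (‖w₁‖ + ‖w₂‖ + 1)) :=
        mul_le_mul (by linarith) hH (integral_nonneg fun ξ => norm_nonneg (G ξ - H ξ)) hD.le
    _ = ε := by field_simp

/-! ### Conditional expectations with respect to a boundary map -/

theorem circleMonomial_natCast (n : ℕ) (ξ : Circle) : circleMonomial n ξ = (ξ : ℂ) ^ n := by
  simp [circleMonomial]

theorem circleMonomial_neg (k : ℤ) (ξ : Circle) :
    circleMonomial (-k) ξ = conj (circleMonomial k ξ) := by
  simp [circleMonomial, ← Circle.coe_inv_eq_conj]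

theorem circle_conj_eq_inv (ξ : Circle) : conj (ξ : ℂ) = (ξ : ℂ)⁻¹ := by
  rw [← Circle.coe_inv_eq_conj, Circle.coe_inv]

theorem isBoundaryMap_id : IsBoundaryMap (fun z => z) (fun ξ => ξ) :=
  ⟨fun _ h => h, rfl, measurable_id, HasBoundary.id'⟩

theorem dslope_id_zero : dslope (fun z : ℂ => z) 0 = fun _ => 1 := by
  ext z
  rcases eq_or_ne z 0 with rfl | hz
  · rw [dslope_same]; simp
  · rw [dslope_of_ne _ hz, slope_def_field]; simp [hz]

namespace IsBoundaryMap

variable {f : ℂ → ℂ} {T : Circle → Circle}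

/-- The weight `w` integrated against all the powers of `T`. -/
theorem integral_mul_circleMonomial_of_nat (w : C(Circle, ℂ)) (c : ℤ → ℂ)
    (hpos : ∀ n : ℕ, ∫ ξ, w ξ * (T ξ : ℂ) ^ n ∂circleMeasure = c n)
    (hneg : ∀ n : ℕ, ∫ ξ, conj (w ξ) * (T ξ : ℂ) ^ (n + 1) ∂circleMeasure = conj (c (-(n + 1 : ℤ))))
    (k : ℤ) : ∫ ξ, w ξ * circleMonomial k (T ξ) ∂circleMeasure = c k := by
  obtain ⟨n, rfl | rfl⟩ : ∃ n : ℕ, k = n ∨ k = -(n + 1 : ℤ) := by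
    rcases k with n | n
    · exact ⟨n, Or.inl rfl⟩
    · exact ⟨n, Or.inr (Int.negSucc_eq n)⟩
  · simpa only [circleMonomial_natCast] using hpos n
  · have h := congrArg conj (hneg n)
    rw [← integral_conj, Complex.conj_conj] at h
    rw [← h]
    congr 1
    ext ξ
    rw [circleMonomial_neg, map_mul, Complex.conj_conj, ← Nat.cast_succ, circleMonomial_natCast]

/-- The Poisson kernel as a continuous function on the circle. -/
noncomputable def poissonWeight (z : ℂ) (hz : z ∈ Metric.ball (0 : ℂ) 1) : C(Circle, ℂ) :=
  ⟨fun ξ => (poissonKernel 0 z ξ : ℂ),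
    Complex.continuous_ofReal.comp (continuous_poissonKernel_circle hz)⟩

/-- For `k ≥ 0` this is Poisson's formula for `f ^ k`; negative `k` follow by conjugation. The right
side depends on `z` only through `f z`, so the identity map at the point `f z` has the same moments.
-/
theorem integral_poissonWeight_mul_circleMonomial (hT : IsBoundaryMap f T) {z : ℂ}
    (hz : z ∈ Metric.ball (0 : ℂ) 1) (k : ℤ) :
    ∫ ξ, poissonWeight z hz ξ * circleMonomial k (T ξ) ∂circleMeasure =
      if 0 ≤ k then f z ^ k.toNat else conj (f z) ^ (-k).toNat := by
  refine integral_mul_circleMonomial_of_nat (poissonWeight z hz)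
    (fun k => if 0 ≤ k then f z ^ k.toNat else conj (f z) ^ (-k).toNat) (fun n => ?_)
    (fun n => ?_) k
  · simpa [poissonWeight] using (hT.hasBoundary.pow n).integral_poissonKernel hz
  · have h := (hT.hasBoundary.pow (n + 1)).integral_poissonKernel hz
    have h1 : ¬ (0 : ℤ) ≤ -(n + 1 : ℤ) := by omega
    have h2 : (- -(n + 1 : ℤ)).toNat = n + 1 := by omega
    simp only [h1, if_false, h2, map_pow, Complex.conj_conj]
    rw [← h]
    simp [poissonWeight]

/-- The case `z = 0` of the moment formula, where the Poisson kernel is `1` and `f 0 = 0`. -/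
theorem measurePreserving (hT : IsBoundaryMap f T) :
    MeasurePreserving T circleMeasure circleMeasure := by
  refine measurePreserving_of_moments hT.measurable fun k => ?_
  have h0 : (0 : ℂ) ∈ Metric.ball (0 : ℂ) 1 := by simp
  have h1 := hT.integral_poissonWeight_mul_circleMonomial h0 k
  have h2 := isBoundaryMap_id.integral_poissonWeight_mul_circleMonomial h0 k
  rw [hT.map_zero, ← h2] at h1
  simpa [poissonWeight, poissonKernel_zero_circle] using h1

/-- The boundary map carries the harmonic measure at `z` to the harmonic measure at `f z`. -/
theorem integral_poissonKernel_mul_comp (hT : IsBoundaryMap f T) {z : ℂ}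
    (hz : z ∈ Metric.ball (0 : ℂ) 1) {G : Circle → ℂ} (hG : Integrable G circleMeasure) :
    ∫ ξ : Circle, (poissonKernel 0 z ξ : ℂ) * G (T ξ) ∂circleMeasure =
      ∫ ξ : Circle, (poissonKernel 0 (f z) ξ : ℂ) * G ξ ∂circleMeasure :=
  integral_mul_comp_eq hT.measurePreserving (poissonWeight z hz)
    (poissonWeight (f z) (hT.mapsTo hz)) (fun k => by
      rw [hT.integral_poissonWeight_mul_circleMonomial,
        isBoundaryMap_id.integral_poissonWeight_mul_circleMonomial]) hG

theorem hasBoundary_dslope (hT : IsBoundaryMap f T) :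
    HasBoundary (dslope f 0) (fun ξ => (ξ : ℂ)⁻¹ * T ξ) := by
  simpa [hT.map_zero] using hT.hasBoundary.dslope_zero

/-- For `k ≥ 0` the integrand is the boundary function of `z f^k`, a power here, which vanishes at
the origin. For `k = -(n+1)` its conjugate is `(T/ξ) T^n`, the boundary function of `dslope f 0`
times the `n`-th power of `f`, and only `n = 0` gives a nonzero value at the origin. -/
theorem integral_circleMonomial_one (hT : IsBoundaryMap f T) (k : ℤ) :
    ∫ ξ, circleMonomial 1 ξ * circleMonomial k (T ξ) ∂circleMeasure =
      if k = -1 then conj (dslope f 0 0) else 0 := by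
  refine integral_mul_circleMonomial_of_nat (circleMonomial 1)
    (fun k => if k = -1 then conj (dslope f 0 0) else 0) (fun n => ?_) (fun n => ?_) k
  · have h := (HasBoundary.id'.mul (hT.hasBoundary.pow n)).integral_eq
    have h1 : (n : ℤ) ≠ -1 := by omega
    simpa [circleMonomial, h1] using h
  · have h := (hT.hasBoundary_dslope.mul (hT.hasBoundary.pow n)).integral_eq
    have e : ∀ ξ : Circle, conj (circleMonomial 1 ξ) * (T ξ : ℂ) ^ (n + 1) =
        (ξ : ℂ)⁻¹ * T ξ * (T ξ : ℂ) ^ n := fun ξ => by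
      simp [circleMonomial, circle_conj_eq_inv, pow_succ]; ring
    simp_rw [e, h, hT.map_zero]
    rcases n with _ | n
    · simp
    · have h1 : (-((n : ℤ) + 1 + 1)) ≠ -1 := by omega
      simp only [Nat.cast_add, Nat.cast_one, if_neg h1]
      simp

theorem integral_circleMonomial_two (hT : IsBoundaryMap f T) (k : ℤ) :
    ∫ ξ, circleMonomial 2 ξ * circleMonomial k (T ξ) ∂circleMeasure =
      if k = -1 then conj (dslope (dslope f 0) 0 0)
        else if k = -2 then conj (dslope f 0 0) ^ 2 else 0 := by
  refine integral_mul_circleMonomial_of_nat (circleMonomial 2)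
    (fun k => if k = -1 then conj (dslope (dslope f 0) 0 0)
        else if k = -2 then conj (dslope f 0 0) ^ 2 else 0) (fun n => ?_) (fun n => ?_) k
  · have h := ((HasBoundary.id'.pow 2).mul (hT.hasBoundary.pow n)).integral_eq
    have h1 : (n : ℤ) ≠ -1 := by omega
    have h2 : (n : ℤ) ≠ -2 := by omega
    simp only [if_neg h1, if_neg h2]
    simpa [circleMonomial, zpow_ofNat] using h
  · have hconj : ∀ ξ : Circle, conj (circleMonomial 2 ξ) = (ξ : ℂ)⁻¹ ^ 2 := fun ξ => by
      rw [← circle_conj_eq_inv, ← map_pow]; simp [circleMonomial, zpow_ofNat]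
    rcases n with _ | n
    · have h1 := hT.hasBoundary_dslope.dslope_zero.integral_eq
      have h2 : ∫ ξ : Circle, (ξ : ℂ)⁻¹ * dslope f 0 0 ∂circleMeasure = 0 := by
        rw [integral_mul_const]
        have := HasBoundary.id'.integral_eq
        have h3 := congrArg conj this
        rw [← integral_conj] at h3
        simp_rw [circle_conj_eq_inv] at h3
        rw [h3]; simp
      have e : ∀ ξ : Circle, conj (circleMonomial 2 ξ) * (T ξ : ℂ) ^ (0 + 1) =
          (ξ : ℂ)⁻¹ * ((ξ : ℂ)⁻¹ * T ξ - dslope f 0 0) + (ξ : ℂ)⁻¹ * dslope f 0 0 := fun ξ => by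
        rw [hconj]; ring
      simp_rw [e]
      rw [integral_add, h1, h2]
      · simp
      · obtain ⟨C, hC⟩ := hT.hasBoundary_dslope.bounded
        refine Integrable.of_bound (C := 1 + ‖dslope f 0 0‖)
          hT.hasBoundary_dslope.dslope_zero.aestronglyMeasurable (.of_forall fun ξ => ?_)
        rw [norm_mul, norm_inv, Circle.norm_coe, inv_one, one_mul]
        refine (norm_sub_le _ _).trans ?_
        rw [norm_mul, norm_inv, Circle.norm_coe, Circle.norm_coe]
        simp
      · exact integrable_circleMeasure_of_continuous
          (by simp_rw [← circle_conj_eq_inv]; fun_prop)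
    · have h := ((hT.hasBoundary_dslope.pow 2).mul (hT.hasBoundary.pow n)).integral_eq
      have e : ∀ ξ : Circle, conj (circleMonomial 2 ξ) * (T ξ : ℂ) ^ (n + 1 + 1) =
          ((ξ : ℂ)⁻¹ * T ξ) ^ 2 * (T ξ : ℂ) ^ n := fun ξ => by
        rw [hconj]; ring
      simp_rw [e, h, hT.map_zero]
      rcases n with _ | n
      · norm_num
      · have h1 : (-((n : ℤ) + 1 + 1 + 1)) ≠ -1 := by omega
        have h2 : (-((n : ℤ) + 1 + 1 + 1)) ≠ -2 := by omega
        simp only [Nat.cast_add, Nat.cast_one, if_neg h1, if_neg h2]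
        simp

/-- `E[ξ | T] = \bar a T`, where `a = f'(0)`. -/
theorem integral_coe_mul_comp (hT : IsBoundaryMap f T) {G : Circle → ℂ}
    (hG : Integrable G circleMeasure) :
    ∫ ξ : Circle, (ξ : ℂ) * G (T ξ) ∂circleMeasure =
      conj (dslope f 0 0) * ∫ ξ : Circle, (ξ : ℂ) * G ξ ∂circleMeasure := by
  have := integral_mul_comp_eq hT.measurePreserving (circleMonomial 1)
    (conj (dslope f 0 0) • circleMonomial 1) (fun k => by
      simp only [ContinuousMap.smul_apply, smul_eq_mul, mul_assoc]
      rw [integral_const_mul, hT.integral_circleMonomial_one,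
        isBoundaryMap_id.integral_circleMonomial_one, dslope_id_zero]
      simp) hG
  simp only [ContinuousMap.smul_apply, smul_eq_mul, mul_assoc] at this
  rw [integral_const_mul] at this
  simpa [circleMonomial] using this

/-- `E[ξ ^ 2 | T] = \bar a_2 T + \bar a ^ 2 T ^ 2`, where `f z = a z + a_2 z ^ 2 + ⋯`. -/
theorem integral_coe_sq_mul_comp (hT : IsBoundaryMap f T) {G : Circle → ℂ}
    (hG : Integrable G circleMeasure) :
    ∫ ξ : Circle, (ξ : ℂ) ^ 2 * G (T ξ) ∂circleMeasure =
      conj (dslope (dslope f 0) 0 0) * ∫ ξ : Circle, (ξ : ℂ) * G ξ ∂circleMeasure +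
      conj (dslope f 0 0) ^ 2 * ∫ ξ : Circle, (ξ : ℂ) ^ 2 * G ξ ∂circleMeasure := by
  have hid := MeasurePreserving.id circleMeasure
  have hs : ∀ {H : Circle → ℂ}, Integrable H circleMeasure →
      ∫ ξ, (conj (dslope (dslope f 0) 0 0) • circleMonomial 1 +
        conj (dslope f 0 0) ^ 2 • circleMonomial 2) ξ * H ξ ∂circleMeasure =
      conj (dslope (dslope f 0) 0 0) * ∫ ξ : Circle, circleMonomial 1 ξ * H ξ ∂circleMeasure +
      conj (dslope f 0 0) ^ 2 * ∫ ξ : Circle, circleMonomial 2 ξ * H ξ ∂circleMeasure := by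
    intro H hH
    rw [← integral_const_mul, ← integral_const_mul, ← integral_add]
    · congr 1; ext ξ; simp; ring
    · exact (integrable_mul_comp hid (circleMonomial 1) hH).const_mul _
    · exact (integrable_mul_comp hid (circleMonomial 2) hH).const_mul _
  have := integral_mul_comp_eq hT.measurePreserving (circleMonomial 2)
    (conj (dslope (dslope f 0) 0 0) • circleMonomial 1 +
      conj (dslope f 0 0) ^ 2 • circleMonomial 2) (fun k => by
      rw [hs (integrable_circleMeasure_of_continuous (circleMonomial k).continuous),
        hT.integral_circleMonomial_two, isBoundaryMap_id.integral_circleMonomial_one,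
        isBoundaryMap_id.integral_circleMonomial_two, dslope_id_zero]
      have hd : dslope (fun _ : ℂ => (1 : ℂ)) 0 0 = 0 := by rw [dslope_same]; simp
      rw [hd]
      by_cases h1 : k = -1
      · simp [h1]
      · by_cases h2 : k = -2
        · simp [h2]
        · simp [h1, h2]) hG
  rw [hs hG] at this
  simpa [circleMonomial, zpow_ofNat] using this

end IsBoundaryMap

/-! ### Riesz products -/

theorem MeasureTheory.MeasurePreserving.integral_comp_circle {T : Circle → Circle}
    (hT : MeasurePreserving T circleMeasure circleMeasure) {E : Type*} [NormedAddCommGroup E]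
    [NormedSpace ℝ E] {G : Circle → E} (hG : Integrable G circleMeasure) :
    ∫ ξ, G (T ξ) ∂circleMeasure = ∫ ξ, G ξ ∂circleMeasure := by
  have := integral_map (μ := circleMeasure) hT.measurable.aemeasurable (f := G)
    (by rw [hT.map_eq]; exact hG.aestronglyMeasurable)
  rw [hT.map_eq] at this
  exact this.symm

theorem MeasureTheory.Integrable.circle_bdd_mul {g G : Circle → ℂ}
    (hG : Integrable G circleMeasure) (hg : Measurable g) {C : ℝ} (hC : ∀ ξ, ‖g ξ‖ ≤ C) :
    Integrable (fun ξ => g ξ * G ξ) circleMeasure :=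
  hG.bdd_mul (c := C) hg.aestronglyMeasurable (.of_forall hC)

/-! ### Reverse martingale differences -/

/-- The difference `ξ - \bar a T(ξ)`, where `a = f'(0)`. -/
noncomputable def boundaryDiff (f : ℂ → ℂ) (T : Circle → Circle) (ξ : Circle) : ℂ :=
  ξ - conj (dslope f 0 0) * T ξ

namespace IsBoundaryMap

variable {f : ℂ → ℂ} {T : Circle → Circle}

theorem norm_dslope_le_one (hT : IsBoundaryMap f T) {z : ℂ} (hz : z ∈ Metric.ball (0 : ℂ) 1) :
    ‖dslope f 0 z‖ ≤ 1 := by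
  have := Complex.norm_dslope_le_div_of_mapsTo_ball hT.hasBoundary.differentiableOn
    (R₂ := 1) (fun w hw => by
      rw [hT.map_zero]; exact Metric.ball_subset_closedBall (hT.mapsTo hw)) hz
  simpa using this

theorem norm_boundaryDiff_le (hT : IsBoundaryMap f T) (ξ : Circle) :
    ‖boundaryDiff f T ξ‖ ≤ 2 := by
  have h := hT.norm_dslope_le_one (z := 0) (by simp)
  refine (norm_sub_le _ _).trans ?_
  rw [norm_mul, RCLike.norm_conj, Circle.norm_coe, Circle.norm_coe]
  linarith

theorem measurable_boundaryDiff (hT : IsBoundaryMap f T) : Measurable (boundaryDiff f T) :=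
  measurable_circleCoe.sub ((measurable_circleCoe.comp hT.measurable).const_mul _)

theorem integrable_comp (hT : IsBoundaryMap f T) {G : Circle → ℂ}
    (hG : Integrable G circleMeasure) : Integrable (fun ξ => G (T ξ)) circleMeasure :=
  hT.measurePreserving.integrable_comp_of_integrable hG

theorem integrable_coe_mul {G : Circle → ℂ} (hG : Integrable G circleMeasure) :
    Integrable (fun ξ : Circle => (ξ : ℂ) * G ξ) circleMeasure :=
  hG.circle_bdd_mul measurable_circleCoe (C := 1) (fun ξ => (Circle.norm_coe ξ).le)

theorem integrable_conj {G : Circle → ℂ} (hG : Integrable G circleMeasure) :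
    Integrable (fun ξ => conj (G ξ)) circleMeasure :=
  Complex.conjCLE.toContinuousLinearMap.integrable_comp hG

/-- That is, `E[d | T] = 0`: `ā T` is the conditional expectation of `ξ` given `T`. -/
theorem integral_boundaryDiff_mul_comp (hT : IsBoundaryMap f T) {G : Circle → ℂ}
    (hG : Integrable G circleMeasure) :
    ∫ ξ, boundaryDiff f T ξ * G (T ξ) ∂circleMeasure = 0 := by
  have h1 := hT.integral_coe_mul_comp hG
  have h2 := hT.measurePreserving.integral_comp_circle (integrable_coe_mul hG)
  have e : ∀ ξ, boundaryDiff f T ξ * G (T ξ) =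
      (ξ : ℂ) * G (T ξ) - conj (dslope f 0 0) * ((T ξ : ℂ) * G (T ξ)) := fun ξ => by
    rw [boundaryDiff]; ring
  simp_rw [e]
  rw [integral_sub (integrable_coe_mul (hT.integrable_comp hG))
    ((hT.integrable_comp (integrable_coe_mul hG)).const_mul _), integral_const_mul, h1, h2, sub_self]

theorem integral_conj_boundaryDiff_mul_comp (hT : IsBoundaryMap f T) {G : Circle → ℂ}
    (hG : Integrable G circleMeasure) :
    ∫ ξ, conj (boundaryDiff f T ξ) * G (T ξ) ∂circleMeasure = 0 := by
  have h := congrArg conj (hT.integral_boundaryDiff_mul_comp (integrable_conj hG))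
  rw [← integral_conj] at h
  simpa using h

theorem integral_coe_mul_conj_mul_comp (hT : IsBoundaryMap f T) {G : Circle → ℂ}
    (hG : Integrable G circleMeasure) :
    ∫ ξ : Circle, (ξ : ℂ) * (conj (T ξ : ℂ) * G (T ξ)) ∂circleMeasure =
      conj (dslope f 0 0) * ∫ ξ, G ξ ∂circleMeasure := by
  have hG' : Integrable (fun ξ : Circle => conj (ξ : ℂ) * G ξ) circleMeasure := by
    simpa using integrable_conj (integrable_coe_mul (integrable_conj hG))
  rw [hT.integral_coe_mul_comp hG']
  congr 2
  ext ξ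
  rw [circle_conj_eq_inv, mul_inv_cancel_left₀ (Circle.coe_ne_zero ξ)]

/-- That is, `E[|d|² | T] = 1 - |a|²`, a constant: expand `|d|² = 1 + |a|² - 2 Re(a ξ \bar T)` and
use `E[ξ \bar T | T] = ā`. -/
theorem integral_boundaryDiff_mul_conj_mul_comp (hT : IsBoundaryMap f T) {G : Circle → ℂ}
    (hG : Integrable G circleMeasure) :
    ∫ ξ, boundaryDiff f T ξ * conj (boundaryDiff f T ξ) * G (T ξ) ∂circleMeasure =
      ((1 - ‖dslope f 0 0‖ ^ 2 : ℝ) : ℂ) * ∫ ξ, G ξ ∂circleMeasure := by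
  set a := dslope f 0 0
  have hG' : Integrable (fun ξ : Circle => conj (ξ : ℂ) * G ξ) circleMeasure := by
    simpa using integrable_conj (integrable_coe_mul (integrable_conj hG))
  have hi : Integrable (fun ξ : Circle => (ξ : ℂ) * (conj (T ξ : ℂ) * G (T ξ))) circleMeasure :=
    integrable_coe_mul (hT.integrable_comp hG')
  have hi2 : Integrable (fun ξ : Circle => conj (ξ : ℂ) * (T ξ * G (T ξ))) circleMeasure := by
    simpa using integrable_conj (integrable_coe_mul (integrable_conj
      (hT.integrable_comp (integrable_coe_mul hG))))
  have h1 := hT.integral_coe_mul_conj_mul_comp hG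
  have h2 := congrArg conj (hT.integral_coe_mul_conj_mul_comp (integrable_conj hG))
  rw [← integral_conj, map_mul, ← integral_conj] at h2
  simp only [map_mul, Complex.conj_conj] at h2
  have e : ∀ ξ, boundaryDiff f T ξ * conj (boundaryDiff f T ξ) * G (T ξ) =
      (1 + a * conj a) * G (T ξ) - (a * ((ξ : ℂ) * (conj (T ξ : ℂ) * G (T ξ))) +
        conj a * (conj (ξ : ℂ) * (T ξ * G (T ξ)))) := fun ξ => by
    have h3 : (ξ : ℂ) * conj (ξ : ℂ) = 1 := by
      rw [circle_conj_eq_inv, mul_inv_cancel₀ (Circle.coe_ne_zero ξ)]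
    have h4 : (T ξ : ℂ) * conj (T ξ : ℂ) = 1 := by
      rw [circle_conj_eq_inv, mul_inv_cancel₀ (Circle.coe_ne_zero _)]
    simp only [boundaryDiff, map_sub, map_mul, Complex.conj_conj]
    linear_combination G (T ξ) * h3 + G (T ξ) * a * conj a * h4
  simp_rw [e]
  rw [integral_sub ((hT.integrable_comp hG).const_mul _) ((hi.const_mul _).fun_add (hi2.const_mul _)),
    integral_add (hi.const_mul _) (hi2.const_mul _), integral_const_mul, integral_const_mul,
    integral_const_mul, h1, h2, hT.measurePreserving.integral_comp_circle hG]
  have h5 : ((1 - ‖a‖ ^ 2 : ℝ) : ℂ) = 1 - a * conj a := by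
    rw [Complex.mul_conj, Complex.normSq_eq_norm_sq]; push_cast; ring
  rw [h5]
  ring

/-- That is, `E[d² | T] = ā₂ T`: the three contributions `ā² T²`, `-2 ā² T²` and `ā² T²` cancel. -/
theorem integral_boundaryDiff_sq_mul_comp (hT : IsBoundaryMap f T) {G : Circle → ℂ}
    (hG : Integrable G circleMeasure) :
    ∫ ξ, boundaryDiff f T ξ ^ 2 * G (T ξ) ∂circleMeasure =
      conj (dslope (dslope f 0) 0 0) * ∫ ξ : Circle, (ξ : ℂ) * G ξ ∂circleMeasure := by
  set a := dslope f 0 0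
  have hG1 := integrable_coe_mul hG
  have hG2 : Integrable (fun ξ : Circle => (ξ : ℂ) ^ 2 * G ξ) circleMeasure := by
    simpa only [sq, mul_assoc] using integrable_coe_mul hG1
  have hi1 : Integrable (fun ξ : Circle => (ξ : ℂ) ^ 2 * G (T ξ)) circleMeasure := by
    simpa only [sq, mul_assoc] using integrable_coe_mul (integrable_coe_mul (hT.integrable_comp hG))
  have hi2 := integrable_coe_mul (hT.integrable_comp hG1)
  have hi3 := hT.integrable_comp hG2
  have h1 := hT.integral_coe_sq_mul_comp hG
  have h2 := hT.integral_coe_mul_comp hG1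
  have h3 := hT.measurePreserving.integral_comp_circle hG2
  have e : ∀ ξ, boundaryDiff f T ξ ^ 2 * G (T ξ) =
      (ξ : ℂ) ^ 2 * G (T ξ) - (2 * conj a * ((ξ : ℂ) * (T ξ * G (T ξ))) -
        conj a ^ 2 * ((T ξ : ℂ) ^ 2 * G (T ξ))) := fun ξ => by
    rw [boundaryDiff]; ring
  have h4 : ∫ ξ : Circle, (ξ : ℂ) * ((ξ : ℂ) * G ξ) ∂circleMeasure =
      ∫ ξ : Circle, (ξ : ℂ) ^ 2 * G ξ ∂circleMeasure := by simp only [sq, mul_assoc]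
  have hi4 : Integrable (fun ξ : Circle => 2 * conj a * ((ξ : ℂ) * (T ξ * G (T ξ))) -
      conj a ^ 2 * ((T ξ : ℂ) ^ 2 * G (T ξ))) circleMeasure :=
    (hi2.const_mul _).sub (hi3.const_mul _)
  simp_rw [e]
  rw [integral_sub hi1 hi4,
    integral_sub (hi2.const_mul _) (hi3.const_mul _), integral_const_mul, integral_const_mul,
    h1, h2, h3, h4]
  ring

theorem integral_norm_sq_boundaryDiff (hT : IsBoundaryMap f T) :
    ∫ ξ, ‖boundaryDiff f T ξ‖ ^ 2 ∂circleMeasure = 1 - ‖dslope f 0 0‖ ^ 2 := by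
  have h := hT.integral_boundaryDiff_mul_conj_mul_comp (G := fun _ => 1) (integrable_const _)
  simp only [Complex.mul_conj, Complex.normSq_eq_norm_sq, mul_one, integral_const, probReal_univ,
    one_smul] at h
  rw [integral_complex_ofReal] at h
  exact_mod_cast h

/-- Testing `E[d² | T] = ā₂ T` against `\bar T` writes `ā₂` as the mean of `d² \bar T`, and the mean
of `|d|²` is the right side. -/
theorem norm_second_coeff_le (hT : IsBoundaryMap f T) :
    ‖dslope (dslope f 0) 0 0‖ ≤ 1 - ‖dslope f 0 0‖ ^ 2 := by
  have h := hT.integral_boundaryDiff_sq_mul_comp (G := fun ξ => conj (ξ : ℂ))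
    (integrable_circleMeasure_of_continuous (by fun_prop))
  have h1 : ∀ ξ : Circle, (ξ : ℂ) * conj (ξ : ℂ) = 1 := fun ξ => by
    rw [circle_conj_eq_inv, mul_inv_cancel₀ (Circle.coe_ne_zero ξ)]
  simp_rw [h1] at h
  rw [← hT.integral_norm_sq_boundaryDiff]
  have h2 : ‖dslope (dslope f 0) 0 0‖ =
      ‖∫ ξ, boundaryDiff f T ξ ^ 2 * conj (T ξ : ℂ) ∂circleMeasure‖ := by
    rw [h]; simp
  rw [h2]
  refine (norm_integral_le_integral_norm _).trans (le_of_eq ?_)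
  congr 1
  ext ξ
  rw [norm_mul, RCLike.norm_conj, Circle.norm_coe, mul_one, norm_pow]

end IsBoundaryMap

/-- One factor of a Riesz product. -/
noncomputable def rieszFactor (d : Circle → ℂ) (c : ℂ) (ξ : Circle) : ℝ :=
  1 + 1 / 4 * (c * conj (d ξ)).re

/-- The Riesz product `∏_{n < N} (1 + Re (c_n \bar d(T^n ξ)) / 4)`. -/
noncomputable def rieszProduct (d : Circle → ℂ) (T : Circle → Circle) :
    ℕ → (ℕ → ℂ) → Circle → ℝ
  | 0, _, _ => 1
  | N + 1, c, ξ => rieszFactor d (c 0) ξ * rieszProduct d T N (fun n => c (n + 1)) (T ξ)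

theorem ofReal_rieszFactor (d : Circle → ℂ) (c : ℂ) (ξ : Circle) :
    (rieszFactor d c ξ : ℂ) = 1 + 1 / 8 * (c * conj (d ξ) + conj c * d ξ) := by
  have h := Complex.add_conj (c * conj (d ξ))
  rw [map_mul, Complex.conj_conj] at h
  rw [h, rieszFactor]
  push_cast
  ring

/-- With `|d| ≤ 2` and `|c| ≤ 1`, the coefficient `1/4` keeps the perturbation of `1` at most `1/2`.
Positivity is what matters; the bound `2` only serves integrability. -/
theorem rieszFactor_mem {d : Circle → ℂ} (hd : ∀ ξ, ‖d ξ‖ ≤ 2) {c : ℂ} (hc : ‖c‖ ≤ 1) (ξ : Circle) :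
    rieszFactor d c ξ ∈ Icc (0 : ℝ) 2 := by
  have h1 : |(c * conj (d ξ)).re| ≤ 2 := by
    refine (Complex.abs_re_le_norm _).trans ?_
    rw [norm_mul, RCLike.norm_conj]
    nlinarith [hd ξ, norm_nonneg c, norm_nonneg (d ξ)]
  have := abs_le.1 h1
  constructor <;> unfold rieszFactor <;> linarith

theorem rieszProduct_mem {d : Circle → ℂ} (hd : ∀ ξ, ‖d ξ‖ ≤ 2) (T : Circle → Circle) (N : ℕ)
    {c : ℕ → ℂ} (hc : ∀ n, ‖c n‖ ≤ 1) (ξ : Circle) :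
    rieszProduct d T N c ξ ∈ Icc (0 : ℝ) (2 ^ N) := by
  induction N generalizing c ξ with
  | zero => simp [rieszProduct]
  | succ N ih =>
    have h1 := rieszFactor_mem hd (hc 0) ξ
    have h2 := ih (fun n => hc (n + 1)) (T ξ)
    refine ⟨mul_nonneg h1.1 h2.1, ?_⟩
    rw [rieszProduct, pow_succ, mul_comm (2 ^ N : ℝ)]
    exact mul_le_mul h1.2 h2.2 h2.1 (by norm_num)

theorem measurable_rieszFactor {d : Circle → ℂ} (hd : Measurable d) (c : ℂ) :
    Measurable (rieszFactor d c) := by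
  unfold rieszFactor
  exact ((Complex.measurable_re.comp
    ((Complex.continuous_conj.measurable.comp hd).const_mul c)).const_mul _).const_add _

theorem measurable_rieszProduct {d : Circle → ℂ} (hd : Measurable d) {T : Circle → Circle}
    (hT : Measurable T) (N : ℕ) (c : ℕ → ℂ) : Measurable (rieszProduct d T N c) := by
  induction N generalizing c with
  | zero => exact measurable_const
  | succ N ih => exact (measurable_rieszFactor hd (c 0)).mul ((ih _).comp hT)

namespace IsBoundaryMap

variable {f : ℂ → ℂ} {T : Circle → Circle}

theorem integrable_rieszProduct_mul (hT : IsBoundaryMap f T) (N : ℕ)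
    {c : ℕ → ℂ} (hc : ∀ n, ‖c n‖ ≤ 1) {G : Circle → ℂ} (hG : Integrable G circleMeasure) :
    Integrable (fun ξ => (rieszProduct (boundaryDiff f T) T N c ξ : ℂ) * G ξ) circleMeasure := by
  refine hG.circle_bdd_mul (C := 2 ^ N) (Complex.measurable_ofReal.comp
    (measurable_rieszProduct hT.measurable_boundaryDiff hT.measurable N c)) fun ξ => ?_
  have := rieszProduct_mem hT.norm_boundaryDiff_le T N hc ξ
  rw [Complex.norm_real, Real.norm_of_nonneg this.1]
  exact this.2

theorem integrable_boundaryDiff_mul (hT : IsBoundaryMap f T) {G : Circle → ℂ}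
    (hG : Integrable G circleMeasure) :
    Integrable (fun ξ => boundaryDiff f T ξ * G ξ) circleMeasure :=
  hG.circle_bdd_mul hT.measurable_boundaryDiff hT.norm_boundaryDiff_le

theorem integrable_conj_boundaryDiff_mul (hT : IsBoundaryMap f T) {G : Circle → ℂ}
    (hG : Integrable G circleMeasure) :
    Integrable (fun ξ => conj (boundaryDiff f T ξ) * G ξ) circleMeasure :=
  hG.circle_bdd_mul (Complex.continuous_conj.measurable.comp hT.measurable_boundaryDiff)
    fun ξ => by rw [RCLike.norm_conj]; exact hT.norm_boundaryDiff_le ξ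

/-- A factor has conditional expectation one given `T`, since `d` and its conjugate have conditional
expectation zero. -/
theorem integral_rieszFactor_mul_comp (hT : IsBoundaryMap f T) (c : ℂ) {G : Circle → ℂ}
    (hG : Integrable G circleMeasure) :
    ∫ ξ, (rieszFactor (boundaryDiff f T) c ξ : ℂ) * G (T ξ) ∂circleMeasure =
      ∫ ξ, G ξ ∂circleMeasure := by
  have hGT := hT.integrable_comp hG
  have e : ∀ ξ, (rieszFactor (boundaryDiff f T) c ξ : ℂ) * G (T ξ) =
      G (T ξ) + (1 / 8 * c * (conj (boundaryDiff f T ξ) * G (T ξ)) +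
        1 / 8 * conj c * (boundaryDiff f T ξ * G (T ξ))) := fun ξ => by
    rw [ofReal_rieszFactor]; ring
  simp_rw [e]
  have i1 := (hT.integrable_conj_boundaryDiff_mul hGT).const_mul (1 / 8 * c)
  have i2 := (hT.integrable_boundaryDiff_mul hGT).const_mul (1 / 8 * conj c)
  rw [integral_add hGT (i1.fun_add i2), integral_add i1 i2, integral_const_mul, integral_const_mul,
    hT.integral_conj_boundaryDiff_mul_comp hG, hT.integral_boundaryDiff_mul_comp hG,
    hT.measurePreserving.integral_comp_circle hG]
  simp

/-- In the expansion the linear term dies, the `|d|²` term gives the main contribution, and the `d²`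
term leaves a first moment of `G`. -/
theorem integral_boundaryDiff_mul_rieszFactor_mul_comp (hT : IsBoundaryMap f T) (c : ℂ)
    {G : Circle → ℂ} (hG : Integrable G circleMeasure) :
    ∫ ξ, boundaryDiff f T ξ * ((rieszFactor (boundaryDiff f T) c ξ : ℂ) * G (T ξ)) ∂circleMeasure =
      1 / 8 * (c * (((1 - ‖dslope f 0 0‖ ^ 2 : ℝ) : ℂ) * ∫ ξ, G ξ ∂circleMeasure) +
        conj c * (conj (dslope (dslope f 0) 0 0) * ∫ ξ : Circle, (ξ : ℂ) * G ξ ∂circleMeasure)) := by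
  have hGT := hT.integrable_comp hG
  have e : ∀ ξ, boundaryDiff f T ξ * ((rieszFactor (boundaryDiff f T) c ξ : ℂ) * G (T ξ)) =
      boundaryDiff f T ξ * G (T ξ) +
        (1 / 8 * c * (boundaryDiff f T ξ * conj (boundaryDiff f T ξ) * G (T ξ)) +
        1 / 8 * conj c * (boundaryDiff f T ξ ^ 2 * G (T ξ))) := fun ξ => by
    rw [ofReal_rieszFactor]; ring
  simp_rw [e]
  have i0 := hT.integrable_boundaryDiff_mul hGT
  have i1 : Integrable (fun ξ => 1 / 8 * c * (boundaryDiff f T ξ * conj (boundaryDiff f T ξ) *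
      G (T ξ))) circleMeasure := by
    have := (hT.integrable_boundaryDiff_mul (hT.integrable_conj_boundaryDiff_mul hGT)).const_mul
      (1 / 8 * c)
    simpa only [mul_assoc] using this
  have i2 : Integrable (fun ξ => 1 / 8 * conj c * (boundaryDiff f T ξ ^ 2 * G (T ξ)))
      circleMeasure := by
    have := (hT.integrable_boundaryDiff_mul i0).const_mul (1 / 8 * conj c)
    simpa only [sq, mul_assoc] using this
  rw [integral_add i0 (i1.fun_add i2), integral_add i1 i2, integral_const_mul, integral_const_mul,
    hT.integral_boundaryDiff_mul_comp hG, hT.integral_boundaryDiff_mul_conj_mul_comp hG,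
    hT.integral_boundaryDiff_sq_mul_comp hG]
  ring

/-- The first `n` factors of a Riesz product have conditional expectation one with respect to
`T^n`. -/
theorem integral_rieszProduct_add_mul_comp (hT : IsBoundaryMap f T) (n N : ℕ)
    {c : ℕ → ℂ} (hc : ∀ n, ‖c n‖ ≤ 1) {G : Circle → ℂ} (hG : Integrable G circleMeasure) :
    ∫ ξ, (rieszProduct (boundaryDiff f T) T (n + N) c ξ : ℂ) * G (T^[n] ξ) ∂circleMeasure =
      ∫ ξ, (rieszProduct (boundaryDiff f T) T N (fun k => c (n + k)) ξ : ℂ) * G ξ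
        ∂circleMeasure := by
  induction n generalizing c with
  | zero => simp
  | succ n ih =>
    have hc' : ∀ k, ‖c (k + 1)‖ ≤ 1 := fun k => hc _
    have hGn : Integrable (fun ξ => G (T^[n] ξ)) circleMeasure :=
      (hT.measurePreserving.iterate n).integrable_comp_of_integrable hG
    have h := hT.integral_rieszFactor_mul_comp (c 0)
      (hT.integrable_rieszProduct_mul (n + N) hc' hGn)
    rw [ih hc'] at h
    rw [show n + 1 + N = n + N + 1 by ring]
    simp only [rieszProduct, Function.iterate_succ_apply, Complex.ofReal_mul, mul_assoc]
    rw [h]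
    simp only [show ∀ k, n + k + 1 = n + 1 + k from fun k => by ring]

theorem integral_rieszProduct_mul_comp (hT : IsBoundaryMap f T) (N : ℕ)
    {c : ℕ → ℂ} (hc : ∀ n, ‖c n‖ ≤ 1) {G : Circle → ℂ} (hG : Integrable G circleMeasure) :
    ∫ ξ, (rieszProduct (boundaryDiff f T) T N c ξ : ℂ) * G (T^[N] ξ) ∂circleMeasure =
      ∫ ξ, G ξ ∂circleMeasure := by
  simpa [rieszProduct] using hT.integral_rieszProduct_add_mul_comp N 0 hc hG

theorem integral_rieszProduct (hT : IsBoundaryMap f T) (N : ℕ)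
    {c : ℕ → ℂ} (hc : ∀ n, ‖c n‖ ≤ 1) :
    ∫ ξ, (rieszProduct (boundaryDiff f T) T N c ξ : ℂ) ∂circleMeasure = 1 := by
  simpa using hT.integral_rieszProduct_mul_comp N hc (G := fun _ => 1) (integrable_const _)

theorem integrable_rieszProduct (hT : IsBoundaryMap f T) (N : ℕ)
    {c : ℕ → ℂ} (hc : ∀ n, ‖c n‖ ≤ 1) :
    Integrable (fun ξ => (rieszProduct (boundaryDiff f T) T N c ξ : ℂ)) circleMeasure := by
  simpa using hT.integrable_rieszProduct_mul N hc (G := fun _ => 1) (integrable_const _)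

theorem integral_boundaryDiff_mul_rieszProduct_succ (hT : IsBoundaryMap f T) (N : ℕ)
    {c : ℕ → ℂ} (hc : ∀ n, ‖c n‖ ≤ 1) :
    ∫ ξ, boundaryDiff f T ξ * rieszProduct (boundaryDiff f T) T (N + 1) c ξ ∂circleMeasure =
      1 / 8 * (c 0 * ((1 - ‖dslope f 0 0‖ ^ 2 : ℝ) : ℂ) +
        conj (c 0) * (conj (dslope (dslope f 0) 0 0) * ∫ ξ : Circle,
          (ξ : ℂ) * rieszProduct (boundaryDiff f T) T N (fun n => c (n + 1)) ξ
            ∂circleMeasure)) := by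
  have hc' : ∀ k, ‖c (k + 1)‖ ≤ 1 := fun k => hc _
  have h := hT.integral_boundaryDiff_mul_rieszFactor_mul_comp (c 0)
    (hT.integrable_rieszProduct N hc')
  rw [hT.integral_rieszProduct N hc', mul_one] at h
  rw [← h]
  simp [rieszProduct]

/-- The mean of the coordinate function with respect to a Riesz product is small. -/
theorem norm_integral_coe_mul_rieszProduct_le (hT : IsBoundaryMap f T) (N : ℕ)
    {c : ℕ → ℂ} (hc : ∀ n, ‖c n‖ ≤ 1) :
    ‖∫ ξ : Circle, (ξ : ℂ) * rieszProduct (boundaryDiff f T) T N c ξ ∂circleMeasure‖ ≤ 1 / 2 := by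
  induction N generalizing c with
  | zero =>
    have := HasBoundary.id'.integral_eq
    simp only [rieszProduct, Complex.ofReal_one, mul_one, this]
    norm_num
  | succ N ih =>
    have hc' : ∀ k, ‖c (k + 1)‖ ≤ 1 := fun k => hc _
    have h1 := hT.integral_boundaryDiff_mul_rieszProduct_succ N hc
    set e := ∫ ξ : Circle, (ξ : ℂ) * rieszProduct (boundaryDiff f T) T N (fun n => c (n + 1)) ξ
      ∂circleMeasure
    have he : ‖e‖ ≤ 1 / 2 := ih hc'
    have i0 := hT.integrable_rieszProduct N hc'
    have i1 := hT.integrable_rieszProduct (N + 1) hc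
    have h2 := hT.integral_rieszFactor_mul_comp (c 0) (integrable_coe_mul i0)
    -- Splitting `ξ = d + ā T` gives the recursion `e_{N+1} = (c₀ κ + c̄₀ ā₂ e_N) / 8 + ā e_N`,
    -- where `e_N` belongs to the shifted coefficients.
    have e1 : ∀ ξ : Circle, (ξ : ℂ) * rieszProduct (boundaryDiff f T) T (N + 1) c ξ =
        boundaryDiff f T ξ * rieszProduct (boundaryDiff f T) T (N + 1) c ξ +
        conj (dslope f 0 0) * ((rieszFactor (boundaryDiff f T) (c 0) ξ : ℂ) * ((T ξ : ℂ) *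
          rieszProduct (boundaryDiff f T) T N (fun n => c (n + 1)) (T ξ))) := fun ξ => by
      have : (ξ : ℂ) = boundaryDiff f T ξ + conj (dslope f 0 0) * T ξ := by
        rw [boundaryDiff]; ring
      rw [this, rieszProduct]
      push_cast
      ring
    have i2 : Integrable (fun ξ => conj (dslope f 0 0) * ((rieszFactor (boundaryDiff f T) (c 0) ξ : ℂ)
        * ((T ξ : ℂ) * rieszProduct (boundaryDiff f T) T N (fun n => c (n + 1)) (T ξ))))
        circleMeasure := by
      refine (Integrable.circle_bdd_mul (hT.integrable_comp (integrable_coe_mul i0))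
        (C := 2) (Complex.measurable_ofReal.comp
          (measurable_rieszFactor hT.measurable_boundaryDiff _)) fun ξ => ?_).const_mul _
      have := rieszFactor_mem hT.norm_boundaryDiff_le (hc 0) ξ
      simp only [Function.comp_apply]
      rw [Complex.norm_real, Real.norm_of_nonneg this.1]
      exact this.2
    simp_rw [e1]
    rw [integral_add (hT.integrable_boundaryDiff_mul i1) i2, integral_const_mul, h2, h1]
    have ha := hT.norm_dslope_le_one (z := 0) (by simp)
    have ha2 := hT.norm_second_coeff_le
    have hκ : 0 ≤ 1 - ‖dslope f 0 0‖ ^ 2 := (norm_nonneg _).trans ha2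
    have b1 : ‖c 0 * ((1 - ‖dslope f 0 0‖ ^ 2 : ℝ) : ℂ)‖ ≤ 1 - ‖dslope f 0 0‖ ^ 2 := by
      rw [norm_mul, Complex.norm_real, Real.norm_of_nonneg hκ]
      nlinarith [hc 0]
    have b2 : ‖conj (c 0) * (conj (dslope (dslope f 0) 0 0) * e)‖ ≤
        (1 - ‖dslope f 0 0‖ ^ 2) * (1 / 2) := by
      rw [norm_mul, norm_mul, RCLike.norm_conj, RCLike.norm_conj]
      have : ‖dslope (dslope f 0) 0 0‖ * ‖e‖ ≤ (1 - ‖dslope f 0 0‖ ^ 2) * (1 / 2) :=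
        mul_le_mul ha2 he (norm_nonneg _) hκ
      nlinarith [hc 0, norm_nonneg (c 0), mul_nonneg (norm_nonneg (dslope (dslope f 0) 0 0))
        (norm_nonneg e)]
    refine (norm_add_le _ _).trans ?_
    rw [norm_mul, norm_mul, RCLike.norm_conj]
    have b3 := norm_add_le (c 0 * ((1 - ‖dslope f 0 0‖ ^ 2 : ℝ) : ℂ))
      (conj (c 0) * (conj (dslope (dslope f 0) 0 0) * e))
    have b4 : ‖(1 / 8 : ℂ)‖ = 1 / 8 := by norm_num
    rw [b4]
    -- The estimate needed is `κ/8 + κ/16 + |a|/2 ≤ 1/2`. Dividing by `1 - |a|` when it is nonzero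
    -- turns it into `3 (1 + |a|) / 8 ≤ 1`.
    nlinarith [norm_nonneg (dslope f 0 0)]

/-- The lower bound behind the Riesz product argument. -/
theorem le_re_mul_integral_boundaryDiff_mul_rieszProduct (hT : IsBoundaryMap f T) {n N : ℕ}
    (hn : n < N) {c : ℕ → ℂ} (hc : ∀ n, ‖c n‖ ≤ 1) {b : ℂ} (hb : c n * b = ‖b‖) :
    (1 - ‖dslope f 0 0‖ ^ 2) / 16 * ‖b‖ ≤ (b * ∫ ξ, boundaryDiff f T (T^[n] ξ) *
      rieszProduct (boundaryDiff f T) T N c ξ ∂circleMeasure).re := by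
  obtain ⟨M, rfl⟩ : ∃ M, N = n + (M + 1) := ⟨N - n - 1, by omega⟩
  have hc' : ∀ k, ‖c (n + k)‖ ≤ 1 := fun k => hc _
  have hd : Integrable (boundaryDiff f T) circleMeasure := by
    simpa using hT.integrable_boundaryDiff_mul (G := fun _ => 1) (integrable_const _)
  have h := hT.integral_rieszProduct_add_mul_comp n (M + 1) hc hd
  simp_rw [mul_comm _ (boundaryDiff f T _)] at h
  rw [h, hT.integral_boundaryDiff_mul_rieszProduct_succ M hc']
  set e := ∫ ξ : Circle, (ξ : ℂ) * rieszProduct (boundaryDiff f T) T M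
    (fun k => c (n + (k + 1))) ξ ∂circleMeasure
  have he : ‖e‖ ≤ 1 / 2 :=
    hT.norm_integral_coe_mul_rieszProduct_le M (c := fun k => c (n + (k + 1))) fun k => hc _
  have ha2 := hT.norm_second_coeff_le
  have hκ : 0 ≤ 1 - ‖dslope f 0 0‖ ^ 2 := (norm_nonneg _).trans ha2
  set κ := 1 - ‖dslope f 0 0‖ ^ 2
  -- The choice of `c n` makes the main term exactly `κ ‖b‖ / 8`. Since `|a₂| ≤ κ` and `‖e‖ ≤ 1/2`,
  -- the other term costs at most half of it.
  have e1 : b * (1 / 8 * (c (n + 0) * (κ : ℂ) + conj (c (n + 0)) *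
      (conj (dslope (dslope f 0) 0 0) * e))) = ((κ / 8 * ‖b‖ : ℝ) : ℂ) +
      1 / 8 * (b * conj (c n) * (conj (dslope (dslope f 0) 0 0) * e)) := by
    push_cast
    rw [add_zero, ← hb]
    ring
  rw [e1, Complex.add_re, Complex.ofReal_re]
  have b1 : ‖1 / 8 * (b * conj (c n) * (conj (dslope (dslope f 0) 0 0) * e))‖ ≤
      κ / 16 * ‖b‖ := by
    rw [norm_mul, norm_mul, norm_mul, norm_mul, RCLike.norm_conj, RCLike.norm_conj]
    have b4 : ‖(1 / 8 : ℂ)‖ = 1 / 8 := by norm_num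
    have b5 : ‖dslope (dslope f 0) 0 0‖ * ‖e‖ ≤ κ * (1 / 2) :=
      mul_le_mul ha2 he (norm_nonneg _) hκ
    have b6 : ‖b‖ * ‖c n‖ ≤ ‖b‖ * 1 := mul_le_mul_of_nonneg_left (hc n) (norm_nonneg _)
    have b7 := mul_le_mul b6 b5 (by positivity) (by positivity)
    rw [b4]
    linarith
  have b2 := (abs_le.1 ((Complex.abs_re_le_norm _).trans b1)).1
  linarith

end IsBoundaryMap

/-! ### Fatou's theorem on radial limits of Poisson integrals -/

/-- A single term of the series suffices: `k = 0` if `|x| ≤ δ`, and `k = n + 1` if `2^n δ ≤ |x| <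
2^(n+1) δ`. The factor `4` absorbs this shift of the index. Dominating the kernel by dyadic
intervals reduces it to averages over intervals. -/
theorem div_sq_add_sq_le_tsum {δ : ℝ} (hδ : 0 < δ) (x : ℝ) :
    ENNReal.ofReal (δ / (δ ^ 2 + x ^ 2)) ≤ ∑' k : ℕ,
      ENNReal.ofReal (4 * (1 / 4) ^ k / δ) * indicator {y : ℝ | |y| ≤ 2 ^ k * δ} 1 x := by
  obtain ⟨k, hk, hle⟩ : ∃ k : ℕ, |x| ≤ 2 ^ k * δ ∧
      δ / (δ ^ 2 + x ^ 2) ≤ 4 * (1 / 4) ^ k / δ := by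
    rcases le_or_gt |x| δ with h | h
    · refine ⟨0, by simpa using h, ?_⟩
      rw [div_le_div_iff₀ (by positivity) hδ]
      nlinarith [sq_nonneg x]
    · obtain ⟨n, hn1, hn2⟩ := exists_nat_pow_near (y := (2 : ℝ)) ((one_le_div hδ).2 h.le) one_lt_two
      rw [div_lt_iff₀ hδ] at hn2
      rw [le_div_iff₀ hδ] at hn1
      refine ⟨n + 1, hn2.le, ?_⟩
      have h1 : (2 ^ n * δ) ^ 2 ≤ x ^ 2 := by
        rw [← sq_abs x]
        exact pow_le_pow_left₀ (by positivity) hn1 2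
      have h2 : (4 : ℝ) ^ n * δ ^ 2 ≤ x ^ 2 := by
        rw [show (4 : ℝ) = 2 ^ 2 by norm_num, ← pow_mul, mul_comm 2 n, pow_mul, ← mul_pow]
        exact h1
      have h3 : (4 : ℝ) * (1 / 4) ^ (n + 1) = 1 / 4 ^ n := by
        rw [pow_succ, one_div_pow]; ring
      have h4 : (0 : ℝ) < 4 ^ n := by positivity
      rw [h3, div_div, div_le_div_iff₀ (by positivity) (by positivity)]
      nlinarith
  refine le_trans ?_ (ENNReal.le_tsum k)
  rw [indicator_of_mem (by exact hk)]
  simpa using ENNReal.ofReal_le_ofReal hle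

theorem integral_approx_identity_le {g : ℝ → ℝ} (hg : Integrable g) (hg0 : ∀ t, 0 ≤ g t) (θ : ℝ)
    {B : ℝ} (hB : ∀ s : ℝ, 0 < s → s⁻¹ * ∫ t in Metric.closedBall θ s, g t ≤ B) {δ : ℝ}
    (hδ : 0 < δ) :
    ∫ t, δ / (δ ^ 2 + (t - θ) ^ 2) * g t ≤ ∑' k : ℕ, 4 * (1 / 2) ^ k *
      ((2 ^ k * δ)⁻¹ * ∫ t in Metric.closedBall θ (2 ^ k * δ), g t) := by
  have hA : ∀ s : ℝ, 0 ≤ ∫ t in Metric.closedBall θ s, g t := fun s =>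
    integral_nonneg fun t => hg0 t
  have hterm : ∀ k : ℕ, 0 ≤ 4 * (1 / 2 : ℝ) ^ k *
      ((2 ^ k * δ)⁻¹ * ∫ t in Metric.closedBall θ (2 ^ k * δ), g t) := fun k =>
    mul_nonneg (by positivity) (mul_nonneg (by positivity) (hA _))
  have hsum : Summable fun k : ℕ => 4 * (1 / 2 : ℝ) ^ k *
      ((2 ^ k * δ)⁻¹ * ∫ t in Metric.closedBall θ (2 ^ k * δ), g t) := by
    refine Summable.of_nonneg_of_le hterm (fun k => ?_)
      ((summable_geometric_two.mul_left 4).mul_right B)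
    exact mul_le_mul_of_nonneg_left (hB _ (by positivity)) (by positivity)
  have hnn : 0 ≤ ∫ t, δ / (δ ^ 2 + (t - θ) ^ 2) * g t :=
    integral_nonneg fun t => mul_nonneg (by positivity) (hg0 t)
  have hmeas : Measurable fun t : ℝ => δ / (δ ^ 2 + (t - θ) ^ 2) := by fun_prop
  rw [← ENNReal.ofReal_le_ofReal_iff (tsum_nonneg hterm), ENNReal.ofReal_tsum_of_nonneg hterm hsum,
    ofReal_integral_eq_lintegral_ofReal]
  · calc ∫⁻ t, ENNReal.ofReal (δ / (δ ^ 2 + (t - θ) ^ 2) * g t)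
        ≤ ∫⁻ t, ∑' k : ℕ, ENNReal.ofReal (4 * (1 / 4) ^ k / δ) *
          indicator (Metric.closedBall θ (2 ^ k * δ)) (fun t => ENNReal.ofReal (g t)) t := by
          refine lintegral_mono fun t => ?_
          rw [ENNReal.ofReal_mul (by positivity)]
          refine (mul_le_mul_left (div_sq_add_sq_le_tsum hδ (t - θ)) _).trans (le_of_eq ?_)
          rw [← ENNReal.tsum_mul_right]
          refine tsum_congr fun k => ?_
          by_cases h : t ∈ Metric.closedBall θ (2 ^ k * δ)
          · have h' : |t - θ| ≤ 2 ^ k * δ := by simpa [Real.dist_eq] using h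
            rw [indicator_of_mem h, indicator_of_mem (by exact h')]
            simp
          · have h' : ¬ |t - θ| ≤ 2 ^ k * δ := by simpa [Real.dist_eq] using h
            rw [indicator_of_notMem h, indicator_of_notMem (by exact h')]
            simp
      _ = ∑' k : ℕ, ∫⁻ t, ENNReal.ofReal (4 * (1 / 4) ^ k / δ) *
          indicator (Metric.closedBall θ (2 ^ k * δ)) (fun t => ENNReal.ofReal (g t)) t := by
          refine lintegral_tsum fun k => ?_
          exact (hg.aestronglyMeasurable.aemeasurable.ennreal_ofReal.indicator
            Metric.isClosed_closedBall.measurableSet).const_mul _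
      _ ≤ _ := by
          refine le_of_eq (tsum_congr fun k => ?_)
          rw [lintegral_const_mul' _ _ ENNReal.ofReal_ne_top,
            lintegral_indicator Metric.isClosed_closedBall.measurableSet,
            ← ofReal_integral_eq_lintegral_ofReal hg.integrableOn (.of_forall hg0),
            ← ENNReal.ofReal_mul (by positivity)]
          congr 1
          have e : (1 / 4 : ℝ) ^ k = (1 / 2) ^ k * (2 ^ k)⁻¹ := by
            rw [← inv_pow, ← mul_pow]; norm_num
          rw [e, mul_inv]
          ring
  · refine hg.bdd_mul (c := δ⁻¹) hmeas.aestronglyMeasurable (.of_forall fun t => ?_)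
    rw [Real.norm_of_nonneg (by positivity), div_le_iff₀ (by positivity)]
    have : δ⁻¹ * δ = 1 := inv_mul_cancel₀ hδ.ne'
    nlinarith [sq_nonneg (t - θ), inv_pos.2 hδ, mul_nonneg (inv_pos.2 hδ).le (sq_nonneg (t - θ))]
  · exact .of_forall fun t => mul_nonneg (by positivity) (hg0 t)

/-- The averages are bounded uniformly in the radius: by hypothesis for small radii, by the total
mass for the others. The dyadic series therefore has a geometric majorant and converges to zero term
by term. -/
theorem tendsto_integral_approx_identity {g : ℝ → ℝ} (hg : Integrable g) (hg0 : ∀ t, 0 ≤ g t)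
    (θ : ℝ) (h : Tendsto (fun s : ℝ => s⁻¹ * ∫ t in Metric.closedBall θ s, g t) (𝓝[>] 0) (𝓝 0)) :
    Tendsto (fun δ : ℝ => ∫ t, δ / (δ ^ 2 + (t - θ) ^ 2) * g t) (𝓝[>] 0) (𝓝 0) := by
  have hA : ∀ s : ℝ, 0 ≤ ∫ t in Metric.closedBall θ s, g t := fun s =>
    integral_nonneg fun t => hg0 t
  obtain ⟨B, hB⟩ : ∃ B : ℝ, ∀ s : ℝ, 0 < s → s⁻¹ * ∫ t in Metric.closedBall θ s, g t ≤ B := by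
    have h1 : ∀ᶠ s in 𝓝[>] (0 : ℝ), s⁻¹ * ∫ t in Metric.closedBall θ s, g t < 1 :=
      h.eventually (gt_mem_nhds one_pos)
    obtain ⟨s₀, hs₀, hs⟩ := mem_nhdsGT_iff_exists_Ioo_subset.1 h1
    have hs₀' : 0 < s₀ := hs₀
    refine ⟨max 1 (s₀⁻¹ * ∫ t, g t), fun s hpos => ?_⟩
    rcases lt_or_ge s s₀ with hlt | hge
    · have h2 : s⁻¹ * ∫ t in Metric.closedBall θ s, g t < 1 := hs ⟨hpos, hlt⟩
      exact h2.le.trans (le_max_left _ _)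
    · refine le_trans ?_ (le_max_right _ _)
      exact mul_le_mul (inv_anti₀ hs₀' hge)
        (setIntegral_le_integral hg (.of_forall hg0)) (hA s) (inv_pos.2 hs₀').le
  have hlim : Tendsto (fun δ : ℝ => ∑' k : ℕ, 4 * (1 / 2 : ℝ) ^ k *
      ((2 ^ k * δ)⁻¹ * ∫ t in Metric.closedBall θ (2 ^ k * δ), g t)) (𝓝[>] 0)
      (𝓝 (∑' _ : ℕ, (0 : ℝ))) := by
    refine tendsto_tsum_of_dominated_convergence (bound := fun k : ℕ => 4 * (1 / 2 : ℝ) ^ k * B)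
      ((summable_geometric_two.mul_left 4).mul_right B) (fun k => ?_) ?_
    · have hk : Tendsto (fun δ : ℝ => 2 ^ k * δ) (𝓝[>] 0) (𝓝[>] 0) := by
        refine tendsto_nhdsWithin_iff.2 ⟨?_, ?_⟩
        · have : Tendsto (fun δ : ℝ => 2 ^ k * δ) (𝓝 0) (𝓝 (2 ^ k * 0)) :=
            (continuous_const.mul continuous_id).tendsto 0
          rw [mul_zero] at this
          exact this.mono_left nhdsWithin_le_nhds
        · filter_upwards [self_mem_nhdsWithin] with δ hδ
          exact mem_Ioi.2 (mul_pos (pow_pos two_pos k) (mem_Ioi.1 hδ))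
      have := (h.comp hk).const_mul (4 * (1 / 2 : ℝ) ^ k)
      rw [mul_zero] at this
      exact this
    · filter_upwards [self_mem_nhdsWithin] with δ hδ k
      have hδ' : 0 < 2 ^ k * δ := mul_pos (by positivity) hδ
      rw [Real.norm_of_nonneg (mul_nonneg (by positivity)
        (mul_nonneg (inv_pos.2 hδ').le (hA _)))]
      exact mul_le_mul_of_nonneg_left (hB _ hδ') (by positivity)
  rw [tsum_zero] at hlim
  refine tendsto_of_tendsto_of_tendsto_of_le_of_le' tendsto_const_nhds hlim ?_ ?_
  · filter_upwards [self_mem_nhdsWithin] with δ hδ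
    have : (0 : ℝ) < δ := hδ
    exact integral_nonneg fun t => mul_nonneg (by positivity) (hg0 t)
  · filter_upwards [self_mem_nhdsWithin] with δ hδ
    exact integral_approx_identity_le hg hg0 θ hB hδ

/-- The squared distance is `(1 - r)² + 2 r (1 - cos (t - θ))`, and `1 - cos x ≥ 2 x² / π² ≥ x² / 5`
on `[-π, π]`. With `2 r ≥ 1` this costs a factor `5`, and the numerator `1 - r² ≤ 2 (1 - r)` a
factor `2`. -/
theorem poissonKernel_circleExp_le {r θ t : ℝ} (hr : 1 / 2 ≤ r) (hr1 : r < 1)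
    (ht : |t - θ| ≤ Real.pi) :
    poissonKernel 0 ((r : ℂ) * Circle.exp θ) (Circle.exp t) ≤
      10 * ((1 - r) / ((1 - r) ^ 2 + (t - θ) ^ 2)) := by
  have h1 : ‖(Circle.exp t : ℂ) - (r : ℂ) * Circle.exp θ‖ ^ 2 =
      (1 - r) ^ 2 + 2 * r * (1 - Real.cos (t - θ)) := by
    rw [← Complex.normSq_eq_norm_sq, Complex.normSq_apply, Circle.coe_exp, Circle.coe_exp,
      Real.cos_sub]
    simp only [Complex.sub_re, Complex.sub_im, Complex.re_ofReal_mul, Complex.im_ofReal_mul,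
      Complex.exp_ofReal_mul_I_re, Complex.exp_ofReal_mul_I_im]
    nlinarith [Real.sin_sq_add_cos_sq t, Real.sin_sq_add_cos_sq θ]
  have h2 := Real.cos_le_one_sub_mul_cos_sq ht
  have hpi : Real.pi ^ 2 ≤ 10 := by nlinarith [Real.pi_lt_d2, Real.pi_pos]
  have h3 : (t - θ) ^ 2 / 10 ≤ (1 - Real.cos (t - θ)) / 2 := by
    have : (t - θ) ^ 2 / 10 ≤ (t - θ) ^ 2 / Real.pi ^ 2 :=
      div_le_div_of_nonneg_left (sq_nonneg _) (by positivity) hpi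
    have e : 2 / Real.pi ^ 2 * (t - θ) ^ 2 = 2 * ((t - θ) ^ 2 / Real.pi ^ 2) := by ring
    rw [e] at h2
    linarith
  have h4 : 0 ≤ 1 - Real.cos (t - θ) := by linarith [Real.cos_le_one (t - θ)]
  have h5 : (1 - r) ^ 2 + (t - θ) ^ 2 / 5 ≤ (1 - r) ^ 2 + 2 * r * (1 - Real.cos (t - θ)) := by
    nlinarith
  have hδ : 0 < 1 - r := by linarith
  have hn : ‖(r : ℂ) * Circle.exp θ‖ = r := by
    rw [norm_mul, Circle.norm_coe, mul_one, Complex.norm_real, Real.norm_of_nonneg (by linarith)]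
  rw [poissonKernel, sub_zero, sub_zero, hn, Circle.norm_coe, h1, ← mul_div_assoc,
    div_le_div_iff₀ (by positivity) (by positivity)]
  have h6 : (1 : ℝ) ^ 2 - r ^ 2 ≤ 2 * (1 - r) := by nlinarith
  have h7 : 0 ≤ (1 - r) ^ 2 + (t - θ) ^ 2 := by positivity
  calc ((1 : ℝ) ^ 2 - r ^ 2) * ((1 - r) ^ 2 + (t - θ) ^ 2)
      ≤ 2 * (1 - r) * ((1 - r) ^ 2 + (t - θ) ^ 2) := mul_le_mul_of_nonneg_right h6 h7
    _ ≤ 2 * (1 - r) * (5 * ((1 - r) ^ 2 + (t - θ) ^ 2 / 5)) := by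
      refine mul_le_mul_of_nonneg_left ?_ (by linarith)
      nlinarith [sq_nonneg (1 - r)]
    _ ≤ 2 * (1 - r) * (5 * ((1 - r) ^ 2 + 2 * r * (1 - Real.cos (t - θ)))) :=
      mul_le_mul_of_nonneg_left (by linarith) (by linarith)
    _ = _ := by ring

theorem integral_circleMeasure_shift {E : Type*} [NormedAddCommGroup E] [NormedSpace ℝ E]
    {g : Circle → E} (hg : AEStronglyMeasurable g circleMeasure) (θ : ℝ) :
    ∫ ξ, g ξ ∂circleMeasure = (2 * Real.pi)⁻¹ •
      ∫ t in Ioc (θ - Real.pi) (θ + Real.pi), g (Circle.exp t) := by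
  have hp : (fun t : ℝ => g (Circle.exp t)).Periodic (2 * Real.pi) := fun x => by
    simp only [Circle.periodic_exp x]
  have := hp.intervalIntegral_add_eq (-Real.pi) (θ - Real.pi)
  rw [show -Real.pi + 2 * Real.pi = Real.pi by ring,
    show θ - Real.pi + 2 * Real.pi = θ + Real.pi by ring] at this
  rw [integral_circleMeasure hg, this, intervalIntegral.integral_of_le (by linarith [Real.pi_pos])]

theorem intervalIntegrable_comp_circleExp {E : Type*} [NormedAddCommGroup E]
    {g : Circle → E} (hg : Integrable g circleMeasure) (a b : ℝ) :
    IntervalIntegrable (fun t : ℝ => g (Circle.exp t)) volume a b := by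
  have hp : (fun t : ℝ => g (Circle.exp t)).Periodic (2 * Real.pi) := fun x => by
    simp only [Circle.periodic_exp x]
  refine hp.intervalIntegrable (t := -Real.pi) (by positivity) ?_ a b
  rw [show -Real.pi + 2 * Real.pi = Real.pi by ring,
    intervalIntegrable_iff_integrableOn_Ioc_of_le (by linarith [Real.pi_pos])]
  exact integrable_circleMeasure hg

/-- **Fatou's theorem**: the Poisson integral of an integrable function has this function as its
radial limit at almost every point. -/
theorem ae_tendsto_integral_poissonKernel {Φ : Circle → ℂ} (hΦ : Integrable Φ circleMeasure) :
    ∀ᵐ θ : ℝ, Tendsto (fun r : ℝ => ∫ ξ : Circle,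
      (poissonKernel 0 ((r : ℂ) * Circle.exp θ) ξ : ℂ) * Φ ξ ∂circleMeasure)
      (𝓝[<] 1) (𝓝 (Φ (Circle.exp θ))) := by
  have hloc : LocallyIntegrable (fun t : ℝ => Φ (Circle.exp t)) volume := fun x =>
    ⟨Ioc (x - 1) (x + 1), Ioc_mem_nhds (by linarith) (by linarith),
      (intervalIntegrable_iff_integrableOn_Ioc_of_le (by linarith)).1
        (intervalIntegrable_comp_circleExp hΦ _ _)⟩
  -- Convergence is proved at each Lebesgue point `θ`. The period centred at `θ` keeps `|t - θ| ≤
  -- π`, as the kernel bound requires.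
  filter_upwards [IsUnifLocDoublingMeasure.ae_tendsto_average_norm_sub volume hloc 1] with θ hθ
  set J := Ioc (θ - Real.pi) (θ + Real.pi) with hJ
  set c := Φ (Circle.exp θ) with hc
  have hdiff : Integrable (fun ξ => ‖Φ ξ - c‖) circleMeasure := (hΦ.sub (integrable_const c)).norm
  set g : ℝ → ℝ := J.indicator fun t => ‖Φ (Circle.exp t) - c‖ with hgdef
  have hgi : Integrable g := by
    rw [hgdef, integrable_indicator_iff measurableSet_Ioc]
    exact (intervalIntegrable_iff_integrableOn_Ioc_of_le (by linarith [Real.pi_pos])).1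
      (intervalIntegrable_comp_circleExp hdiff _ _)
  have hg0 : ∀ t, 0 ≤ g t := fun t => indicator_nonneg (fun _ _ => norm_nonneg _) t
  have hballs : Tendsto (fun s : ℝ => s⁻¹ * ∫ t in Metric.closedBall θ s, g t) (𝓝[>] 0) (𝓝 0) := by
    have h1 := (hθ (l := 𝓝[>] (0 : ℝ)) (fun _ => θ) (fun s => s) tendsto_id (by
      filter_upwards [self_mem_nhdsWithin] with s hs
      have : (0 : ℝ) < s := hs
      simp [this.le])).const_mul 2
    rw [mul_zero] at h1
    refine tendsto_of_tendsto_of_tendsto_of_le_of_le' tendsto_const_nhds h1 ?_ ?_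
    · filter_upwards [self_mem_nhdsWithin] with s hs
      exact mul_nonneg (inv_pos.2 hs).le (integral_nonneg fun t => hg0 t)
    · filter_upwards [self_mem_nhdsWithin] with s hs
      have hs' : (0 : ℝ) < s := hs
      rw [setAverage_eq, Real.volume_real_closedBall hs'.le, smul_eq_mul, mul_inv, ← mul_assoc,
        ← mul_assoc, mul_inv_cancel₀ two_ne_zero, one_mul]
      refine mul_le_mul_of_nonneg_left ?_ (inv_pos.2 hs').le
      refine integral_mono hgi.integrableOn ?_ fun t => ?_
      · have := intervalIntegrable_comp_circleExp hdiff (θ - s - 1) (θ + s)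
        rw [intervalIntegrable_iff_integrableOn_Ioc_of_le (by linarith)] at this
        refine this.mono_set ?_
        rw [Real.closedBall_eq_Icc]
        exact fun t ht => ⟨by linarith [ht.1], ht.2⟩
      · exact indicator_le_self' (fun _ _ => norm_nonneg _) t
  have hmain := tendsto_integral_approx_identity hgi hg0 θ hballs
  have hr : Tendsto (fun r : ℝ => 1 - r) (𝓝[<] 1) (𝓝[>] 0) := by
    refine tendsto_nhdsWithin_iff.2 ⟨?_, ?_⟩
    · have : Tendsto (fun r : ℝ => 1 - r) (𝓝 1) (𝓝 (1 - 1)) :=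
        (continuous_const.sub continuous_id).tendsto 1
      rw [sub_self] at this
      exact this.mono_left nhdsWithin_le_nhds
    · filter_upwards [self_mem_nhdsWithin] with r hr
      exact sub_pos.2 (mem_Iio.1 hr)
  have hlim := (hmain.comp hr).const_mul ((2 * Real.pi)⁻¹ * 10)
  rw [mul_zero] at hlim
  rw [tendsto_iff_norm_sub_tendsto_zero]
  refine squeeze_zero' (.of_forall fun _ => norm_nonneg _) ?_ hlim
  have hnear : ∀ᶠ r in 𝓝[<] (1 : ℝ), 1 / 2 ≤ r :=
    mem_nhdsWithin_of_mem_nhds (Ici_mem_nhds (by norm_num))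
  filter_upwards [self_mem_nhdsWithin, hnear] with r hr1 hr2
  have hr1' : r < 1 := hr1
  have hz : (r : ℂ) * Circle.exp θ ∈ Metric.ball (0 : ℂ) 1 := by
    rw [mem_ball_zero_iff, norm_mul, Circle.norm_coe, mul_one, Complex.norm_real,
      Real.norm_of_nonneg (by linarith)]
    exact hr1'
  have hP := continuous_poissonKernel_circle hz
  have hPi : ∀ {G : Circle → ℂ}, Integrable G circleMeasure → Integrable (fun ξ : Circle =>
      (poissonKernel 0 ((r : ℂ) * Circle.exp θ) ξ : ℂ) * G ξ) circleMeasure := fun hG =>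
    integrable_mul_comp (.id _) (IsBoundaryMap.poissonWeight _ hz) hG
  have h1 : ∫ ξ : Circle, (poissonKernel 0 ((r : ℂ) * Circle.exp θ) ξ : ℂ) * c ∂circleMeasure = c :=
    (HasBoundary.const c).integral_poissonKernel hz
  have hPd := (hPi (hΦ.sub (integrable_const c))).norm
  have hkey : ‖∫ ξ : Circle, (poissonKernel 0 ((r : ℂ) * Circle.exp θ) ξ : ℂ) * Φ ξ ∂circleMeasure
      - c‖ ≤ ∫ ξ : Circle, poissonKernel 0 ((r : ℂ) * Circle.exp θ) ξ * ‖Φ ξ - c‖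
        ∂circleMeasure := by
    have h2 := integral_sub (hPi hΦ) (hPi (integrable_const c))
    rw [h1] at h2
    rw [← h2]
    refine (norm_integral_le_integral_norm _).trans (le_of_eq ?_)
    congr 1
    ext ξ
    rw [← mul_sub, norm_mul, Complex.norm_real,
      Real.norm_of_nonneg (poissonKernel_nonneg_circle hz ξ)]
  refine hkey.trans ?_
  have hPm : Integrable (fun ξ : Circle => poissonKernel 0 ((r : ℂ) * Circle.exp θ) ξ * ‖Φ ξ - c‖)
      circleMeasure := by
    refine hPd.congr (.of_forall fun ξ => ?_)
    simp only [Pi.sub_apply]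
    rw [norm_mul, Complex.norm_real, Real.norm_of_nonneg (poissonKernel_nonneg_circle hz ξ)]
  rw [integral_circleMeasure_shift hPm.aestronglyMeasurable θ, smul_eq_mul, mul_assoc,
    Function.comp_apply]
  refine mul_le_mul_of_nonneg_left ?_ (by positivity)
  rw [← integral_const_mul, ← integral_indicator measurableSet_Ioc]
  have hδ : 0 < 1 - r := by linarith
  refine integral_mono ?_ ?_ fun t => ?_
  · rw [integrable_indicator_iff measurableSet_Ioc]
    exact (intervalIntegrable_iff_integrableOn_Ioc_of_le (by linarith [Real.pi_pos])).1
      (intervalIntegrable_comp_circleExp hPm _ _)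
  · refine (hgi.bdd_mul (c := (1 - r)⁻¹) (f := fun t => (1 - r) / ((1 - r) ^ 2 + (t - θ) ^ 2))
      (Measurable.aestronglyMeasurable (by fun_prop)) (.of_forall fun t => ?_)).const_mul 10
    rw [Real.norm_of_nonneg (by positivity), div_le_iff₀ (by positivity)]
    have : (1 - r)⁻¹ * (1 - r) = 1 := inv_mul_cancel₀ hδ.ne'
    nlinarith [sq_nonneg (t - θ), mul_nonneg (inv_pos.2 hδ).le (sq_nonneg (t - θ))]
  · by_cases ht : t ∈ J
    · rw [hgdef, indicator_of_mem ht]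
      simp only [indicator_of_mem ht, ← mul_assoc]
      refine mul_le_mul_of_nonneg_right ?_ (norm_nonneg _)
      refine poissonKernel_circleExp_le hr2 hr1' (abs_le.2 ⟨?_, ?_⟩) <;>
      linarith [ht.1, ht.2]
    · rw [hgdef]
      simp only [indicator_of_notMem ht, mul_zero]
      exact (indicator_of_notMem ht _).le

/-! ### Equidistribution of the iterates -/

namespace IsBoundaryMap

variable {f : ℂ → ℂ} {T : Circle → Circle}

/-- The equality case of the Schwarz lemma. -/
theorem norm_dslope_lt_one (hT : IsBoundaryMap f T) (hrot : ¬ IsDiscRotation f) {z : ℂ}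
    (hz : z ∈ Metric.ball (0 : ℂ) 1) : ‖dslope f 0 z‖ < 1 := by
  refine lt_of_le_of_ne (hT.norm_dslope_le_one hz) fun h => hrot ⟨dslope f 0 z, h, ?_⟩
  intro w hw
  have := Complex.affine_of_mapsTo_ball_of_norm_dslope_eq_div hT.hasBoundary.differentiableOn
    (R₂ := 1) (fun w hw => by
      rw [hT.map_zero]; exact Metric.ball_subset_closedBall (hT.mapsTo hw)) hz
      (by rw [h]; norm_num) hw
  simpa [hT.map_zero, mul_comm] using this

theorem exists_norm_le_mul (hT : IsBoundaryMap f T) (hrot : ¬ IsDiscRotation f) {r : ℝ}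
    (hr0 : 0 ≤ r) (hr : r < 1) :
    ∃ ρ : ℝ, 0 ≤ ρ ∧ ρ < 1 ∧ ∀ z : ℂ, ‖z‖ ≤ r → ‖f z‖ ≤ ρ * ‖z‖ := by
  have hsub : Metric.closedBall (0 : ℂ) r ⊆ Metric.ball 0 1 := Metric.closedBall_subset_ball hr
  have hcont : ContinuousOn (fun z => ‖dslope f 0 z‖) (Metric.closedBall (0 : ℂ) r) :=
    (hT.hasBoundary_dslope.differentiableOn.continuousOn.mono hsub).norm
  obtain ⟨z₀, hz₀, hmax⟩ := (isCompact_closedBall (0 : ℂ) r).exists_isMaxOn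
    ⟨0, by simpa using hr0⟩ hcont
  refine ⟨‖dslope f 0 z₀‖, norm_nonneg _, hT.norm_dslope_lt_one hrot (hsub hz₀), fun z hz => ?_⟩
  have h1 : z * dslope f 0 z = f z := by
    simpa [hT.map_zero] using sub_smul_dslope f 0 z
  have h2 : ‖dslope f 0 z‖ ≤ ‖dslope f 0 z₀‖ := hmax (by simpa using hz)
  rw [← h1, norm_mul, mul_comm]
  exact mul_le_mul_of_nonneg_right h2 (norm_nonneg _)

/-- A contraction towards the origin keeps the closed disc of radius `r` invariant, so the same
factor applies at every iteration. -/
theorem exists_norm_iterate_le (hT : IsBoundaryMap f T) (hrot : ¬ IsDiscRotation f) {r : ℝ}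
    (hr0 : 0 ≤ r) (hr : r < 1) :
    ∃ ρ : ℝ, 0 ≤ ρ ∧ ρ < 1 ∧ ∀ (n : ℕ) (z : ℂ), ‖z‖ ≤ r → ‖f^[n] z‖ ≤ ρ ^ n := by
  obtain ⟨ρ, hρ0, hρ1, h⟩ := hT.exists_norm_le_mul hrot hr0 hr
  have key : ∀ (n : ℕ) (z : ℂ), ‖z‖ ≤ r → ‖f^[n] z‖ ≤ ρ ^ n * ‖z‖ := by
    intro n
    induction n with
    | zero => intro z _; simp
    | succ n ih =>
      intro z hz
      have h1 := h z hz
      have h2 : ‖f z‖ ≤ r := h1.trans ((mul_le_of_le_one_left (norm_nonneg _) hρ1.le).trans hz)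
      rw [Function.iterate_succ_apply]
      calc ‖f^[n] (f z)‖ ≤ ρ ^ n * ‖f z‖ := ih _ h2
        _ ≤ ρ ^ n * (ρ * ‖z‖) := by gcongr
        _ = _ := by ring
  refine ⟨ρ, hρ0, hρ1, fun n z hz => (key n z hz).trans ?_⟩
  exact mul_le_of_le_one_right (by positivity) (hz.trans hr.le)

theorem iterate_mapsTo (hT : IsBoundaryMap f T) (n : ℕ) :
    MapsTo f^[n] (Metric.ball 0 1) (Metric.ball 0 1) := hT.mapsTo.iterate n

theorem integral_poissonKernel_mul_iterate (hT : IsBoundaryMap f T) (n : ℕ) {z : ℂ}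
    (hz : z ∈ Metric.ball (0 : ℂ) 1) {G : Circle → ℂ} (hG : Integrable G circleMeasure) :
    ∫ ξ : Circle, (poissonKernel 0 z ξ : ℂ) * G (T^[n] ξ) ∂circleMeasure =
      ∫ ξ : Circle, (poissonKernel 0 (f^[n] z) ξ : ℂ) * G ξ ∂circleMeasure := by
  induction n generalizing z with
  | zero => rfl
  | succ n ih =>
    have hGn : Integrable (fun ξ => G (T^[n] ξ)) circleMeasure :=
      (hT.measurePreserving.iterate n).integrable_comp_of_integrable hG
    simp only [Function.iterate_succ_apply]
    rw [hT.integral_poissonKernel_mul_comp hz hGn, ih (hT.mapsTo hz)]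

end IsBoundaryMap

/-! ### Poisson kernels near the origin and near the circle -/

theorem abs_poissonKernel_sub_one_le {w : ℂ} (hw : ‖w‖ ≤ 1 / 2) (ξ : Circle) :
    |poissonKernel 0 w ξ - 1| ≤ 8 * ‖w‖ := by
  have h1 : 1 - ‖w‖ ≤ ‖(ξ : ℂ) - w‖ := by
    have := norm_sub_norm_le (ξ : ℂ) w
    rwa [Circle.norm_coe] at this
  have h2 : ‖(ξ : ℂ) - w‖ ≤ 1 + ‖w‖ := by
    have := norm_sub_le (ξ : ℂ) w
    rwa [Circle.norm_coe] at this
  have h0 := norm_nonneg w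
  have hpos : (0 : ℝ) < ‖(ξ : ℂ) - w‖ := by linarith
  have h4 : (1 / 4 : ℝ) ≤ ‖(ξ : ℂ) - w‖ ^ 2 := by nlinarith
  have e : poissonKernel 0 w ξ - 1 =
      (1 - ‖w‖ ^ 2 - ‖(ξ : ℂ) - w‖ ^ 2) / ‖(ξ : ℂ) - w‖ ^ 2 := by
    rw [poissonKernel, sub_zero, sub_zero, Circle.norm_coe]
    field_simp
  rw [e, abs_div, abs_of_pos (by positivity : (0 : ℝ) < ‖(ξ : ℂ) - w‖ ^ 2),
    div_le_iff₀ (by positivity), abs_le]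
  constructor <;> nlinarith

theorem norm_integral_poissonKernel_mul_sub_le {w : ℂ} (hw : ‖w‖ ≤ 1 / 2) {H : Circle → ℂ}
    (hH : Integrable H circleMeasure) :
    ‖∫ ξ : Circle, (poissonKernel 0 w ξ : ℂ) * H ξ ∂circleMeasure - ∫ ξ, H ξ ∂circleMeasure‖ ≤
      8 * ‖w‖ * ∫ ξ, ‖H ξ‖ ∂circleMeasure := by
  have hwb : w ∈ Metric.ball (0 : ℂ) 1 := by rw [mem_ball_zero_iff]; linarith
  have hi : Integrable (fun ξ : Circle => (poissonKernel 0 w ξ : ℂ) * H ξ) circleMeasure :=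
    integrable_mul_comp (.id _) (IsBoundaryMap.poissonWeight w hwb) hH
  rw [← integral_sub hi hH, ← integral_const_mul]
  refine norm_integral_le_of_norm_le (hH.norm.const_mul _) (.of_forall fun ξ => ?_)
  rw [show (poissonKernel 0 w ξ : ℂ) * H ξ - H ξ = ((poissonKernel 0 w ξ - 1 : ℝ) : ℂ) * H ξ by
    push_cast; ring, norm_mul, Complex.norm_real]
  exact mul_le_mul_of_nonneg_right (abs_poissonKernel_sub_one_le hw ξ) (norm_nonneg _)

theorem poissonKernel_symm (r : ℝ) (ξ η : Circle) :
    poissonKernel 0 ((r : ℂ) * η) ξ = poissonKernel 0 ((r : ℂ) * ξ) η := by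
  have h : ∀ ξ η : Circle, ‖(ξ : ℂ) - r * η‖ ^ 2 =
      1 + r ^ 2 - 2 * r * ((ξ : ℂ).re * (η : ℂ).re + (ξ : ℂ).im * (η : ℂ).im) := by
    intro ξ η
    have h1 := Circle.normSq_coe ξ
    have h2 := Circle.normSq_coe η
    rw [Complex.normSq_apply] at h1 h2
    rw [← Complex.normSq_eq_norm_sq, Complex.normSq_apply]
    simp only [Complex.sub_re, Complex.sub_im, Complex.re_ofReal_mul, Complex.im_ofReal_mul]
    linear_combination h1 + r ^ 2 * h2
  simp only [poissonKernel, sub_zero, norm_mul, Circle.norm_coe, h]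
  ring_nf

theorem ofReal_mul_circle_mem_ball {r : ℝ} (hr0 : 0 ≤ r) (hr : r < 1) (ξ : Circle) :
    (r : ℂ) * ξ ∈ Metric.ball (0 : ℂ) 1 := by
  rw [mem_ball_zero_iff, norm_mul, Circle.norm_coe, mul_one, Complex.norm_real,
    Real.norm_of_nonneg hr0]
  exact hr

/-- The Poisson kernel with pole at `r ξ` concentrates near `ξ` as `r → 1`. -/
theorem integral_poissonKernel_mul_norm_sub_sq {r : ℝ} (hr0 : 0 ≤ r) (hr : r < 1) (ξ : Circle) :
    ∫ η : Circle, poissonKernel 0 ((r : ℂ) * ξ) η * ‖(η : ℂ) - ξ‖ ^ 2 ∂circleMeasure =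
      2 * (1 - r) := by
  have hz := ofReal_mul_circle_mem_ball hr0 hr ξ
  -- On the circle `|η - ξ|² = 2 Re (1 - η \bar ξ)`, and `1 - η \bar ξ` is analytic in `η` with
  -- value `1 - r` at `r ξ`.
  have h := ((HasBoundary.const 1).sub (HasBoundary.id'.mul
    (HasBoundary.const (conj (ξ : ℂ))))).integral_poissonKernel hz
  have hξ : (ξ : ℂ) * conj (ξ : ℂ) = 1 := by
    rw [circle_conj_eq_inv, mul_inv_cancel₀ (Circle.coe_ne_zero ξ)]
  rw [mul_assoc, hξ, mul_one] at h
  have h2 := congrArg Complex.re h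
  have hP := continuous_poissonKernel_circle hz
  have hi : Integrable (fun η : Circle => (poissonKernel 0 ((r : ℂ) * ξ) η : ℂ) *
      (1 - (η : ℂ) * conj (ξ : ℂ))) circleMeasure :=
    integrable_circleMeasure_of_continuous
      ((Complex.continuous_ofReal.comp hP).mul (by fun_prop))
  have h3 := integral_re hi
  simp only [RCLike.re_to_complex] at h3
  rw [← h3] at h2
  simp only [Complex.re_ofReal_mul, Complex.sub_re, Complex.one_re, Complex.ofReal_re] at h2
  rw [← h2, ← integral_const_mul]
  congr 1
  ext η
  have h4 := Circle.normSq_coe ξ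
  have h5 := Circle.normSq_coe η
  rw [Complex.normSq_apply] at h4 h5
  rw [← Complex.normSq_eq_norm_sq, Complex.normSq_apply]
  simp only [Complex.sub_re, Complex.sub_im, Complex.mul_re, Complex.conj_re, Complex.conj_im]
  linear_combination poissonKernel 0 ((r : ℂ) * ξ) η * (h4 + h5)

/-- The inequality `x ≤ s/2 + x²/(2 s)` converts the Lipschitz bound into the second moment `2 (1 -
r)` of the kernel. -/
theorem norm_poisson_average_sub_le (φ : C(Circle, ℂ)) {L : ℝ} (hL0 : 0 ≤ L)
    (hL : ∀ ξ η : Circle, ‖φ η - φ ξ‖ ≤ L * ‖(η : ℂ) - ξ‖) {r s : ℝ} (hr0 : 0 ≤ r) (hr : r < 1)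
    (hs : 0 < s) (ξ : Circle) :
    ‖∫ η : Circle, (poissonKernel 0 ((r : ℂ) * ξ) η : ℂ) * φ η ∂circleMeasure - φ ξ‖ ≤
      L * (s + (1 - r) / s) := by
  have hz := ofReal_mul_circle_mem_ball hr0 hr ξ
  have hP := continuous_poissonKernel_circle hz
  have hPc := Complex.continuous_ofReal.comp hP
  have h1 : ∫ η : Circle, (poissonKernel 0 ((r : ℂ) * ξ) η : ℂ) * φ ξ ∂circleMeasure = φ ξ :=
    (HasBoundary.const (φ ξ)).integral_poissonKernel hz
  have h1' : ∫ η : Circle, poissonKernel 0 ((r : ℂ) * ξ) η ∂circleMeasure = 1 := by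
    have := (HasBoundary.const 1).integral_poissonKernel hz
    simp only [mul_one] at this
    rw [integral_complex_ofReal] at this
    exact_mod_cast this
  have h2 : ∫ η : Circle, ((poissonKernel 0 ((r : ℂ) * ξ) η : ℂ) * φ η -
      (poissonKernel 0 ((r : ℂ) * ξ) η : ℂ) * φ ξ) ∂circleMeasure =
      ∫ η : Circle, (poissonKernel 0 ((r : ℂ) * ξ) η : ℂ) * φ η ∂circleMeasure -
      ∫ η : Circle, (poissonKernel 0 ((r : ℂ) * ξ) η : ℂ) * φ ξ ∂circleMeasure := integral_sub
    (integrable_circleMeasure_of_continuous (hPc.mul φ.continuous))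
    (integrable_circleMeasure_of_continuous (hPc.mul (continuous_const (y := φ ξ))))
  rw [h1] at h2
  rw [← h2]
  have hb : ∀ η : Circle, ‖(poissonKernel 0 ((r : ℂ) * ξ) η : ℂ) * φ η -
      (poissonKernel 0 ((r : ℂ) * ξ) η : ℂ) * φ ξ‖ ≤
      L * (s / 2 * poissonKernel 0 ((r : ℂ) * ξ) η +
        1 / (2 * s) * (poissonKernel 0 ((r : ℂ) * ξ) η * ‖(η : ℂ) - ξ‖ ^ 2)) := by
    intro η
    have hP0 := poissonKernel_nonneg_circle hz η
    rw [← mul_sub, norm_mul, Complex.norm_real, Real.norm_of_nonneg hP0]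
    have h3 : ‖(η : ℂ) - ξ‖ ≤ s / 2 + 1 / (2 * s) * ‖(η : ℂ) - ξ‖ ^ 2 := by
      have : s / 2 + 1 / (2 * s) * ‖(η : ℂ) - ξ‖ ^ 2 - ‖(η : ℂ) - ξ‖ =
          (s - ‖(η : ℂ) - ξ‖) ^ 2 / (2 * s) := by field_simp; ring
      have : 0 ≤ (s - ‖(η : ℂ) - ξ‖) ^ 2 / (2 * s) := by positivity
      linarith
    calc poissonKernel 0 ((r : ℂ) * ξ) η * ‖φ η - φ ξ‖
        ≤ poissonKernel 0 ((r : ℂ) * ξ) η *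
          (L * (s / 2 + 1 / (2 * s) * ‖(η : ℂ) - ξ‖ ^ 2)) :=
          mul_le_mul_of_nonneg_left ((hL ξ η).trans (mul_le_mul_of_nonneg_left h3 hL0)) hP0
      _ = _ := by ring
  have i1 : Integrable (fun η : Circle => s / 2 * poissonKernel 0 ((r : ℂ) * ξ) η)
      circleMeasure := integrable_circleMeasure_of_continuous (hP.const_mul _)
  have i2 : Integrable (fun η : Circle => 1 / (2 * s) *
      (poissonKernel 0 ((r : ℂ) * ξ) η * ‖(η : ℂ) - ξ‖ ^ 2)) circleMeasure :=
    integrable_circleMeasure_of_continuous ((hP.mul (by fun_prop)).const_mul _)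
  refine (norm_integral_le_of_norm_le ((i1.add i2).const_mul L) (.of_forall hb)).trans ?_
  simp only [Pi.add_apply]
  rw [integral_const_mul, integral_add i1 i2, integral_const_mul, integral_const_mul, h1',
    integral_poissonKernel_mul_norm_sub_sq hr0 hr]
  refine mul_le_mul_of_nonneg_left ?_ hL0
  have : 1 / (2 * s) * (2 * (1 - r)) = (1 - r) / s := by field_simp
  rw [this]
  linarith

namespace IsBoundaryMap

variable {f : ℂ → ℂ} {T : Circle → Circle}

/-- Fubini and the symmetry of the kernel put the pole at `r η`, and `T^n` then carries the harmonic
measure at `r η` to that at `f^n (r η)`. Smoothing `φ` thus moves the problem strictly inside the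
disc, where iterates tend to zero. -/
theorem integral_poisson_average_mul_iterate (hT : IsBoundaryMap f T) (φ : C(Circle, ℂ)) {r : ℝ}
    (hr0 : 0 ≤ r) (hr : r < 1) (n : ℕ) {H : Circle → ℂ} (hH : Integrable H circleMeasure) :
    ∫ ξ : Circle, (∫ η : Circle, (poissonKernel 0 ((r : ℂ) * ξ) η : ℂ) * φ η ∂circleMeasure) *
        H (T^[n] ξ) ∂circleMeasure =
      ∫ η : Circle, φ η * ∫ ξ : Circle, (poissonKernel 0 (f^[n] ((r : ℂ) * η)) ξ : ℂ) * H ξ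
        ∂circleMeasure ∂circleMeasure := by
  have hHn : Integrable (fun ξ => H (T^[n] ξ)) circleMeasure :=
    (hT.measurePreserving.iterate n).integrable_comp_of_integrable hH
  have hK : Continuous fun p : Circle × Circle =>
      (poissonKernel 0 ((r : ℂ) * p.1) p.2 : ℂ) * φ p.2 := by
    refine (Complex.continuous_ofReal.comp ?_).mul (by fun_prop)
    unfold poissonKernel
    refine Continuous.div (by fun_prop) (by fun_prop) fun p => ?_
    have h : (p.2 : ℂ) ≠ (r : ℂ) * p.1 := by
      intro h
      have := ofReal_mul_circle_mem_ball hr0 hr p.1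
      rw [← h, mem_ball_zero_iff, Circle.norm_coe] at this
      exact lt_irrefl _ this
    simpa [sub_eq_zero] using h
  obtain ⟨C, hC⟩ := isCompact_univ.exists_bound_of_continuousOn hK.continuousOn
  have hint : Integrable (fun p : Circle × Circle =>
      ((poissonKernel 0 ((r : ℂ) * p.1) p.2 : ℂ) * φ p.2) * H (T^[n] p.1))
      (circleMeasure.prod circleMeasure) :=
    (hHn.comp_fst circleMeasure).bdd_mul (c := C) hK.aestronglyMeasurable
      (.of_forall fun p => hC p (mem_univ p))
  simp_rw [← integral_mul_const]
  rw [integral_integral_swap hint]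
  congr 1
  ext η
  rw [← hT.integral_poissonKernel_mul_iterate n (ofReal_mul_circle_mem_ball hr0 hr η) hH,
    ← integral_const_mul]
  congr 1
  ext ξ
  rw [poissonKernel_symm]
  ring

/-- The iterates of `T` equidistribute any Lipschitz weight, uniformly in the test function. -/
theorem exists_forall_norm_integral_mul_iterate_sub_le (hT : IsBoundaryMap f T)
    (hrot : ¬ IsDiscRotation f) (φ : C(Circle, ℂ)) {L : ℝ} (hL0 : 0 ≤ L)
    (hL : ∀ ξ η : Circle, ‖φ η - φ ξ‖ ≤ L * ‖(η : ℂ) - ξ‖) {ε : ℝ} (hε : 0 < ε) :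
    ∃ K₀ : ℕ, ∀ n, K₀ ≤ n → ∀ H : Circle → ℂ, Integrable H circleMeasure →
      ‖∫ ξ, φ ξ * H (T^[n] ξ) ∂circleMeasure -
        (∫ ξ, φ ξ ∂circleMeasure) * ∫ ξ, H ξ ∂circleMeasure‖ ≤
      ε * ∫ ξ, ‖H ξ‖ ∂circleMeasure := by
  -- The order of choice is `s`, then `r` with `1 - r ≤ s²`, then `K₀`. The first two make the
  -- smoothing error at most `ε/2`; with `r` fixed, large iterates make the remaining error at most
  -- `ε/2`.
  obtain ⟨s, hs, hsε⟩ : ∃ s : ℝ, 0 < s ∧ L * (s + s) ≤ ε / 2 := by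
    refine ⟨ε / (4 * (L + 1)), by positivity, ?_⟩
    rw [← two_mul, ← mul_assoc, mul_div_assoc', div_le_iff₀ (by positivity)]
    nlinarith
  obtain ⟨r, hr0, hr1, hrs⟩ : ∃ r : ℝ, 0 ≤ r ∧ r < 1 ∧ (1 - r) / s ≤ s := by
    refine ⟨max 0 (1 - s ^ 2), le_max_left _ _, max_lt one_pos ?_, ?_⟩
    · have : 0 < s ^ 2 := by positivity
      linarith
    · rw [div_le_iff₀ hs]
      have := le_max_right 0 (1 - s ^ 2)
      nlinarith
  obtain ⟨ρ, hρ0, hρ1, hρ⟩ := hT.exists_norm_iterate_le hrot hr0 hr1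
  have hφ1 : (0 : ℝ) < ‖φ‖ + 1 := by positivity
  obtain ⟨K₀, hK₀⟩ : ∃ K₀ : ℕ, ∀ n, K₀ ≤ n → ρ ^ n < min (1 / 2) (ε / (16 * (‖φ‖ + 1))) :=
    eventually_atTop.1 ((tendsto_pow_atTop_nhds_zero_of_lt_one hρ0 hρ1).eventually
      (gt_mem_nhds (by positivity)))
  refine ⟨K₀, fun n hn H hH => ?_⟩
  have hsmall := hK₀ n hn
  have hI0 : 0 ≤ ∫ ξ, ‖H ξ‖ ∂circleMeasure := integral_nonneg fun ξ => norm_nonneg _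
  have hmp := hT.measurePreserving.iterate n
  have hHn : Integrable (fun ξ => H (T^[n] ξ)) circleMeasure :=
    hmp.integrable_comp_of_integrable hH
  have hHnorm : ∫ ξ, ‖H (T^[n] ξ)‖ ∂circleMeasure = ∫ ξ, ‖H ξ‖ ∂circleMeasure :=
    hmp.integral_comp_circle hH.norm
  have havg := fun ξ => norm_poisson_average_sub_le φ hL0 hL hr0 hr1 hs ξ
  set A : Circle → ℂ := fun ξ =>
    ∫ η : Circle, (poissonKernel 0 ((r : ℂ) * ξ) η : ℂ) * φ η ∂circleMeasure with hA
  have hAm : AEStronglyMeasurable A circleMeasure := by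
    have hP : Measurable fun p : Circle × Circle =>
        (poissonKernel 0 ((r : ℂ) * p.1) p.2 : ℂ) * φ p.2 := by
      unfold poissonKernel
      have h1 : Measurable fun p : Circle × Circle => (p.1 : ℂ) :=
        measurable_circleCoe.comp measurable_fst
      have h2 : Measurable fun p : Circle × Circle => (p.2 : ℂ) :=
        measurable_circleCoe.comp measurable_snd
      exact (Complex.measurable_ofReal.comp (by fun_prop)).mul
        (φ.continuous.measurable.comp measurable_snd)
    exact hP.stronglyMeasurable.integral_prod_right.aestronglyMeasurable
  have hφH : Integrable (fun ξ => φ ξ * H (T^[n] ξ)) circleMeasure := integrable_mul_comp hmp φ hH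
  have hAH : Integrable (fun ξ => A ξ * H (T^[n] ξ)) circleMeasure := by
    refine hHn.bdd_mul (c := L * (s + (1 - r) / s) + ‖φ‖) hAm (.of_forall fun ξ => ?_)
    have h1 := norm_add_le (A ξ - φ ξ) (φ ξ)
    rw [sub_add_cancel] at h1
    exact h1.trans (add_le_add (havg ξ) (φ.norm_coe_le_norm ξ))
  have b1 : ‖∫ ξ, φ ξ * H (T^[n] ξ) ∂circleMeasure - ∫ ξ, A ξ * H (T^[n] ξ) ∂circleMeasure‖ ≤
      ε / 2 * ∫ ξ, ‖H ξ‖ ∂circleMeasure := by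
    rw [← integral_sub hφH hAH, ← hHnorm, ← integral_const_mul]
    refine norm_integral_le_of_norm_le (hHn.norm.const_mul _) (.of_forall fun ξ => ?_)
    rw [← sub_mul, norm_mul, norm_sub_rev]
    refine mul_le_mul_of_nonneg_right ((havg ξ).trans (le_trans ?_ hsε)) (norm_nonneg _)
    gcongr
  have b2 : ‖∫ ξ, A ξ * H (T^[n] ξ) ∂circleMeasure -
      (∫ ξ, φ ξ ∂circleMeasure) * ∫ ξ, H ξ ∂circleMeasure‖ ≤
      ε / 2 * ∫ ξ, ‖H ξ‖ ∂circleMeasure := by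
    have hfub := hT.integral_poisson_average_mul_iterate φ hr0 hr1 n hH
    have hbound : ∀ η : Circle, ‖∫ ξ : Circle, (poissonKernel 0 (f^[n] ((r : ℂ) * η)) ξ : ℂ) * H ξ
        ∂circleMeasure - ∫ ξ, H ξ ∂circleMeasure‖ ≤ 8 * ρ ^ n * ∫ ξ, ‖H ξ‖ ∂circleMeasure := by
      intro η
      have hw : ‖f^[n] ((r : ℂ) * η)‖ ≤ ρ ^ n := by
        refine hρ n _ ?_
        rw [norm_mul, Circle.norm_coe, mul_one, Complex.norm_real, Real.norm_of_nonneg hr0]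
      refine (norm_integral_poissonKernel_mul_sub_le
        (hw.trans (hsmall.le.trans (min_le_left _ _))) hH).trans ?_
      gcongr
    have hcont : Continuous fun η : Circle => ∫ ξ : Circle,
        (poissonKernel 0 (f^[n] ((r : ℂ) * η)) ξ : ℂ) * H ξ ∂circleMeasure := by
      simp_rw [← fun η : Circle => hT.integral_poissonKernel_mul_iterate n
        (ofReal_mul_circle_mem_ball hr0 hr1 η) hH]
      have hKc : Continuous fun p : Circle × Circle =>
          (poissonKernel 0 ((r : ℂ) * p.1) p.2 : ℂ) := by
        refine Complex.continuous_ofReal.comp ?_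
        unfold poissonKernel
        refine Continuous.div (by fun_prop) (by fun_prop) fun p => ?_
        have h : (p.2 : ℂ) ≠ (r : ℂ) * p.1 := by
          intro h
          have := ofReal_mul_circle_mem_ball hr0 hr1 p.1
          rw [← h, mem_ball_zero_iff, Circle.norm_coe] at this
          exact lt_irrefl _ this
        simpa [sub_eq_zero] using h
      obtain ⟨C, hC⟩ := isCompact_univ.exists_bound_of_continuousOn hKc.continuousOn
      refine continuous_of_dominated (bound := fun ξ => C * ‖H (T^[n] ξ)‖) (fun η => ?_)
        (fun η => .of_forall fun ξ => ?_) (hHn.norm.const_mul C) (.of_forall fun ξ => ?_)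
      · exact ((hKc.comp (Continuous.prodMk continuous_const continuous_id)).aestronglyMeasurable).mul
          hHn.aestronglyMeasurable
      · rw [norm_mul]
        exact mul_le_mul_of_nonneg_right (hC (η, ξ) (mem_univ _)) (norm_nonneg _)
      · exact (hKc.comp (Continuous.prodMk continuous_id continuous_const)).mul_const _
    rw [hfub, ← integral_mul_const, ← integral_sub
      (integrable_circleMeasure_of_continuous (φ.continuous.fun_mul hcont))
      (integrable_circleMeasure_of_continuous (φ.continuous.mul_const _))]
    refine (norm_integral_le_of_norm_le_const (C := ‖φ‖ * (8 * ρ ^ n * ∫ ξ, ‖H ξ‖ ∂circleMeasure))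
      (.of_forall fun η => ?_)).trans ?_
    · rw [← mul_sub, norm_mul]
      exact mul_le_mul (φ.norm_coe_le_norm η) (hbound η) (norm_nonneg _) (norm_nonneg _)
    · rw [probReal_univ, mul_one, ← mul_assoc]
      refine mul_le_mul_of_nonneg_right ?_ hI0
      have h1 := hsmall.le.trans (min_le_right _ _)
      rw [le_div_iff₀ (by positivity)] at h1
      have h2 : 0 ≤ ρ ^ n := by positivity
      nlinarith [norm_nonneg φ]
  have := norm_add_le (∫ ξ, φ ξ * H (T^[n] ξ) ∂circleMeasure - ∫ ξ, A ξ * H (T^[n] ξ) ∂circleMeasure)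
    (∫ ξ, A ξ * H (T^[n] ξ) ∂circleMeasure -
      (∫ ξ, φ ξ ∂circleMeasure) * ∫ ξ, H ξ ∂circleMeasure)
  rw [sub_add_sub_cancel] at this
  linarith

end IsBoundaryMap

/-! ### Sums of iterated differences -/

/-- The sequence `b` with `b n = α n + q * b (n - 1)`. -/
def geometricConv (q : ℂ) (α : ℕ → ℂ) : ℕ → ℂ
  | 0 => α 0
  | n + 1 => α (n + 1) + q * geometricConv q α n

/-- Summation by parts inverts `x ↦ x n - q * x (n + 1)` on coefficients, leaving one boundary term.
-/
theorem sum_geometricConv_mul (q : ℂ) (α x : ℕ → ℂ) (N : ℕ) :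
    ∑ n ∈ Finset.range (N + 1), geometricConv q α n * (x n - q * x (n + 1)) =
      ∑ n ∈ Finset.range (N + 1), α n * x n - q * geometricConv q α N * x (N + 1) := by
  induction N with
  | zero => simp [geometricConv]; ring
  | succ N ih =>
    rw [Finset.sum_range_succ, ih, Finset.sum_range_succ _ (N + 1)]
    simp only [geometricConv]
    ring

theorem summable_norm_of_summable_norm_geometricConv {q : ℂ} {α : ℕ → ℂ}
    (h : Summable fun n => ‖geometricConv q α n‖) : Summable fun n => ‖α n‖ := by
  rw [← summable_nat_add_iff 1]
  refine Summable.of_nonneg_of_le (fun _ => norm_nonneg _) (fun n => ?_)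
    (((summable_nat_add_iff 1).2 h).add (h.mul_left ‖q‖))
  have e : α (n + 1) = geometricConv q α (n + 1) - q * geometricConv q α n := by
    simp [geometricConv]
  calc ‖α (n + 1)‖ ≤ ‖geometricConv q α (n + 1)‖ + ‖q * geometricConv q α n‖ := by
        rw [e]; exact norm_sub_le _ _
    _ = _ := by rw [norm_mul]

/-- Convexity gives `(x + ρ y)² ≤ x²/(1 - ρ) + ρ y²`. After summation the last term is absorbed into
the left side, with total `A / (1 - ρ)²`. -/
theorem summable_norm_sq_geometricConv {q : ℂ} (hq : ‖q‖ < 1) {α : ℕ → ℂ}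
    (h : Summable fun n => ‖α n‖ ^ 2) : Summable fun n => ‖geometricConv q α n‖ ^ 2 := by
  set ρ := ‖q‖ with hρ
  have hρ0 : 0 ≤ ρ := norm_nonneg q
  have h1 : 0 < 1 - ρ := by linarith
  have hstep : ∀ n, ‖geometricConv q α (n + 1)‖ ^ 2 ≤
      ‖α (n + 1)‖ ^ 2 / (1 - ρ) + ρ * ‖geometricConv q α n‖ ^ 2 := by
    intro n
    have h2 : ‖geometricConv q α (n + 1)‖ ≤ ‖α (n + 1)‖ + ρ * ‖geometricConv q α n‖ := by
      rw [geometricConv, hρ, ← norm_mul]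
      exact norm_add_le _ _
    set x := ‖α (n + 1)‖
    set y := ‖geometricConv q α n‖
    have h3 : (x + ρ * y) ^ 2 ≤ x ^ 2 / (1 - ρ) + ρ * y ^ 2 := by
      have : x ^ 2 / (1 - ρ) + ρ * y ^ 2 - (x + ρ * y) ^ 2 =
          ρ * (x - (1 - ρ) * y) ^ 2 / (1 - ρ) := by field_simp; ring
      have : 0 ≤ ρ * (x - (1 - ρ) * y) ^ 2 / (1 - ρ) := by positivity
      linarith
    exact (pow_le_pow_left₀ (norm_nonneg _) h2 2).trans h3
  set A := ∑' n, ‖α n‖ ^ 2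
  have hA : ∀ N, ∑ n ∈ Finset.range N, ‖α n‖ ^ 2 ≤ A := fun N =>
    h.sum_le_tsum _ fun _ _ => by positivity
  have hbound : ∀ N, ∑ n ∈ Finset.range (N + 1), ‖geometricConv q α n‖ ^ 2 ≤
      (∑ n ∈ Finset.range (N + 1), ‖α n‖ ^ 2) / (1 - ρ) +
        ρ * ∑ n ∈ Finset.range N, ‖geometricConv q α n‖ ^ 2 := by
    intro N
    rw [Finset.sum_range_succ', Finset.sum_range_succ', add_div, Finset.sum_div, Finset.mul_sum]
    have h2 : ∑ n ∈ Finset.range N, ‖geometricConv q α (n + 1)‖ ^ 2 ≤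
        ∑ n ∈ Finset.range N, ‖α (n + 1)‖ ^ 2 / (1 - ρ) +
        ∑ n ∈ Finset.range N, ρ * ‖geometricConv q α n‖ ^ 2 := by
      rw [← Finset.sum_add_distrib]
      exact Finset.sum_le_sum fun n _ => hstep n
    have h3 : ‖geometricConv q α 0‖ ^ 2 ≤ ‖α 0‖ ^ 2 / (1 - ρ) := by
      rw [geometricConv, le_div_iff₀ h1]
      nlinarith [sq_nonneg ‖α 0‖]
    linarith
  refine summable_of_sum_range_le (c := A / (1 - ρ) ^ 2) (fun n => by positivity) fun N => ?_
  have h2 : ∑ n ∈ Finset.range N, ‖geometricConv q α n‖ ^ 2 ≤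
      ∑ n ∈ Finset.range (N + 1), ‖geometricConv q α n‖ ^ 2 :=
    Finset.sum_le_sum_of_subset_of_nonneg (Finset.range_mono (Nat.le_succ N))
      fun _ _ _ => by positivity
  have h3 := hbound N
  have h4 : (∑ n ∈ Finset.range (N + 1), ‖α n‖ ^ 2) / (1 - ρ) ≤ A / (1 - ρ) := by
    gcongr
    exact hA _
  rw [pow_two, ← div_div, le_div_iff₀ h1]
  linarith

/-- The sum `∑_{n < N} c_n d(T^n ξ)`. -/
noncomputable def iterateSum (d : Circle → ℂ) (T : Circle → Circle) (c : ℕ → ℂ) (N : ℕ)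
    (ξ : Circle) : ℂ :=
  ∑ n ∈ Finset.range N, c n * d (T^[n] ξ)

theorem iterateSum_add (d : Circle → ℂ) (T : Circle → Circle) (c : ℕ → ℂ) (M N : ℕ) (ξ : Circle) :
    iterateSum d T c (M + N) ξ =
      iterateSum d T c M ξ + iterateSum d T (fun n => c (M + n)) N (T^[M] ξ) := by
  simp only [iterateSum, Finset.sum_range_add]
  refine congrArg _ (Finset.sum_congr rfl fun n _ => ?_)
  rw [← Function.iterate_add_apply, add_comm]

theorem iterateSum_succ' (d : Circle → ℂ) (T : Circle → Circle) (c : ℕ → ℂ) (N : ℕ) (ξ : Circle) :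
    iterateSum d T c (N + 1) ξ =
      c 0 * d ξ + iterateSum d T (fun n => c (n + 1)) N (T ξ) := by
  simp only [iterateSum, Finset.sum_range_succ', Function.iterate_succ_apply,
    Function.iterate_zero_apply]
  ring

/-- The square of the first moment is at most the second moment. -/
theorem sq_integral_norm_le {g : Circle → ℂ} (hg : Integrable g circleMeasure)
    (hg2 : Integrable (fun ξ => ‖g ξ‖ ^ 2) circleMeasure) :
    (∫ ξ, ‖g ξ‖ ∂circleMeasure) ^ 2 ≤ ∫ ξ, ‖g ξ‖ ^ 2 ∂circleMeasure := by
  set I := ∫ ξ, ‖g ξ‖ ∂circleMeasure with hI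
  have h : 0 ≤ ∫ ξ, (‖g ξ‖ - I) ^ 2 ∂circleMeasure := integral_nonneg fun ξ => sq_nonneg _
  have e : ∀ ξ, (‖g ξ‖ - I) ^ 2 = ‖g ξ‖ ^ 2 - (2 * I * ‖g ξ‖ - I ^ 2) := fun ξ => by ring
  have hi : Integrable (fun ξ => 2 * I * ‖g ξ‖ - I ^ 2) circleMeasure :=
    (hg.norm.const_mul _).sub (integrable_const _)
  simp_rw [e] at h
  rw [integral_sub hg2 hi, integral_sub (hg.norm.const_mul _) (integrable_const _),
    integral_const_mul, integral_const, ← hI, probReal_univ, one_smul] at h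
  nlinarith

namespace IsBoundaryMap

variable {f : ℂ → ℂ} {T : Circle → Circle}

theorem measurable_iterateSum (hT : IsBoundaryMap f T) (c : ℕ → ℂ) (N : ℕ) :
    Measurable (iterateSum (boundaryDiff f T) T c N) := by
  refine Finset.measurable_fun_sum _ fun n _ => ?_
  exact (hT.measurable_boundaryDiff.comp (hT.measurable.iterate n)).const_mul _

theorem norm_iterateSum_le (hT : IsBoundaryMap f T) (c : ℕ → ℂ) (N : ℕ) (ξ : Circle) :
    ‖iterateSum (boundaryDiff f T) T c N ξ‖ ≤ 2 * ∑ n ∈ Finset.range N, ‖c n‖ := by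
  rw [Finset.mul_sum]
  refine norm_sum_le_of_le _ fun n _ => ?_
  rw [norm_mul, mul_comm]
  exact mul_le_mul_of_nonneg_right (hT.norm_boundaryDiff_le _) (norm_nonneg _)

theorem integrable_iterateSum (hT : IsBoundaryMap f T) (c : ℕ → ℂ) (N : ℕ) :
    Integrable (iterateSum (boundaryDiff f T) T c N) circleMeasure :=
  .of_bound (hT.measurable_iterateSum c N).aestronglyMeasurable _
    (.of_forall (hT.norm_iterateSum_le c N))

theorem integrable_norm_sq_iterateSum (hT : IsBoundaryMap f T) (c : ℕ → ℂ) (N : ℕ) :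
    Integrable (fun ξ => ‖iterateSum (boundaryDiff f T) T c N ξ‖ ^ 2) circleMeasure := by
  refine .of_bound ((hT.measurable_iterateSum c N).norm.pow_const 2).aestronglyMeasurable
    ((2 * ∑ n ∈ Finset.range N, ‖c n‖) ^ 2) (.of_forall fun ξ => ?_)
  rw [norm_pow, norm_norm]
  exact pow_le_pow_left₀ (norm_nonneg _) (hT.norm_iterateSum_le c N ξ) 2

/-- The differences `d ∘ T^n` are orthogonal in `L²`. -/
theorem integral_norm_sq_iterateSum (hT : IsBoundaryMap f T) (c : ℕ → ℂ) (N : ℕ) :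
    ∫ ξ, ‖iterateSum (boundaryDiff f T) T c N ξ‖ ^ 2 ∂circleMeasure =
      (1 - ‖dslope f 0 0‖ ^ 2) * ∑ n ∈ Finset.range N, ‖c n‖ ^ 2 := by
  induction N generalizing c with
  | zero => simp [iterateSum]
  | succ N ih =>
    set S := iterateSum (boundaryDiff f T) T (fun n => c (n + 1)) N
    have hS := hT.integrable_iterateSum (fun n => c (n + 1)) N
    have hS2 := hT.integrable_norm_sq_iterateSum (fun n => c (n + 1)) N
    have h0 := hT.integral_boundaryDiff_mul_comp (integrable_conj hS)
    have i0 : Integrable (fun ξ => boundaryDiff f T ξ * conj (S (T ξ))) circleMeasure :=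
      hT.integrable_boundaryDiff_mul (hT.integrable_comp (integrable_conj hS))
    have i1 : Integrable (fun ξ => (2 * (c 0 * (boundaryDiff f T ξ * conj (S (T ξ)))).re))
        circleMeasure := (Complex.reCLM.integrable_comp (i0.const_mul (c 0))).const_mul 2
    have h1 : ∫ ξ, 2 * (c 0 * (boundaryDiff f T ξ * conj (S (T ξ)))).re ∂circleMeasure = 0 := by
      rw [integral_const_mul]
      have := integral_re (i0.const_mul (c 0))
      simp only [RCLike.re_to_complex] at this
      rw [this, integral_const_mul, h0]
      simp
    have i2 : Integrable (fun ξ => ‖boundaryDiff f T ξ‖ ^ 2) circleMeasure := by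
      refine .of_bound (hT.measurable_boundaryDiff.norm.pow_const 2).aestronglyMeasurable (2 ^ 2)
        (.of_forall fun ξ => ?_)
      rw [norm_pow, norm_norm]
      exact pow_le_pow_left₀ (norm_nonneg _) (hT.norm_boundaryDiff_le ξ) 2
    have i3 : Integrable (fun ξ => ‖S (T ξ)‖ ^ 2) circleMeasure :=
      hT.measurePreserving.integrable_comp_of_integrable hS2
    have e : ∀ ξ, ‖iterateSum (boundaryDiff f T) T c (N + 1) ξ‖ ^ 2 =
        ‖c 0‖ ^ 2 * ‖boundaryDiff f T ξ‖ ^ 2 +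
          (‖S (T ξ)‖ ^ 2 + 2 * (c 0 * (boundaryDiff f T ξ * conj (S (T ξ)))).re) := fun ξ => by
      rw [iterateSum_succ', ← Complex.normSq_eq_norm_sq, Complex.normSq_add,
        Complex.normSq_eq_norm_sq, Complex.normSq_eq_norm_sq, norm_mul, mul_pow, mul_assoc,
        add_assoc]
    simp_rw [e]
    have i4 : Integrable (fun ξ => ‖S (T ξ)‖ ^ 2 +
        2 * (c 0 * (boundaryDiff f T ξ * conj (S (T ξ)))).re) circleMeasure := i3.add i1
    rw [integral_add (i2.const_mul _) i4, integral_add i3 i1, h1, integral_const_mul,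
      hT.integral_norm_sq_boundaryDiff,
      hT.measurePreserving.integral_comp_circle hS2, ih, Finset.sum_range_succ']
    ring

theorem integral_norm_iterateSum_le (hT : IsBoundaryMap f T) (c : ℕ → ℂ) (N : ℕ) :
    ∫ ξ, ‖iterateSum (boundaryDiff f T) T c N ξ‖ ∂circleMeasure ≤
      √(∑ n ∈ Finset.range N, ‖c n‖ ^ 2) := by
  refine Real.le_sqrt_of_sq_le ?_
  refine (sq_integral_norm_le (hT.integrable_iterateSum c N)
    (hT.integrable_norm_sq_iterateSum c N)).trans ?_
  rw [hT.integral_norm_sq_iterateSum]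
  refine mul_le_of_le_one_left (Finset.sum_nonneg fun _ _ => by positivity) ?_
  linarith [sq_nonneg ‖dslope f 0 0‖]

/-- A series of differences with square-summable coefficients converges in `L¹`. -/
theorem exists_tendsto_iterateSum (hT : IsBoundaryMap f T) {b : ℕ → ℂ}
    (hb : Summable fun n => ‖b n‖ ^ 2) :
    ∃ Φ : Circle → ℂ, Integrable Φ circleMeasure ∧
      Tendsto (fun N => ∫ ξ, ‖iterateSum (boundaryDiff f T) T b N (T ξ) - Φ ξ‖ ∂circleMeasure)
        atTop (𝓝 0) := by
  have hi : ∀ N, Integrable (fun ξ => iterateSum (boundaryDiff f T) T b N (T ξ)) circleMeasure :=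
    fun N => hT.integrable_comp (hT.integrable_iterateSum b N)
  let u : ℕ → (Circle →₁[circleMeasure] ℂ) := fun N => (hi N).toL1 _
  have hu : CauchySeq u := by
    refine cauchySeq_of_le_tendsto_0' (fun N => √(∑' n, ‖b (n + N)‖ ^ 2)) (fun N M hNM => ?_) ?_
    · obtain ⟨L, rfl⟩ := Nat.exists_eq_add_of_le hNM
      rw [dist_comm, dist_eq_norm, ← Integrable.toL1_sub, L1.norm_of_fun_eq_integral_norm]
      -- A block of the series is a sum of the same kind composed with `T^[N + 1]`, the extra step
      -- being the initial `T`. Its `L¹` norm is bounded by the `ℓ²` norm of a tail of `b`.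
      have e : ∀ ξ, ((fun ξ => iterateSum (boundaryDiff f T) T b (N + L) (T ξ)) -
          fun ξ => iterateSum (boundaryDiff f T) T b N (T ξ)) ξ =
          iterateSum (boundaryDiff f T) T (fun n => b (N + n)) L (T^[N + 1] ξ) := fun ξ => by
        rw [Pi.sub_apply, iterateSum_add, add_sub_cancel_left, Function.iterate_succ_apply]
      simp_rw [e]
      rw [(hT.measurePreserving.iterate (N + 1)).integral_comp_circle
        (hT.integrable_iterateSum (fun n => b (N + n)) L).norm]
      refine (hT.integral_norm_iterateSum_le _ _).trans (Real.sqrt_le_sqrt ?_)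
      simp_rw [add_comm N]
      exact ((summable_nat_add_iff N).2 hb).sum_le_tsum _ fun _ _ => by positivity
    · have := (tendsto_sum_nat_add fun n => ‖b n‖ ^ 2).sqrt
      rwa [Real.sqrt_zero] at this
  obtain ⟨v, hv⟩ := cauchySeq_tendsto_of_complete hu
  refine ⟨v, L1.integrable_coeFn v, ?_⟩
  rw [tendsto_iff_norm_sub_tendsto_zero] at hv
  refine hv.congr fun N => ?_
  have h1 : u N - v = ((hi N).sub (L1.integrable_coeFn v)).toL1 _ := by
    rw [Integrable.toL1_sub _ _ (hi N) (L1.integrable_coeFn v), Integrable.toL1_coeFn]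
  rw [h1, L1.norm_of_fun_eq_integral_norm]
  rfl

/-- The function `d` is the boundary function of `z - ā f(z)`, and composition with `T^n` moves the
evaluation point to `f^n z`. -/
theorem integral_poissonKernel_mul_boundaryDiff_iterate (hT : IsBoundaryMap f T) (n : ℕ) {z : ℂ}
    (hz : z ∈ Metric.ball (0 : ℂ) 1) :
    ∫ ξ : Circle, (poissonKernel 0 z ξ : ℂ) * boundaryDiff f T (T^[n] ξ) ∂circleMeasure =
      f^[n] z - conj (dslope f 0 0) * f^[n + 1] z := by
  have hd : Integrable (boundaryDiff f T) circleMeasure := by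
    simpa using hT.integrable_boundaryDiff_mul (G := fun _ => 1) (integrable_const _)
  rw [hT.integral_poissonKernel_mul_iterate n hz hd, Function.iterate_succ_apply']
  exact (HasBoundary.id'.sub ((HasBoundary.const (conj (dslope f 0 0))).mul
    hT.hasBoundary)).integral_poissonKernel (hT.iterate_mapsTo n hz)

theorem integral_poissonKernel_mul_iterateSum (hT : IsBoundaryMap f T) (b : ℕ → ℂ) (N : ℕ) {z : ℂ}
    (hz : z ∈ Metric.ball (0 : ℂ) 1) :
    ∫ ξ : Circle, (poissonKernel 0 z ξ : ℂ) * iterateSum (boundaryDiff f T) T b N (T ξ)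
      ∂circleMeasure =
      ∑ n ∈ Finset.range N, b n * (f^[n + 1] z - conj (dslope f 0 0) * f^[n + 2] z) := by
  simp only [iterateSum, Finset.mul_sum]
  have hd : Integrable (boundaryDiff f T) circleMeasure := by
    simpa using hT.integrable_boundaryDiff_mul (G := fun _ => 1) (integrable_const _)
  have hd' : ∀ n, Integrable (fun ξ => boundaryDiff f T (T^[n + 1] ξ)) circleMeasure := fun n =>
    (hT.measurePreserving.iterate (n + 1)).integrable_comp_of_integrable hd
  rw [integral_finsetSum]
  · refine Finset.sum_congr rfl fun n _ => ?_
    rw [← hT.integral_poissonKernel_mul_boundaryDiff_iterate (n + 1) hz, ← integral_const_mul]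
    congr 1
    ext ξ
    rw [Function.iterate_succ_apply]
    ring
  · intro n _
    exact integrable_mul_comp (.id _) (poissonWeight z hz) ((hd' n).const_mul (b n))

/-- `F` is the Poisson integral of the `L¹` sum of its boundary series. -/
theorem iterateSeries_eq_integral_poissonKernel (hT : IsBoundaryMap f T)
    (hrot : ¬ IsDiscRotation f) {a : ℕ → ℂ} (ha : Summable fun n => ‖a (n + 1)‖ ^ 2)
    {Φ : Circle → ℂ} (hΦ : Integrable Φ circleMeasure)
    (hlim : Tendsto (fun N => ∫ ξ, ‖iterateSum (boundaryDiff f T) T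
      (geometricConv (conj (dslope f 0 0)) fun n => a (n + 1)) N (T ξ) - Φ ξ‖ ∂circleMeasure)
        atTop (𝓝 0)) {z : ℂ} (hz : z ∈ Metric.ball (0 : ℂ) 1) :
    iterateSeries f a z = ∫ ξ : Circle, (poissonKernel 0 z ξ : ℂ) * Φ ξ ∂circleMeasure := by
  set q := conj (dslope f 0 0) with hq
  set b := geometricConv q fun n => a (n + 1) with hb
  have hq1 : ‖q‖ < 1 := by
    rw [hq, RCLike.norm_conj]
    exact hT.norm_dslope_lt_one hrot (by simp)
  have hb2 := summable_norm_sq_geometricConv hq1 ha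
  have hbounded : ∀ {c : ℕ → ℂ}, (Summable fun n => ‖c n‖ ^ 2) → ∃ C : ℝ, ∀ n, ‖c n‖ ≤ C := by
    intro c hc
    refine ⟨√(∑' n, ‖c n‖ ^ 2), fun n => Real.le_sqrt_of_sq_le ?_⟩
    exact hc.le_tsum n fun _ _ => by positivity
  obtain ⟨A, hA⟩ := hbounded ha
  obtain ⟨B, hB⟩ := hbounded hb2
  obtain ⟨ρ, hρ0, hρ1, hρ⟩ := hT.exists_norm_iterate_le hrot (norm_nonneg z)
    (mem_ball_zero_iff.1 hz)
  have hsum : Summable fun n => a (n + 1) * f^[n + 1] z := by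
    refine Summable.of_norm_bounded (g := fun n => A * ρ ^ n)
      ((summable_geometric_of_lt_one hρ0 hρ1).mul_left A) fun n => ?_
    rw [norm_mul]
    refine mul_le_mul (hA n) ((hρ (n + 1) z le_rfl).trans ?_) (norm_nonneg _)
      ((norm_nonneg _).trans (hA n))
    exact pow_le_pow_of_le_one hρ0 hρ1.le (Nat.le_succ n)
  have h1 : Tendsto (fun N => ∑ n ∈ Finset.range (N + 1),
      b n * (f^[n + 1] z - q * f^[n + 2] z)) atTop (𝓝 (iterateSeries f a z)) := by
    have e := fun N => sum_geometricConv_mul q (fun n => a (n + 1)) (fun n => f^[n + 1] z) N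
    simp_rw [← hb] at e
    simp_rw [show ∀ n, f^[n + 2] z = f^[n + 1 + 1] z from fun n => rfl, e]
    have h2 := (tendsto_add_atTop_iff_nat 1).2 hsum.hasSum.tendsto_sum_nat
    -- The boundary term of the summation by parts vanishes in the limit, as `b` is bounded and the
    -- iterates at `z` decay geometrically.
    have h3 : Tendsto (fun N => q * b N * f^[N + 1 + 1] z) atTop (𝓝 0) := by
      refine squeeze_zero_norm (a := fun N => ‖q‖ * B * ρ ^ N) (fun N => ?_) ?_
      · rw [norm_mul, norm_mul]
        have := (norm_nonneg _).trans (hB N)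
        refine mul_le_mul (mul_le_mul_of_nonneg_left (hB N) (norm_nonneg q))
          ((hρ (N + 1 + 1) z le_rfl).trans ?_) (norm_nonneg _) (by positivity)
        exact pow_le_pow_of_le_one hρ0 hρ1.le (by omega)
      · simpa using (tendsto_pow_atTop_nhds_zero_of_lt_one hρ0 hρ1).const_mul (‖q‖ * B)
    have h4 := h2.sub h3
    rw [sub_zero] at h4
    exact h4
  refine tendsto_nhds_unique h1 ?_
  refine Tendsto.congr (fun N => hT.integral_poissonKernel_mul_iterateSum b (N + 1) hz) ?_
  rw [tendsto_add_atTop_iff_nat (f := fun N => ∫ ξ : Circle, (poissonKernel 0 z ξ : ℂ) *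
    iterateSum (boundaryDiff f T) T b N (T ξ) ∂circleMeasure) 1, tendsto_iff_norm_sub_tendsto_zero]
  have h4 := hlim.const_mul ‖poissonWeight z hz‖
  rw [mul_zero] at h4
  refine squeeze_zero (fun _ => norm_nonneg _) (fun N => ?_) h4
  have hi : Integrable (fun ξ => iterateSum (boundaryDiff f T) T b N (T ξ)) circleMeasure :=
    hT.integrable_comp (hT.integrable_iterateSum b N)
  have h5 := norm_integral_mul_comp_le (.id _) (poissonWeight z hz) (hi.sub hΦ)
  simp only [Pi.sub_apply, mul_sub, id] at h5
  have h6 := integral_sub (integrable_mul_comp (.id _) (poissonWeight z hz) hi)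
    (integrable_mul_comp (.id _) (poissonWeight z hz) hΦ)
  simp only [id] at h6
  rw [h6] at h5
  exact h5

end IsBoundaryMap

/-! ### Boundedness on an arc -/

instance : circleMeasure.IsOpenPosMeasure := by
  refine ⟨fun U hU ⟨ξ, hξ⟩ h => ?_⟩
  have hV : IsOpen ((fun t : ℝ => Circle.exp t) ⁻¹' U) := hU.preimage Circle.exp.continuous
  have hmem : Complex.arg ξ ∈ (fun t : ℝ => Circle.exp t) ⁻¹' U := by
    change Circle.exp (Complex.arg ξ) ∈ U
    rwa [Circle.exp_arg]
  -- The argument may equal `π`, so only membership in the closure is available; openness of `U`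
  -- makes this sufficient.
  have hcl : Complex.arg ξ ∈ closure (Ioo (-Real.pi) Real.pi) := by
    rw [closure_Ioo (by linarith [Real.pi_pos])]
    exact ⟨(Complex.neg_pi_lt_arg _).le, Complex.arg_le_pi _⟩
  have hne : (((fun t : ℝ => Circle.exp t) ⁻¹' U) ∩ Ioo (-Real.pi) Real.pi).Nonempty :=
    mem_closure_iff.1 hcl _ hV hmem
  have hpos := (hV.inter isOpen_Ioo).measure_pos volume hne
  have h0 := ae_restrict_of_ae_circleMeasure (p := fun ξ => ξ ∉ U) (measure_eq_zero_iff_ae_notMem.1 h)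
  rw [ae_restrict_iff' measurableSet_Ioc, ae_iff] at h0
  refine hpos.ne' (measure_mono_null (fun t ht => ?_) h0)
  simp only [mem_ofPred_eq, Classical.not_imp, not_not]
  exact ⟨Ioo_subset_Ioc_self ht.2, ht.1⟩

/-- By Fatou's theorem the radial limit of `F` exists and equals `Φ` almost everywhere, so the bound
on radial limits becomes a bound on `Φ`. -/
theorem EssBoundedOnArc.exists_ae_norm_le {F : ℂ → ℂ} {α β : ℝ} (hF : EssBoundedOnArc F α β)
    {Φ : Circle → ℂ} (hΦ : Integrable Φ circleMeasure)
    (hFΦ : ∀ z ∈ Metric.ball (0 : ℂ) 1,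
      F z = ∫ ξ : Circle, (poissonKernel 0 z ξ : ℂ) * Φ ξ ∂circleMeasure) :
    ∃ M : ℝ, 0 ≤ M ∧ ∀ᵐ ξ : Circle ∂circleMeasure,
      ξ ∈ (fun t : ℝ => Circle.exp t) '' Ioo α β → ‖Φ ξ‖ ≤ M := by
  obtain ⟨M, hM⟩ := hF
  refine ⟨max M 0, le_max_right _ _, ae_circleMeasure_of_ae (p := fun ξ =>
    ξ ∈ (fun t : ℝ => Circle.exp t) '' Ioo α β → ‖Φ ξ‖ ≤ max M 0) ?_⟩
  have h1 : ∀ᵐ t : ℝ, t ∈ Ioo α β → ‖Φ (Circle.exp t)‖ ≤ M := by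
    filter_upwards [hM, ae_tendsto_integral_poissonKernel hΦ] with t ht1 ht2 ht
    refine ht1 ht _ (ht2.congr' ?_)
    have hpos : ∀ᶠ r in 𝓝[<] (1 : ℝ), 0 ≤ r := mem_nhdsWithin_of_mem_nhds (Ici_mem_nhds one_pos)
    filter_upwards [self_mem_nhdsWithin, hpos] with r hr1 hr0
    rw [← coe_circleExp_eq_circlePoint, hFΦ _ (ofReal_mul_circle_mem_ball hr0 hr1 _)]
  -- A point of the arc has many angles and the given one need not lie in `(α, β)`, so all
  -- translates by multiples of `2π` are treated.
  have h2 : ∀ k : ℤ, ∀ᵐ t : ℝ, t + k * (2 * Real.pi) ∈ Ioo α β →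
      ‖Φ (Circle.exp (t + k * (2 * Real.pi)))‖ ≤ M := fun k =>
    (measurePreserving_add_right volume (k * (2 * Real.pi))).quasiMeasurePreserving.ae h1
  filter_upwards [ae_all_iff.2 h2] with t ht ⟨s, hs, hst⟩
  obtain ⟨k, hk⟩ := Circle.exp_eq_exp.1 hst
  have := ht k
  rw [← hk, show Circle.exp s = Circle.exp t from hst] at this
  exact (this hs).trans (le_max_left _ _)

/-- A tent function on the circle. -/
noncomputable def circleTent (ζ : Circle) (δ : ℝ) : C(Circle, ℂ) :=
  ⟨fun ξ => ((max 0 (δ - ‖(ξ : ℂ) - ζ‖) : ℝ) : ℂ), Complex.continuous_ofReal.comp (by fun_prop)⟩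

theorem norm_circleTent_sub_le (ζ : Circle) (δ : ℝ) (ξ η : Circle) :
    ‖circleTent ζ δ η - circleTent ζ δ ξ‖ ≤ 1 * ‖(η : ℂ) - ξ‖ := by
  simp only [circleTent, ContinuousMap.coe_mk]
  rw [← Complex.ofReal_sub, Complex.norm_real, Real.norm_eq_abs, one_mul]
  refine (abs_max_sub_max_le_max _ _ _ _).trans (max_le ?_ ?_)
  · simp
  · have e : δ - ‖(η : ℂ) - ζ‖ - (δ - ‖(ξ : ℂ) - ζ‖) = ‖(ξ : ℂ) - ζ‖ - ‖(η : ℂ) - ζ‖ := by ring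
    rw [e]
    refine (abs_norm_sub_norm_le _ _).trans ?_
    rw [sub_sub_sub_cancel_right, norm_sub_rev]

theorem exists_integral_circleTent (ζ : Circle) {δ : ℝ} (hδ : 0 < δ) :
    ∃ A : ℝ, 0 < A ∧ ∫ ξ, circleTent ζ δ ξ ∂circleMeasure = A := by
  have hc : Continuous fun ξ : Circle => max 0 (δ - ‖(ξ : ℂ) - ζ‖) := by fun_prop
  refine ⟨∫ ξ : Circle, max 0 (δ - ‖(ξ : ℂ) - ζ‖) ∂circleMeasure, ?_, ?_⟩
  · refine hc.integral_pos_of_hasCompactSupport_nonneg_nonzero (HasCompactSupport.of_compactSpace _)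
      (fun ξ => le_max_left _ _) (x := ζ) ?_
    simp [hδ.le, hδ.ne']
  · exact integral_complex_ofReal

/-! ### The Riesz product estimate -/

/-- A unimodular number (or zero) that rotates `b` to `|b|`. -/
noncomputable def unitConj (b : ℂ) : ℂ := conj b / ‖b‖

theorem norm_unitConj_le (b : ℂ) : ‖unitConj b‖ ≤ 1 := by
  rw [unitConj, norm_div, RCLike.norm_conj, Complex.norm_real, norm_norm]
  exact div_self_le_one _

theorem unitConj_mul (b : ℂ) : unitConj b * b = ‖b‖ := by
  rcases eq_or_ne b 0 with rfl | hb
  · simp [unitConj]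
  · have h : (‖b‖ : ℂ) ≠ 0 := by simpa using hb
    rw [unitConj, div_mul_eq_mul_div, Complex.conj_mul', pow_two, mul_div_assoc, div_self h, mul_one]

namespace IsBoundaryMap

variable {f : ℂ → ℂ} {T : Circle → Circle}

/-- The product is nonnegative, so the modulus falls on `G` alone. This controls the tail of the
series, which depends on `T^N` only. -/
theorem integral_norm_rieszProduct_mul_comp (hT : IsBoundaryMap f T) (N : ℕ)
    {c : ℕ → ℂ} (hc : ∀ n, ‖c n‖ ≤ 1) {G : Circle → ℂ} (hG : Integrable G circleMeasure) :
    ∫ ξ, ‖(rieszProduct (boundaryDiff f T) T N c ξ : ℂ) * G (T^[N] ξ)‖ ∂circleMeasure =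
      ∫ ξ, ‖G ξ‖ ∂circleMeasure := by
  have h := hT.integral_rieszProduct_mul_comp N hc (G := fun ξ => (‖G ξ‖ : ℂ)) hG.norm.ofReal
  have e : ∀ ξ, ‖(rieszProduct (boundaryDiff f T) T N c ξ : ℂ) * G (T^[N] ξ)‖ =
      rieszProduct (boundaryDiff f T) T N c ξ * ‖G (T^[N] ξ)‖ := fun ξ => by
    rw [norm_mul, Complex.norm_real,
      Real.norm_of_nonneg (rieszProduct_mem hT.norm_boundaryDiff_le T N hc ξ).1]
  simp_rw [e]
  simp_rw [← Complex.ofReal_mul] at h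
  rw [integral_complex_ofReal, integral_complex_ofReal] at h
  exact_mod_cast h

theorem integral_norm_rieszProduct (hT : IsBoundaryMap f T) (N : ℕ)
    {c : ℕ → ℂ} (hc : ∀ n, ‖c n‖ ≤ 1) :
    ∫ ξ, ‖(rieszProduct (boundaryDiff f T) T N c ξ : ℂ)‖ ∂circleMeasure = 1 := by
  simpa using hT.integral_norm_rieszProduct_mul_comp N hc (G := fun _ => 1) (integrable_const _)

/-- Lower bound for the middle block of the series against a Riesz product. -/
theorem le_re_integral_rieszProduct_mul_iterateSum (hT : IsBoundaryMap f T) (b : ℕ → ℂ) (N : ℕ) :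
    (1 - ‖dslope f 0 0‖ ^ 2) / 16 * ∑ n ∈ Finset.range N, ‖b n‖ ≤
      (∫ ξ, (rieszProduct (boundaryDiff f T) T N (fun n => unitConj (b n)) ξ : ℂ) *
        iterateSum (boundaryDiff f T) T b N ξ ∂circleMeasure).re := by
  have hc : ∀ n, ‖unitConj (b n)‖ ≤ 1 := fun n => norm_unitConj_le _
  have hd : Integrable (boundaryDiff f T) circleMeasure := by
    simpa using hT.integrable_boundaryDiff_mul (G := fun _ => 1) (integrable_const _)
  have hd' : ∀ n, Integrable (fun ξ => b n * boundaryDiff f T (T^[n] ξ)) circleMeasure := fun n =>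
    ((hT.measurePreserving.iterate n).integrable_comp_of_integrable hd).const_mul (b n)
  simp only [iterateSum, Finset.mul_sum]
  rw [integral_finsetSum _ fun n _ => hT.integrable_rieszProduct_mul N hc (hd' n), Complex.re_sum]
  refine Finset.sum_le_sum fun n hn => ?_
  have h := hT.le_re_mul_integral_boundaryDiff_mul_rieszProduct (Finset.mem_range.1 hn) hc
    (unitConj_mul (b n))
  rw [← integral_const_mul] at h
  refine h.trans (le_of_eq ?_)
  congr 2
  ext ξ
  ring

theorem integral_norm_rieszProduct_mul_iterateSum_le (hT : IsBoundaryMap f T) (b : ℕ → ℂ)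
    (M N : ℕ) {c : ℕ → ℂ} (hc : ∀ n, ‖c n‖ ≤ 1) :
    ∫ ξ, ‖(rieszProduct (boundaryDiff f T) T N c ξ : ℂ) * iterateSum (boundaryDiff f T) T b M ξ‖
      ∂circleMeasure ≤ 2 * ∑ n ∈ Finset.range M, ‖b n‖ := by
  have hQ := hT.integrable_rieszProduct N hc
  have h : ∫ ξ, ‖(rieszProduct (boundaryDiff f T) T N c ξ : ℂ) *
      iterateSum (boundaryDiff f T) T b M ξ‖ ∂circleMeasure ≤
      ∫ ξ, (2 * ∑ n ∈ Finset.range M, ‖b n‖) *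
        ‖(rieszProduct (boundaryDiff f T) T N c ξ : ℂ)‖ ∂circleMeasure := by
    refine integral_mono (hT.integrable_rieszProduct_mul N hc (hT.integrable_iterateSum b M)).norm
      (hQ.norm.const_mul _) fun ξ => ?_
    rw [norm_mul, mul_comm]
    exact mul_le_mul_of_nonneg_right (hT.norm_iterateSum_le b M ξ) (norm_nonneg _)
  rwa [integral_const_mul, hT.integral_norm_rieszProduct N hc, mul_one] at h

/-- If the `L¹` sum of the series is bounded on an open arc, then a block of coefficients is
bounded in `ℓ¹`, uniformly in its length. -/
theorem sum_norm_le_of_bounded (hT : IsBoundaryMap f T) {b : ℕ → ℂ}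
    (hb : Summable fun n => ‖b n‖ ^ 2) {Φ : Circle → ℂ} (hΦ : Integrable Φ circleMeasure)
    (hlim : Tendsto (fun N => ∫ ξ, ‖iterateSum (boundaryDiff f T) T b N (T ξ) - Φ ξ‖
      ∂circleMeasure) atTop (𝓝 0))
    {ζ : Circle} {δ M A : ℝ} (hA : 0 < A) (hM0 : 0 ≤ M)
    (hM : ∀ᵐ ξ : Circle ∂circleMeasure, ‖(ξ : ℂ) - ζ‖ < δ → ‖Φ ξ‖ ≤ M)
    {K : ℕ} (hK : ∀ H : Circle → ℂ, Integrable H circleMeasure →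
      ‖∫ ξ, circleTent ζ δ ξ * H (T^[K + 1] ξ) ∂circleMeasure - A * ∫ ξ, H ξ ∂circleMeasure‖ ≤
      A * (1 - ‖dslope f 0 0‖ ^ 2) / 64 * ∫ ξ, ‖H ξ‖ ∂circleMeasure) (N : ℕ) :
    A * (1 - ‖dslope f 0 0‖ ^ 2) / 32 * ∑ n ∈ Finset.range N, ‖b (K + n)‖ ≤
      2 * A * (M + 2 * ∑ n ∈ Finset.range K, ‖b n‖ + √(∑' n, ‖b n‖ ^ 2)) := by
  set κ := 1 - ‖dslope f 0 0‖ ^ 2 with hκ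
  have hκ1 : κ ≤ 1 := by rw [hκ]; linarith [sq_nonneg ‖dslope f 0 0‖]
  set d := boundaryDiff f T
  set φ := circleTent ζ δ
  set c : ℕ → ℂ := fun n => unitConj (b (K + n))
  have hc : ∀ n, ‖c n‖ ≤ 1 := fun n => norm_unitConj_le _
  set Q := rieszProduct d T N c
  have hQi : Integrable (fun ξ => (Q ξ : ℂ)) circleMeasure := hT.integrable_rieszProduct N hc
  have hQ0 : ∀ ξ, 0 ≤ Q ξ := fun ξ => (rieszProduct_mem hT.norm_boundaryDiff_le T N hc ξ).1
  have hmpK := hT.measurePreserving.iterate (K + 1)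
  have hcomp : ∀ {H : Circle → ℂ}, Integrable H circleMeasure →
      Integrable (fun ξ => φ ξ * H (T^[K + 1] ξ)) circleMeasure := fun hH =>
    integrable_mul_comp hmpK φ hH
  -- Since `κ ≤ 1`, the equidistribution error is at most the main term; hence the factor `2 A`.
  have hup : ∀ H : Circle → ℂ, Integrable H circleMeasure →
      ‖∫ ξ, φ ξ * H (T^[K + 1] ξ) ∂circleMeasure‖ ≤ 2 * A * ∫ ξ, ‖H ξ‖ ∂circleMeasure := by
    intro H hH
    have h1 := norm_sub_norm_le (∫ ξ, φ ξ * H (T^[K + 1] ξ) ∂circleMeasure)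
      (A * ∫ ξ, H ξ ∂circleMeasure)
    have h2 := hK H hH
    have h3 : ‖(A : ℂ) * ∫ ξ, H ξ ∂circleMeasure‖ ≤ A * ∫ ξ, ‖H ξ‖ ∂circleMeasure := by
      rw [norm_mul, Complex.norm_real, Real.norm_of_nonneg hA.le]
      exact mul_le_mul_of_nonneg_left (norm_integral_le_integral_norm _) hA.le
    have h4 : A * κ / 64 * ∫ ξ, ‖H ξ‖ ∂circleMeasure ≤ A * ∫ ξ, ‖H ξ‖ ∂circleMeasure := by
      refine mul_le_mul_of_nonneg_right ?_ (integral_nonneg fun ξ => norm_nonneg _)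
      nlinarith
    linarith
  have hφ0 : ∀ ξ, ‖φ ξ‖ * Q (T^[K + 1] ξ) = ‖φ ξ * Q (T^[K + 1] ξ)‖ := fun ξ => by
    rw [norm_mul, Complex.norm_real, Real.norm_of_nonneg (hQ0 _)]
  have hφn : ∀ ξ, ((‖φ ξ‖ : ℝ) : ℂ) = φ ξ := fun ξ => by
    simp only [φ, circleTent, ContinuousMap.coe_mk, Complex.norm_real]
    rw [Real.norm_of_nonneg (le_max_left _ _)]
  -- The test weight `φ · Q ∘ T^[K + 1]` is nonnegative, so its `L¹` norm is its integral, bounded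
  -- uniformly in `N`.
  have hW : ∫ ξ, ‖φ ξ * Q (T^[K + 1] ξ)‖ ∂circleMeasure ≤ 2 * A := by
    have h1 := hup _ hQi
    rw [hT.integral_norm_rieszProduct N hc, mul_one] at h1
    refine le_trans (le_of_eq ?_) h1
    have h2 : ∫ ξ, φ ξ * Q (T^[K + 1] ξ) ∂circleMeasure =
        ((∫ ξ, ‖φ ξ * Q (T^[K + 1] ξ)‖ ∂circleMeasure : ℝ) : ℂ) := by
      rw [← integral_complex_ofReal]
      congr 1
      ext ξ
      rw [← hφ0, Complex.ofReal_mul, hφn]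
    rw [h2, Complex.norm_real, Real.norm_of_nonneg (integral_nonneg fun ξ => norm_nonneg _)]
  have hWi := hcomp hQi
  have hmid : ‖∫ ξ, φ ξ * (Q (T^[K + 1] ξ) * iterateSum d T (fun n => b (K + n)) N (T^[K + 1] ξ))
      ∂circleMeasure - A * ∫ ξ, Q ξ * iterateSum d T (fun n => b (K + n)) N ξ ∂circleMeasure‖ ≤
      A * κ / 64 * (2 * ∑ n ∈ Finset.range N, ‖b (K + n)‖) := by
    have hi := hT.integrable_rieszProduct_mul N hc (hT.integrable_iterateSum (fun n => b (K + n)) N)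
    refine (hK _ hi).trans (mul_le_mul_of_nonneg_left
      (hT.integral_norm_rieszProduct_mul_iterateSum_le _ N N hc) ?_)
    have h0 : 0 ≤ κ := (norm_nonneg _).trans hT.norm_second_coeff_le
    positivity
  have hmid2 := hT.le_re_integral_rieszProduct_mul_iterateSum (fun n => b (K + n)) N
  set I₂ := ∫ ξ, φ ξ * (Q (T^[K + 1] ξ) * iterateSum d T (fun n => b (K + n)) N (T^[K + 1] ξ))
      ∂circleMeasure with hI₂
  set S := ∑ n ∈ Finset.range N, ‖b (K + n)‖
  -- The Riesz product gives `A κ S / 16`, and equidistribution loses `(A κ / 64) · 2 S`, half of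
  -- it; the denominator `64` in the hypothesis is chosen for this.
  have hlow : A * κ / 32 * S ≤ ‖I₂‖ := by
    have h1 := (Complex.abs_re_le_norm _).trans hmid
    rw [Complex.sub_re, Complex.re_ofReal_mul] at h1
    have h2 := (abs_le.1 h1).1
    have h3 := mul_le_mul_of_nonneg_left hmid2 hA.le
    have h4 := Complex.re_le_norm I₂
    have h5 : A * (κ / 16 * S) = A * κ / 32 * S + A * κ / 64 * (2 * S) := by ring
    change A * (κ / 16 * S) ≤ _ at h3
    refine le_trans ?_ h4
    rw [h5] at h3
    linarith
  -- The sum splits at `K` and `K + N`: the head is bounded pointwise, the middle is `I₂`, and the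
  -- tail is bounded in `L¹` independently of `L`.
  have hbound : ∀ L : ℕ, ‖I₂‖ ≤ ‖∫ ξ, φ ξ * Q (T^[K + 1] ξ) * iterateSum d T b (K + N + L) (T ξ)
      ∂circleMeasure‖ + 2 * A * (2 * ∑ n ∈ Finset.range K, ‖b n‖ + √(∑' n, ‖b n‖ ^ 2)) := by
    intro L
    have hτi := hT.integrable_iterateSum (fun n => b (K + N + n)) L
    have hτN : Integrable (fun ξ => iterateSum d T (fun n => b (K + N + n)) L (T^[N] ξ))
        circleMeasure := (hT.measurePreserving.iterate N).integrable_comp_of_integrable hτi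
    have hQτ := hT.integrable_rieszProduct_mul N hc hτN
    have i1 : Integrable (fun ξ => φ ξ * Q (T^[K + 1] ξ) * iterateSum d T b K (T ξ))
        circleMeasure := by
      refine hWi.mul_bdd (c := 2 * ∑ n ∈ Finset.range K, ‖b n‖)
        ((hT.measurable_iterateSum b K).comp hT.measurable).aestronglyMeasurable
        (.of_forall fun ξ => hT.norm_iterateSum_le b K _)
    have i2 := hcomp (hT.integrable_rieszProduct_mul N hc
      (hT.integrable_iterateSum (fun n => b (K + n)) N))
    have i3 := hcomp hQτ
    have e : ∀ ξ, φ ξ * Q (T^[K + 1] ξ) * iterateSum d T b (K + N + L) (T ξ) =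
        φ ξ * Q (T^[K + 1] ξ) * iterateSum d T b K (T ξ) +
        (φ ξ * (Q (T^[K + 1] ξ) * iterateSum d T (fun n => b (K + n)) N (T^[K + 1] ξ)) +
        φ ξ * (Q (T^[K + 1] ξ) * iterateSum d T (fun n => b (K + N + n)) L
          (T^[N] (T^[K + 1] ξ)))) := fun ξ => by
      rw [iterateSum_add, iterateSum_add]
      simp only [Function.iterate_succ_apply]
      rw [add_comm K N, Function.iterate_add_apply]
      ring
    have h1 : ‖∫ ξ, φ ξ * Q (T^[K + 1] ξ) * iterateSum d T b K (T ξ) ∂circleMeasure‖ ≤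
        2 * A * (2 * ∑ n ∈ Finset.range K, ‖b n‖) := by
      refine (norm_integral_le_of_norm_le (hWi.norm.mul_const (2 * ∑ n ∈ Finset.range K, ‖b n‖))
        (.of_forall fun ξ => ?_)).trans ?_
      · rw [norm_mul]
        exact mul_le_mul_of_nonneg_left (hT.norm_iterateSum_le b K _) (norm_nonneg _)
      · rw [integral_mul_const]
        exact mul_le_mul_of_nonneg_right hW (by positivity)
    have h3 : ‖∫ ξ, φ ξ * (Q (T^[K + 1] ξ) * iterateSum d T (fun n => b (K + N + n)) L
          (T^[N] (T^[K + 1] ξ))) ∂circleMeasure‖ ≤ 2 * A * √(∑' n, ‖b n‖ ^ 2) := by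
      refine (hup _ hQτ).trans (mul_le_mul_of_nonneg_left ?_ (by positivity))
      rw [hT.integral_norm_rieszProduct_mul_comp N hc hτi]
      refine (hT.integral_norm_iterateSum_le _ _).trans (Real.sqrt_le_sqrt ?_)
      have hs : Summable fun n => ‖b (K + N + n)‖ ^ 2 := by
        simp_rw [add_comm (K + N)]
        exact (summable_nat_add_iff (K + N)).2 hb
      refine (hs.sum_le_tsum _ fun _ _ => by positivity).trans ?_
      exact hs.tsum_le_tsum_of_inj (fun n => K + N + n) (add_right_injective _)
        (fun _ _ => by positivity) (fun _ => le_rfl) hb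
    simp_rw [e]
    have h4 : Integrable (fun ξ => φ ξ * (Q (T^[K + 1] ξ) *
        iterateSum d T (fun n => b (K + n)) N (T^[K + 1] ξ)) +
        φ ξ * (Q (T^[K + 1] ξ) * iterateSum d T (fun n => b (K + N + n)) L
          (T^[N] (T^[K + 1] ξ)))) circleMeasure := i2.add i3
    rw [integral_add i1 h4, integral_add i2 i3, ← hI₂]
    set I₁ := ∫ ξ, φ ξ * Q (T^[K + 1] ξ) * iterateSum d T b K (T ξ) ∂circleMeasure
    set I₃ := ∫ ξ, φ ξ * (Q (T^[K + 1] ξ) * iterateSum d T (fun n => b (K + N + n)) L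
          (T^[N] (T^[K + 1] ξ))) ∂circleMeasure
    have h5 : ‖I₂‖ ≤ ‖I₁ + (I₂ + I₃)‖ + (‖I₁‖ + ‖I₃‖) := by
      calc ‖I₂‖ = ‖(I₁ + (I₂ + I₃)) - (I₁ + I₃)‖ := by congr 1; ring
        _ ≤ ‖I₁ + (I₂ + I₃)‖ + ‖I₁ + I₃‖ := norm_sub_le _ _
        _ ≤ _ := by gcongr; exact norm_add_le _ _
    linarith
  have hWm : ∀ ξ, ‖φ ξ * (Q (T^[K + 1] ξ) : ℂ)‖ ≤ ‖φ‖ * 2 ^ N := fun ξ => by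
    rw [norm_mul, Complex.norm_real, Real.norm_of_nonneg (hQ0 _)]
    exact mul_le_mul (φ.norm_coe_le_norm ξ)
      (rieszProduct_mem hT.norm_boundaryDiff_le T N hc _).2 (hQ0 _) (norm_nonneg _)
  have hWΦ : Integrable (fun ξ => φ ξ * Q (T^[K + 1] ξ) * Φ ξ) circleMeasure :=
    hΦ.bdd_mul (c := ‖φ‖ * 2 ^ N) hWi.aestronglyMeasurable (.of_forall hWm)
  -- For fixed `N` the weight is bounded, so `L¹` convergence of the series suffices. The bound `‖φ‖
  -- * 2 ^ N` is used only here and for integrability, not in the final estimate.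
  have hconv : Tendsto (fun L : ℕ => ∫ ξ, φ ξ * Q (T^[K + 1] ξ) *
      iterateSum d T b (K + N + L) (T ξ) ∂circleMeasure) atTop
      (𝓝 (∫ ξ, φ ξ * Q (T^[K + 1] ξ) * Φ ξ ∂circleMeasure)) := by
    rw [tendsto_iff_norm_sub_tendsto_zero]
    have hlim' : Tendsto (fun L : ℕ => ∫ ξ, ‖iterateSum d T b (K + N + L) (T ξ) - Φ ξ‖
        ∂circleMeasure) atTop (𝓝 0) :=
      hlim.comp (tendsto_atTop_mono (fun L => Nat.le_add_left L (K + N)) tendsto_id)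
    have h4 := hlim'.const_mul (‖φ‖ * 2 ^ N)
    rw [mul_zero] at h4
    refine squeeze_zero (fun _ => norm_nonneg _) (fun L => ?_) h4
    have hi : Integrable (fun ξ => iterateSum d T b (K + N + L) (T ξ)) circleMeasure :=
      hT.integrable_comp (hT.integrable_iterateSum b _)
    rw [← integral_sub (hi.bdd_mul (c := ‖φ‖ * 2 ^ N) hWi.aestronglyMeasurable (.of_forall hWm))
      hWΦ, ← integral_const_mul]
    refine norm_integral_le_of_norm_le ((hi.sub hΦ).norm.const_mul _) (.of_forall fun ξ => ?_)
    rw [← mul_sub, norm_mul]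
    exact mul_le_mul_of_nonneg_right (hWm ξ) (norm_nonneg _)
  have hΦb : ‖∫ ξ, φ ξ * Q (T^[K + 1] ξ) * Φ ξ ∂circleMeasure‖ ≤ 2 * A * M := by
    refine (norm_integral_le_of_norm_le (hWi.norm.mul_const M) ?_).trans ?_
    · filter_upwards [hM] with ξ hξ
      rw [norm_mul]
      -- The tent vanishes outside the ball of radius `δ`, so only the bound for `Φ` on the arc is
      -- needed.
      by_cases h : ‖(ξ : ℂ) - ζ‖ < δ
      · exact mul_le_mul_of_nonneg_left (hξ h) (norm_nonneg _)
      · have : φ ξ = 0 := by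
          simp only [φ, circleTent, ContinuousMap.coe_mk, Complex.ofReal_eq_zero]
          exact max_eq_left (by linarith [not_lt.1 h])
        simp [this]
    · rw [integral_mul_const]
      exact mul_le_mul_of_nonneg_right hW hM0
  have hfin : ‖I₂‖ ≤ 2 * A * M + 2 * A * (2 * ∑ n ∈ Finset.range K, ‖b n‖ + √(∑' n, ‖b n‖ ^ 2)) :=
    (ge_of_tendsto' (hconv.norm.add_const _) hbound).trans (by gcongr)
  refine (hlow.trans hfin).trans (le_of_eq ?_)
  ring

end IsBoundaryMap

/-! ### Conclusion -/

theorem theorem1p5 (f : ℂ → ℂ) (hf : IsInner f) (hf0 : f 0 = 0) (hrot : ¬ IsDiscRotation f)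
    (a : ℕ → ℂ) (ha : Summable (fun n : ℕ => ‖a (n + 1)‖ ^ 2))
    (α β : ℝ) (hαβ : α < β) (hF : EssBoundedOnArc (iterateSeries f a) α β) :
    Summable (fun n : ℕ => ‖a (n + 1)‖) := by
  obtain ⟨T, hT⟩ := hf.exists_isBoundaryMap hf0
  have hq : ‖conj (dslope f 0 0)‖ < 1 := by
    rw [RCLike.norm_conj]
    exact hT.norm_dslope_lt_one hrot (by simp)
  have hb := summable_norm_sq_geometricConv hq ha
  obtain ⟨Φ, hΦ, hlim⟩ := hT.exists_tendsto_iterateSum hb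
  obtain ⟨M, hM0, hM⟩ := hF.exists_ae_norm_le hΦ fun z hz =>
    hT.iterateSeries_eq_integral_poissonKernel hrot ha hΦ hlim hz
  -- The arc is open in the circle, so it contains a chordal ball about its midpoint, on which the
  -- tent lives.
  have hopen : IsOpen ((fun t : ℝ => Circle.exp t) '' Ioo α β) :=
    isLocalHomeomorph_circleExp.isOpenMap _ isOpen_Ioo
  obtain ⟨δ, hδ, hball⟩ := Metric.isOpen_iff.1 hopen (Circle.exp ((α + β) / 2))
    ⟨(α + β) / 2, ⟨by linarith, by linarith⟩, rfl⟩
  set ζ := Circle.exp ((α + β) / 2)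
  obtain ⟨A, hA, hAeq⟩ := exists_integral_circleTent ζ hδ
  have hκ : 0 < 1 - ‖dslope f 0 0‖ ^ 2 := by
    rw [RCLike.norm_conj] at hq
    nlinarith [norm_nonneg (dslope f 0 0)]
  obtain ⟨K, hK⟩ := hT.exists_forall_norm_integral_mul_iterate_sub_le hrot (circleTent ζ δ)
    zero_le_one (norm_circleTent_sub_le ζ δ)
    (ε := A * (1 - ‖dslope f 0 0‖ ^ 2) / 64) (by positivity)
  rw [hAeq] at hK
  have hM' : ∀ᵐ ξ : Circle ∂circleMeasure, ‖(ξ : ℂ) - ζ‖ < δ → ‖Φ ξ‖ ≤ M := by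
    filter_upwards [hM] with ξ hξ h
    refine hξ (hball ?_)
    rw [Metric.mem_ball]
    exact (dist_eq_norm (ξ : ℂ) ζ).trans_lt h
  refine summable_norm_of_summable_norm_geometricConv (q := conj (dslope f 0 0)) ?_
  rw [← summable_nat_add_iff K]
  -- The block starting at coefficient `K` is composed with `T^[K + 1]`, so equidistribution is used
  -- at `K + 1`. The resulting bound does not depend on the length of the block.
  have hsum := hT.sum_norm_le_of_bounded hb hΦ hlim hA hM0 hM' (hK (K + 1) (Nat.le_succ K))
  have hAκ : 0 < A * (1 - ‖dslope f 0 0‖ ^ 2) / 32 := by positivity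
  obtain ⟨C, hC⟩ : ∃ C, ∀ N, A * (1 - ‖dslope f 0 0‖ ^ 2) / 32 * ∑ n ∈ Finset.range N,
      ‖geometricConv (conj (dslope f 0 0)) (fun n => a (n + 1)) (K + n)‖ ≤ C := ⟨_, hsum⟩
  refine summable_of_sum_range_le (c := C / (A * (1 - ‖dslope f 0 0‖ ^ 2) / 32))
    (fun _ => norm_nonneg _) fun N => ?_
  simp_rw [add_comm _ K]
  exact (le_div_iff₀' hAκ).2 (hC N)
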